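/- Let $a>0$, let $S=S^*$ and $T=(t_{jk})$ be complex $2\times2$ matrices, and let at least two entries of $T$ be nonzero. Consider the square lattice graph with vertices $(ma,na)$, $m,n\in\mathbb Z$, and edges of length $a$ joining neighbouring vertices, and let $H$ be the Hamiltonian acting as $-\frac{\mathrm d^2}{\mathrm dx^2}$ on each edge, in the orthogonal sum of the $L^2$ spaces of the edges, with the domain consisting of the $\psi$ that are $W^{2,2}$ on every edge with $\psi''$ square integrable over the whole graph, and that satisfy at every vertex $$\begin{pmatrix} I & T\\ 0&0\end{pmatrix}\Psi'=\begin{pmatrix} S&0\\ -T^*& I\end{pmatrix}\Psi .$$ Here $\Psi,\Psi'\in\mathbb C^4$ are the vectors of the boundary values and of the outward derivatives at the vertex, in the order left, right, lower, upper edge. Let $\sigma(H)$ be its spectrum, and put $$K_c=4\sum_{j,k}|t_{jk}|^2,\qquad K_s=4\left(1+|t_{11}t_{22}-t_{12}t_{21}|^2\right),$$ $$L_c(\theta_1,\theta_2)=8\left[-\Re\left((t_{11}\overline{t_{21}}+t_{12}\overline{t_{22}})e^{i\theta_1}\right)+\Re\left((t_{22}\overline{t_{21}}+\overline{t_{11}}t_{12})e^{i\theta_2}\right)\right],$$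 $$L(\theta_1,\theta_2)=8\Re\left(t_{11}\overline{t_{22}}e^{i(\theta_1-\theta_2)}\right)+8\Re\left(t_{12}\overline{t_{21}}e^{i(\theta_1+\theta_2)}\right),$$ $$V_2(x,\theta_1,\theta_2)=-K_c\cos^2x+K_s\sin^2x+\cos x\,L_c(\theta_1,\theta_2)+L(\theta_1,\theta_2).$$ Let $V_2^+(x)$ and $V_2^-(x)$ be the maximum and the minimum of $V_2(x,\theta_1,\theta_2)$ over $\theta_1,\theta_2\in(-\pi,\pi]$, and let $L_0^+=\max(L_c+L)$ and $L^-_{\pi/2}=\min L$ over the same set. In particular $V_2^+(0)=-K_c+L_0^+$ and $V_2^-(\pi/2)=K_s+L^-_{\pi/2}$. Then: 1. If $L_0^+>K_c$ and $L^-_{\pi/2}<-K_s$, there is a $k_0>0$ with $[k_0^2,\infty)\subset\sigma(H)$. 2. If $L_0^+<K_c$, there is exactly one $b\in(0,\frac\pi2)$ with $V_2^+(b)=0$, and the spectrum has asymptotically gaps of the form $$\left(\frac{n^2\pi^2}{a^2}-\frac{2bn\pi}{a^2}+\mathcal O(1),\ \frac{n^2\pi^2}{a^2}+\frac{2bn\pi}{a^2}+\mathcal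 O(1)\right).$$ 3. If $L^-_{\pi/2}>-K_s$, there is exactly one $c\in(0,\frac\pi2)$ with $V_2^-(\frac\pi2-c)=0$, and the spectrum has asymptotically gaps of the form $$\left(\left(n+\tfrac12\right)^2\frac{\pi^2}{a^2}-\frac{2cn\pi}{a^2}+\mathcal O(1),\ \left(n+\tfrac12\right)^2\frac{\pi^2}{a^2}+\frac{2cn\pi}{a^2}+\mathcal O(1)\right).$$ Here "the spectrum has asymptotically gaps of the form $(l_n+\mathcal O(1),r_n+\mathcal O(1))$" means that there are real sequences $\alpha_n=l_n+\mathcal O(1)$, $\beta_n=r_n+\mathcal O(1)$ such that for all sufficiently large $n$ the open interval $(\alpha_n,\beta_n)$ is nonempty and disjoint from $\sigma(H)$, while $\alpha_n,\beta_n\in\sigma(H)$. -/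

import Mathlib

open MeasureTheory Set Filter

noncomputable section

namespace SquareLattice

/-! Functions on the square lattice with vertices `(m a, n a)`. -/

/-- The two directions of edges. -/
inductive Direction
  | horizontal
  | vertical

/-- The edge `((m, n), horizontal)` joins `(m a, n a)` to `((m + 1) a, n a)`; the edge
`((m, n), vertical)` joins `(m a, n a)` to `(m a, (n + 1) a)`. In both cases the edge is
parametrized by `(0, a)`, with `0` at the vertex `(m a, n a)`. -/
abbrev Edge := (ℤ × ℤ) × Direction

/-- `L²` of one edge. -/
abbrev EdgeSpace (a : ℝ) := Lp ℂ 2 (volume.restrict (Ioo (0 : ℝ) a))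

/-- The state space: the Hilbert space orthogonal sum of the `L²` spaces of the edges. -/
abbrev StateSpace (a : ℝ) := lp (fun _ : Edge => EdgeSpace a) 2

/-- `u ∈ W^{2,2}(0, a)`, with second derivative `w ∈ L²(0, a)`: the function `f` is the
continuously differentiable representative of `u` on `[0, a]`, and its derivative `g` is
absolutely continuous with derivative `w`. -/
structure IsSobolevRep (a : ℝ) (u w : EdgeSpace a) (f g : ℝ → ℂ) : Prop where
  ae_eq : ∀ᵐ x ∂(volume.restrict (Ioo (0 : ℝ) a)), u x = f x
  prim : ∀ x ∈ Icc (0 : ℝ) a, f x = f 0 + ∫ t in (0 : ℝ)..x, g t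
  prim' : ∀ x ∈ Icc (0 : ℝ) a, g x = g 0 + ∫ t in (0 : ℝ)..x, w t

/-- The vector `Ψ(0)` of boundary values at the vertex `(m a, n a)`, in the order
left, right, lower, upper edge. -/
def boundaryValue (a : ℝ) (f : Edge → ℝ → ℂ) (m n : ℤ) : Fin 2 ⊕ Fin 2 → ℂ :=
  Sum.elim ![f ((m - 1, n), .horizontal) a, f ((m, n), .horizontal) 0]
    ![f ((m, n - 1), .vertical) a, f ((m, n), .vertical) 0]

/-- The vector `Ψ'(0)` of derivatives at the vertex `(m a, n a)`, taken in the direction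
away from the vertex, where `g e` is the derivative on the edge `e`. -/
def boundaryDeriv (a : ℝ) (g : Edge → ℝ → ℂ) (m n : ℤ) : Fin 2 ⊕ Fin 2 → ℂ :=
  Sum.elim ![-g ((m - 1, n), .horizontal) a, g ((m, n), .horizontal) 0]
    ![-g ((m, n - 1), .vertical) a, g ((m, n), .vertical) 0]

/-- The vertex coupling in the `ST`-form, for `m = 2`. -/
def VertexCoupling (S T : Matrix (Fin 2) (Fin 2) ℂ) (Ψ Ψ' : Fin 2 ⊕ Fin 2 → ℂ) : Prop :=
  (Matrix.fromBlocks 1 T 0 0).mulVec Ψ' = (Matrix.fromBlocks S 0 (-T.conjTranspose) 1).mulVec Ψ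

theorem integrableOn_edge {a : ℝ} (u : EdgeSpace a) : IntegrableOn u (Ioo 0 a) := by
  have h : MemLp u 2 (volume.restrict (Ioo (0 : ℝ) a)) := Lp.memLp u
  exact h.integrable (by norm_num)

theorem intervalIntegrable_edge {a : ℝ} (u : EdgeSpace a) {x : ℝ} (hx : x ∈ Icc 0 a) :
    IntervalIntegrable u volume 0 x := by
  rw [intervalIntegrable_iff_integrableOn_Ioo_of_le hx.1]
  exact (integrableOn_edge u).mono_set (Ioo_subset_Ioo_right hx.2)

theorem integral_congr_edge {a : ℝ} {u v : ℝ → ℂ}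
    (h : ∀ᵐ x ∂(volume.restrict (Ioo (0 : ℝ) a)), u x = v x) {x : ℝ} (hx : x ∈ Icc 0 a) :
    ∫ t in (0 : ℝ)..x, u t = ∫ t in (0 : ℝ)..x, v t := by
  rw [intervalIntegral.integral_of_le hx.1, intervalIntegral.integral_of_le hx.1,
    integral_Ioc_eq_integral_Ioo, integral_Ioc_eq_integral_Ioo]
  exact integral_congr_ae (ae_restrict_of_ae_restrict_of_subset (Ioo_subset_Ioo_right hx.2) h)

theorem IsSobolevRep.continuousOn_deriv {a : ℝ} {u w : EdgeSpace a} {f g : ℝ → ℂ}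
    (h : IsSobolevRep a u w f g) : ContinuousOn g (Icc 0 a) := by
  rcases le_or_gt 0 a with ha | ha
  · have h1 : IntegrableOn w (uIcc 0 a) := by
      rw [uIcc_of_le ha, integrableOn_Icc_iff_integrableOn_Ioo]
      exact integrableOn_edge w
    have h2 := intervalIntegral.continuousOn_primitive_interval h1
    rw [uIcc_of_le ha] at h2
    exact (continuousOn_const.add h2).congr h.prim'
  · simp [Icc_eq_empty (not_le.2 ha)]

theorem IsSobolevRep.intervalIntegrable_deriv {a : ℝ} {u w : EdgeSpace a} {f g : ℝ → ℂ}
    (h : IsSobolevRep a u w f g) {x : ℝ} (hx : x ∈ Icc 0 a) :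
    IntervalIntegrable g volume 0 x := by
  apply ContinuousOn.intervalIntegrable
  rw [uIcc_of_le hx.1]
  exact h.continuousOn_deriv.mono (Icc_subset_Icc_right hx.2)

theorem IsSobolevRep.continuousOn {a : ℝ} {u w : EdgeSpace a} {f g : ℝ → ℂ}
    (h : IsSobolevRep a u w f g) : ContinuousOn f (Icc 0 a) := by
  rcases le_or_gt 0 a with ha | ha
  · have h1 : IntegrableOn g (uIcc 0 a) := by
      rw [uIcc_of_le ha]
      exact h.continuousOn_deriv.integrableOn_Icc
    have h2 := intervalIntegral.continuousOn_primitive_interval h1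
    rw [uIcc_of_le ha] at h2
    exact (continuousOn_const.add h2).congr h.prim
  · simp [Icc_eq_empty (not_le.2 ha)]

theorem IsSobolevRep.add {a : ℝ} {u₁ w₁ u₂ w₂ : EdgeSpace a} {f₁ g₁ f₂ g₂ : ℝ → ℂ}
    (h₁ : IsSobolevRep a u₁ w₁ f₁ g₁) (h₂ : IsSobolevRep a u₂ w₂ f₂ g₂) :
    IsSobolevRep a (u₁ + u₂) (w₁ + w₂) (f₁ + f₂) (g₁ + g₂) where
  ae_eq := by
    filter_upwards [Lp.coeFn_add u₁ u₂, h₁.ae_eq, h₂.ae_eq] with x h e₁ e₂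
    rw [h, Pi.add_apply, Pi.add_apply, e₁, e₂]
  prim x hx := by
    simp only [Pi.add_apply]
    rw [intervalIntegral.integral_add (h₁.intervalIntegrable_deriv hx)
      (h₂.intervalIntegrable_deriv hx), h₁.prim x hx, h₂.prim x hx]
    ring
  prim' x hx := by
    rw [integral_congr_edge (Lp.coeFn_add w₁ w₂) hx]
    simp only [Pi.add_apply]
    rw [intervalIntegral.integral_add (intervalIntegrable_edge w₁ hx)
      (intervalIntegrable_edge w₂ hx), h₁.prim' x hx, h₂.prim' x hx]
    ring

theorem IsSobolevRep.smul {a : ℝ} {u w : EdgeSpace a} {f g : ℝ → ℂ} (c : ℂ)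
    (h : IsSobolevRep a u w f g) : IsSobolevRep a (c • u) (c • w) (c • f) (c • g) where
  ae_eq := by
    filter_upwards [Lp.coeFn_smul c u, h.ae_eq] with x h e
    rw [h, Pi.smul_apply, Pi.smul_apply, e]
  prim x hx := by
    simp only [Pi.smul_apply]
    rw [intervalIntegral.integral_smul, h.prim x hx, smul_add]
  prim' x hx := by
    rw [integral_congr_edge (Lp.coeFn_smul c w) hx]
    simp only [Pi.smul_apply]
    rw [intervalIntegral.integral_smul, h.prim' x hx, smul_add]

/-- An integrable function on `(0, a)` with vanishing primitive vanishes almost everywhere. -/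
theorem ae_zero_of_primitive {a : ℝ} {g : ℝ → ℂ} (hg : IntegrableOn g (Ioo 0 a))
    (h : ∀ x ∈ Icc (0 : ℝ) a, ∫ t in (0 : ℝ)..x, g t = 0) :
    ∀ᵐ x ∂(volume.restrict (Ioo (0 : ℝ) a)), g x = 0 := by
  rcases le_or_gt a 0 with ha | ha
  · simp [Ioo_eq_empty (not_lt.2 ha)]
  have hI : IntervalIntegrable g volume 0 a :=
    (intervalIntegrable_iff_integrableOn_Ioo_of_le ha.le).2 hg
  rw [ae_restrict_iff' measurableSet_Ioo]
  filter_upwards [hI.ae_hasDerivAt_integral] with x hx hxa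
  rw [uIcc_of_le ha.le] at hx
  have h1 := hx (Ioo_subset_Icc_self hxa) 0 (left_mem_Icc.2 ha.le)
  have h2 : HasDerivAt (fun y => ∫ t in (0 : ℝ)..y, g t) 0 x := by
    refine (hasDerivAt_const x (0 : ℂ)).congr_of_eventuallyEq ?_
    filter_upwards [Ioo_mem_nhds hxa.1 hxa.2] with y hy
    exact h y (Ioo_subset_Icc_self hy)
  exact h1.unique h2

theorem eqOn_zero_of_ae {a : ℝ} (ha : 0 < a) {f : ℝ → ℂ} (hf : ContinuousOn f (Icc 0 a))
    (h : ∀ᵐ x ∂(volume.restrict (Ioo (0 : ℝ) a)), f x = 0) : ∀ x ∈ Icc 0 a, f x = 0 := by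
  have h1 : EqOn f (fun _ => 0) (Icc 0 a) := by
    refine Measure.eqOn_Icc_of_ae_eq volume ha.ne ?_ hf continuousOn_const
    rw [← restrict_Ioo_eq_restrict_Icc]
    exact h
  exact h1

theorem IsSobolevRep.eq_zero {a : ℝ} (ha : 0 < a) {w : EdgeSpace a} {f g : ℝ → ℂ}
    (h : IsSobolevRep a 0 w f g) : w = 0 := by
  have h1 : ∀ x ∈ Icc 0 a, f x = 0 := by
    refine eqOn_zero_of_ae ha h.continuousOn ?_
    filter_upwards [h.ae_eq, Lp.coeFn_zero ℂ 2 (volume.restrict (Ioo (0 : ℝ) a))] with x h1 h2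
    rw [← h1, h2, Pi.zero_apply]
  have h0 : (0 : ℝ) ∈ Icc 0 a := left_mem_Icc.2 ha.le
  have h2 : ∀ x ∈ Icc 0 a, g x = 0 := by
    refine eqOn_zero_of_ae ha h.continuousOn_deriv (ae_zero_of_primitive ?_ ?_)
    · exact h.continuousOn_deriv.integrableOn_Icc.mono_set Ioo_subset_Icc_self
    · intro x hx
      have := h.prim x hx
      rw [h1 x hx, h1 0 h0, zero_add] at this
      exact this.symm
  have h3 := ae_zero_of_primitive (integrableOn_edge w) fun x hx => by
      have := h.prim' x hx
      rw [h2 x hx, h2 0 h0, zero_add] at this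
      exact this.symm
  rw [Lp.eq_zero_iff_ae_eq_zero]
  exact h3

/-- The graph of the Hamiltonian: the pairs `(ψ, φ)` of states such that `ψ` is `W^{2,2}` on
every edge, `φ = -ψ''`, and the vertex coupling holds at every vertex. -/
def hamiltonianGraph (a : ℝ) (S T : Matrix (Fin 2) (Fin 2) ℂ) :
    Submodule ℂ (StateSpace a × StateSpace a) where
  carrier := {p | ∃ f g : Edge → ℝ → ℂ, (∀ e, IsSobolevRep a (p.1 e) (-(p.2 e)) (f e) (g e)) ∧
    ∀ m n : ℤ, VertexCoupling S T (boundaryValue a f m n) (boundaryDeriv a g m n)}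
  add_mem' := by
    rintro ⟨ψ₁, φ₁⟩ ⟨ψ₂, φ₂⟩ ⟨f₁, g₁, h₁, c₁⟩ ⟨f₂, g₂, h₂, c₂⟩
    refine ⟨f₁ + f₂, g₁ + g₂, fun e => ?_, fun m n => ?_⟩
    · have h := (h₁ e).add (h₂ e)
      have hw : -φ₁ e + -φ₂ e = -(φ₁ e + φ₂ e) := by abel
      rw [hw] at h
      exact h
    · have e₁ : boundaryValue a (f₁ + f₂) m n = boundaryValue a f₁ m n + boundaryValue a f₂ m n := by
        ext i
        rcases i with i | i <;> fin_cases i <;> simp [boundaryValue]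
      have e₂ : boundaryDeriv a (g₁ + g₂) m n = boundaryDeriv a g₁ m n + boundaryDeriv a g₂ m n := by
        ext i
        rcases i with i | i <;> fin_cases i <;> simp [boundaryDeriv, add_comm]
      have d₁ := c₁ m n
      have d₂ := c₂ m n
      unfold VertexCoupling at d₁ d₂ ⊢
      rw [e₁, e₂, Matrix.mulVec_add, Matrix.mulVec_add, d₁, d₂]
  zero_mem' := by
    refine ⟨0, 0, fun e => ⟨?_, ?_, ?_⟩, fun m n => ?_⟩
    · exact Lp.coeFn_zero ℂ 2 (volume.restrict (Ioo (0 : ℝ) a))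
    · intro x hx
      simp
    · intro x hx
      have h : (-((0 : StateSpace a × StateSpace a).2 e) : EdgeSpace a) = 0 := neg_zero
      rw [h, integral_congr_edge (Lp.coeFn_zero ℂ 2 (volume.restrict (Ioo (0 : ℝ) a))) hx]
      simp
    · have e₁ : boundaryValue a 0 m n = 0 := by
        ext i
        rcases i with i | i <;> fin_cases i <;> simp [boundaryValue]
      have e₂ : boundaryDeriv a 0 m n = 0 := by
        ext i
        rcases i with i | i <;> fin_cases i <;> simp [boundaryDeriv]
      unfold VertexCoupling
      rw [e₁, e₂, Matrix.mulVec_zero, Matrix.mulVec_zero]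
  smul_mem' := by
    rintro c ⟨ψ, φ⟩ ⟨f, g, h, d⟩
    refine ⟨c • f, c • g, fun e => ?_, fun m n => ?_⟩
    · have h' := (h e).smul c
      rw [smul_neg] at h'
      exact h'
    · have e₁ : boundaryValue a (c • f) m n = c • boundaryValue a f m n := by
        ext i
        rcases i with i | i <;> fin_cases i <;> simp [boundaryValue]
      have e₂ : boundaryDeriv a (c • g) m n = c • boundaryDeriv a g m n := by
        ext i
        rcases i with i | i <;> fin_cases i <;> simp [boundaryDeriv]
      have d' := d m n
      unfold VertexCoupling at d' ⊢
      rw [e₁, e₂, Matrix.mulVec_smul, Matrix.mulVec_smul, d']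

/-- The Hamiltonian `H_{S,T}`: the operator `ψ ↦ -ψ''` on the states that are `W^{2,2}` on every
edge, with `ψ''` a state again, and satisfy the vertex coupling at every vertex. -/
def hamiltonian (a : ℝ) (S T : Matrix (Fin 2) (Fin 2) ℂ) : StateSpace a →ₗ.[ℂ] StateSpace a :=
  (hamiltonianGraph a S T).toLinearPMap

/-- The graph of the operator is the relation it is defined from. -/
theorem hamiltonian_graph {a : ℝ} (ha : 0 < a) (S T : Matrix (Fin 2) (Fin 2) ℂ) :
    (hamiltonian a S T).graph = hamiltonianGraph a S T := by
  refine Submodule.toLinearPMap_graph_eq _ ?_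
  rintro ⟨ψ, φ⟩ ⟨f, g, h, -⟩ hψ
  have hψ' : ψ = 0 := hψ
  subst hψ'
  ext1
  funext e
  have h' := (h e).eq_zero ha
  exact neg_eq_zero.1 h'

/-- The spectrum of an operator `A` defined on a subspace of `E`: the complement of the set of
`z` for which `A - z` is a bijection of the domain onto the space with a bounded inverse `R`. -/
def opSpectrum {E : Type*} [NormedAddCommGroup E] [NormedSpace ℂ E] (A : E →ₗ.[ℂ] E) : Set ℂ :=
  {z | ¬ ∃ R : E →L[ℂ] E,
    (∀ y : E, ∃ x : A.domain, (x : E) = R y ∧ A x - z • (x : E) = y) ∧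
    ∀ x : A.domain, R (A x - z • (x : E)) = x}

/-! The quantities that govern the spectrum; `T` has the entries
`T 0 0 = t₁₁`, `T 0 1 = t₁₂`, `T 1 0 = t₂₁`, `T 1 1 = t₂₂`. -/

/-- `e^{iθ}` -/
def phase (θ : ℝ) : ℂ := Complex.exp (Complex.I * θ)

def Kc (T : Matrix (Fin 2) (Fin 2) ℂ) : ℝ :=
  4 * (‖T 0 0‖ ^ 2 + ‖T 1 1‖ ^ 2 + ‖T 0 1‖ ^ 2 + ‖T 1 0‖ ^ 2)

def Ks (T : Matrix (Fin 2) (Fin 2) ℂ) : ℝ :=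
  4 * (1 + ‖T 0 0 * T 1 1 - T 0 1 * T 1 0‖ ^ 2)

def Lc (T : Matrix (Fin 2) (Fin 2) ℂ) (θ₁ θ₂ : ℝ) : ℝ :=
  8 * (-((T 0 0 * star (T 1 0) + T 0 1 * star (T 1 1)) * phase θ₁).re +
    ((T 1 1 * star (T 1 0) + star (T 0 0) * T 0 1) * phase θ₂).re)

def L (T : Matrix (Fin 2) (Fin 2) ℂ) (θ₁ θ₂ : ℝ) : ℝ :=
  8 * (T 0 0 * star (T 1 1) * phase (θ₁ - θ₂)).re +
    8 * (T 0 1 * star (T 1 0) * phase (θ₁ + θ₂)).re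

def V2 (T : Matrix (Fin 2) (Fin 2) ℂ) (x θ₁ θ₂ : ℝ) : ℝ :=
  -Kc T * Real.cos x ^ 2 + Ks T * Real.sin x ^ 2 + Real.cos x * Lc T θ₁ θ₂ + L T θ₁ θ₂

/-- The values of a function of two quasimomentum components in `(-π, π]`. -/
def torusRange (F : ℝ → ℝ → ℝ) : Set ℝ :=
  {y | ∃ θ₁ ∈ Ioc (-Real.pi) Real.pi, ∃ θ₂ ∈ Ioc (-Real.pi) Real.pi, F θ₁ θ₂ = y}

/-- `max {F(θ₁, θ₂) | θ₁, θ₂ ∈ (-π, π]}`; attained for the functions below. -/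
def torusMax (F : ℝ → ℝ → ℝ) : ℝ := sSup (torusRange F)

/-- `min {F(θ₁, θ₂) | θ₁, θ₂ ∈ (-π, π]}`; attained for the functions below. -/
def torusMin (F : ℝ → ℝ → ℝ) : ℝ := sInf (torusRange F)

def V2plus (T : Matrix (Fin 2) (Fin 2) ℂ) (x : ℝ) : ℝ := torusMax (V2 T x)

def V2minus (T : Matrix (Fin 2) (Fin 2) ℂ) (x : ℝ) : ℝ := torusMin (V2 T x)

/-- The constant `L₀⁺`: the maximum of `Lc + L`, so that `V2plus T 0 = -Kc T + L0plus T`. -/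
def L0plus (T : Matrix (Fin 2) (Fin 2) ℂ) : ℝ := torusMax fun θ₁ θ₂ => Lc T θ₁ θ₂ + L T θ₁ θ₂

/-- The constant `L_{π/2}⁻`. -/
def Lpi2minus (T : Matrix (Fin 2) (Fin 2) ℂ) : ℝ := torusMin (L T)

/-- The range is compact and not empty for a continuous function of the two phases, so that the
maximum and the minimum above are attained. -/
theorem isCompact_torusRange {F : ℝ → ℝ → ℝ} (hc : Continuous fun p : ℝ × ℝ => F p.1 p.2)
    (h₁ : ∀ θ₁ θ₂, F (θ₁ + 2 * Real.pi) θ₂ = F θ₁ θ₂)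
    (h₂ : ∀ θ₁ θ₂, F θ₁ (θ₂ + 2 * Real.pi) = F θ₁ θ₂) :
    IsCompact (torusRange F) ∧ (torusRange F).Nonempty := by
  have hpi := Real.pi_pos
  have e : torusRange F = (fun p : ℝ × ℝ => F p.1 p.2) ''
      (Icc (-Real.pi) Real.pi ×ˢ Icc (-Real.pi) Real.pi) := by
    ext y
    constructor
    · rintro ⟨s, hs, t, ht, rfl⟩
      exact ⟨(s, t), ⟨Ioc_subset_Icc_self hs, Ioc_subset_Icc_self ht⟩, rfl⟩
    · rintro ⟨⟨s, t⟩, ⟨hs, ht⟩, rfl⟩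
      have key : ∀ r ∈ Icc (-Real.pi) Real.pi,
          ∃ r' ∈ Ioc (-Real.pi) Real.pi, r' = r ∨ r' = r + 2 * Real.pi := by
        intro r hr
        rcases eq_or_lt_of_le hr.1 with h | h
        · exact ⟨Real.pi, ⟨by linarith, le_refl _⟩, Or.inr (by linarith)⟩
        · exact ⟨r, ⟨h, hr.2⟩, Or.inl rfl⟩
      obtain ⟨s', hs', es⟩ := key s hs
      obtain ⟨t', ht', et⟩ := key t ht
      refine ⟨s', hs', t', ht', ?_⟩
      rcases es with rfl | rfl <;> rcases et with rfl | rfl <;> simp [h₁, h₂]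
  refine ⟨?_, ⟨F 0 0, 0, ⟨by linarith, hpi.le⟩, 0, ⟨by linarith, hpi.le⟩, rfl⟩⟩
  rw [e]
  exact (isCompact_Icc.prod isCompact_Icc).image hc

theorem phase_add_two_pi (θ : ℝ) : phase (θ + 2 * Real.pi) = phase θ := by
  unfold phase
  have h : Complex.I * ((θ + 2 * Real.pi : ℝ) : ℂ) = Complex.I * θ + 2 * Real.pi * Complex.I := by
    push_cast
    ring
  rw [h, Complex.exp_periodic]

theorem continuous_phase : Continuous phase := by
  unfold phase
  fun_prop

theorem isCompact_torusRange_aux (T : Matrix (Fin 2) (Fin 2) ℂ) (r s : ℝ) :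
    IsCompact (torusRange fun θ₁ θ₂ => r + s * Lc T θ₁ θ₂ + L T θ₁ θ₂) ∧
      (torusRange fun θ₁ θ₂ => r + s * Lc T θ₁ θ₂ + L T θ₁ θ₂).Nonempty := by
  refine isCompact_torusRange ?_ ?_ ?_
  · have := continuous_phase
    unfold Lc L
    fun_prop
  · intro u v
    have e₁ : u + 2 * Real.pi - v = u - v + 2 * Real.pi := by ring
    have e₂ : u + 2 * Real.pi + v = u + v + 2 * Real.pi := by ring
    simp only [Lc, L, e₁, e₂, phase_add_two_pi]
  · intro u v
    have e₁ : u - v = u - (v + 2 * Real.pi) + 2 * Real.pi := by ring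
    have e₂ : u + (v + 2 * Real.pi) = u + v + 2 * Real.pi := by ring
    have e₃ : phase (u - v) = phase (u - (v + 2 * Real.pi)) := by
      rw [e₁, phase_add_two_pi]
    simp only [Lc, L, e₂, phase_add_two_pi, e₃]

theorem isGreatest_V2plus (T : Matrix (Fin 2) (Fin 2) ℂ) (x : ℝ) :
    IsGreatest (torusRange (V2 T x)) (V2plus T x) := by
  have h := isCompact_torusRange_aux T (-Kc T * Real.cos x ^ 2 + Ks T * Real.sin x ^ 2) (Real.cos x)
  exact h.1.isGreatest_sSup h.2

theorem isLeast_V2minus (T : Matrix (Fin 2) (Fin 2) ℂ) (x : ℝ) :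
    IsLeast (torusRange (V2 T x)) (V2minus T x) := by
  have h := isCompact_torusRange_aux T (-Kc T * Real.cos x ^ 2 + Ks T * Real.sin x ^ 2) (Real.cos x)
  exact h.1.isLeast_sInf h.2

theorem isGreatest_L0plus (T : Matrix (Fin 2) (Fin 2) ℂ) :
    IsGreatest (torusRange fun θ₁ θ₂ => Lc T θ₁ θ₂ + L T θ₁ θ₂) (L0plus T) := by
  have h := isCompact_torusRange_aux T 0 1
  simp only [zero_add, one_mul] at h
  exact h.1.isGreatest_sSup h.2

theorem isLeast_Lpi2minus (T : Matrix (Fin 2) (Fin 2) ℂ) :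
    IsLeast (torusRange (L T)) (Lpi2minus T) := by
  have h := isCompact_torusRange_aux T 0 0
  simp only [zero_add, zero_mul] at h
  exact h.1.isLeast_sInf h.2

/-- `σ` has asymptotically gaps of the form `(l n + O(1), r n + O(1))`: from some index on, there
is an open interval that does not meet `σ`, whose end points belong to `σ`, and differ from `l n`
and `r n` by bounded amounts. -/
def HasAsymptoticGaps (σ : Set ℂ) (l r : ℕ → ℝ) : Prop :=
  ∃ α β : ℕ → ℝ,
    (fun n => α n - l n) =O[atTop] (fun _ => (1 : ℝ)) ∧
    (fun n => β n - r n) =O[atTop] (fun _ => (1 : ℝ)) ∧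
    ∀ᶠ n in atTop, α n < β n ∧ (∀ E ∈ Ioo (α n) (β n), (E : ℂ) ∉ σ) ∧
      (α n : ℂ) ∈ σ ∧ (β n : ℂ) ∈ σ

end SquareLattice

end

/-! For k > 0 the energy k² lies in the spectrum exactly when some pair of phases admits a Bloch
wave (`mem_opSpectrum_iff`). On an edge, a solution of -ψ'' = k²ψ has outward derivative k / sin ka
times (value at the other end minus cos ka times value at this end). Inserting this into the vertex
condition with Ψ = (x, T*x) leaves one equation for x in ℂ²: x is in the kernel of the Hermitian
matrix u(1 + TT*) + sS - A(θ₁, θ₂), where u = cos ka and s = sin ka / k. The dispersion relation is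
therefore `pencilDet` = 0. It is derived from a 4×4 matrix that involves no division by sin ka
(`bloch_det`), so the energies with sin ka = 0 need no separate treatment. Absence of Bloch waves
gives a bounded resolvent by Gelfand theory for the algebra generated by the two lattice
translations; a Bloch wave gives approximate eigenfunctions by truncation.

The matrix S enters only through s = O(1/k), so at high energy the relation is an O(1/k)
perturbation of its form at s = 0, which is V₂(ka, θ₁, θ₂) = 0 (`V2_eq_pencilDet`). For fixed phases
the determinant at s = 0 is a quadratic polynomial in u with leading coefficient det(1 + TT*) > 0,
and shifting both phases by π amounts to u ↦ -u. Two facts control its sign. First, if u > 0 and the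
determinant is nonnegative for all phases, then the matrix is positive semidefinite for all phases;
as it grows with u at the rate 1 + TT*, its determinant has positive derivative
(`derivative_pos_of_pencilDet_nonneg`), so positivity persists for all larger u. Second, the
polynomial is convex, so negativity at u = 0 for all phases persists up to the first zero.

The condition L₀⁺ < K_c says that the determinant is positive at u = 1 for all phases. The largest
zero is then some M = cos b, and |u| > M gives gaps around ka = nπ (`exists_last_zero`). The
condition L⁻ > -K_s says that it is negative at u = 0 for all phases. The first zero is then some m
= sin c, and |u| < m gives gaps around ka = (n + 1/2)π (`exists_first_zero`). With both inequalities
reversed, the determinant takes both signs at each u in [-1, 1], uniformly by compactness, and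
connectedness of the set of phases yields a zero for every large k.

At the band edges the determinant is bounded linearly with nonzero slope, so the O(1/k) perturbation
moves the edges by O(1/n) in k, hence by O(1) in the energy k² (`hasAsymptoticGaps_of_dispersion`).
-/

noncomputable section

/-! ### The Hermitian 2×2 pencil and the 4×4 Bloch determinant -/

namespace SquareLattice

open ComplexConjugate

/-- The diagonal entries of the Hermitian matrix `u (1 + T T*) + s S - A(θ₁, θ₂)`, where
`A(θ₁, θ₂) = X(θ₁) + T X(θ₂) T*` and `X(θ)` has the entries `0, e^{-iθ}, e^{iθ}, 0`. -/
def pencilDiag (S T : Matrix (Fin 2) (Fin 2) ℂ) (u s θ₂ : ℝ) (i : Fin 2) : ℝ :=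
  u * (1 + ‖T i 0‖ ^ 2 + ‖T i 1‖ ^ 2) + s * (S i i).re -
    2 * (T i 0 * conj (T i 1) * conj (phase θ₂)).re

/-- The upper right entry of the Hermitian matrix `u (1 + T T*) + s S - A(θ₁, θ₂)`. -/
def pencilOff (S T : Matrix (Fin 2) (Fin 2) ℂ) (u s θ₁ θ₂ : ℝ) : ℂ :=
  u * (T 0 0 * conj (T 1 0) + T 0 1 * conj (T 1 1)) + s * S 0 1 - conj (phase θ₁) -
    (T 0 0 * conj (T 1 1) * conj (phase θ₂) + T 0 1 * conj (T 1 0) * phase θ₂)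

/-- The determinant of the Hermitian matrix `u (1 + T T*) + s S - A(θ₁, θ₂)`. -/
def pencilDet (S T : Matrix (Fin 2) (Fin 2) ℂ) (u s θ₁ θ₂ : ℝ) : ℝ :=
  pencilDiag S T u s θ₂ 0 * pencilDiag S T u s θ₂ 1 - ‖pencilOff S T u s θ₁ θ₂‖ ^ 2

theorem phase_eq (θ : ℝ) : phase θ = ⟨Real.cos θ, Real.sin θ⟩ := by
  unfold phase
  rw [mul_comm, Complex.exp_mul_I]
  apply Complex.ext <;> simp [Complex.cos_ofReal_re, Complex.sin_ofReal_re]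

/-- At s = 0 the matrix S drops out. The cos² terms collect to det(1 + TT*) = (Kc + Ks)/4, the terms
linear in cos x to Lc, and the rest to L and Ks. -/
theorem V2_eq_pencilDet (S T : Matrix (Fin 2) (Fin 2) ℂ) (x θ₁ θ₂ : ℝ) :
    V2 T x θ₁ θ₂ = -4 * pencilDet S T (Real.cos x) 0 θ₁ θ₂ := by
  obtain ⟨a, a', ha⟩ : ∃ a a' : ℝ, T 0 0 = ⟨a, a'⟩ := ⟨_, _, rfl⟩
  obtain ⟨b, b', hb⟩ : ∃ a a' : ℝ, T 0 1 = ⟨a, a'⟩ := ⟨_, _, rfl⟩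
  obtain ⟨c, c', hc⟩ : ∃ a a' : ℝ, T 1 0 = ⟨a, a'⟩ := ⟨_, _, rfl⟩
  obtain ⟨d, d', hd⟩ : ∃ a a' : ℝ, T 1 1 = ⟨a, a'⟩ := ⟨_, _, rfl⟩
  have h0 := Real.sin_sq_add_cos_sq x
  have h1 := Real.sin_sq_add_cos_sq θ₁
  have h2 := Real.sin_sq_add_cos_sq θ₂
  simp only [V2, Kc, Ks, Lc, L, pencilDet, pencilDiag, pencilOff, ha, hb, hc, hd, phase_eq,
    Complex.sq_norm, Complex.normSq_apply, Real.cos_sub, Real.sin_sub, Real.cos_add, Real.sin_add]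
  generalize Real.cos x = u at h0 ⊢
  generalize Real.sin x = v at h0 ⊢
  generalize Real.cos θ₁ = c₁ at h1 ⊢
  generalize Real.sin θ₁ = s₁ at h1 ⊢
  generalize Real.cos θ₂ = c₂ at h2 ⊢
  generalize Real.sin θ₂ = s₂ at h2 ⊢
  simp
  -- The squared bracket pair is |det T|². The coefficient of the identity in x is Ks; the phases θ₁
  -- and θ₂ enter through |det X(θ₁)|² and |det T|² |det X(θ₂)|².
  linear_combination
    (4 * (1 + ((a*d-a'*d'-b*c+b'*c')^2 + (a*d'+a'*d-b*c'-b'*c)^2))) * h0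
    - 4 * h1 - 4 * ((a*d-a'*d'-b*c+b'*c')^2 + (a*d'+a'*d-b*c'-b'*c)^2) * h2

/-- The part of the Bloch matrix that does not depend on the phases. The unknowns are
`x₁, x₂, y₁, y₂`, where the boundary data at a vertex are
`Ψ = (x, T* x)` and `Ψ' = (S x - T y, y)`; the four equations express the values and the
derivatives at the far ends of the horizontal and the vertical edge by the data at the near ends,
with `c = cos ka`, `s = sin ka / k`, `r = k sin ka`. -/
def blochConst (S T : Matrix (Fin 2) (Fin 2) ℂ) (c s r : ℂ) : Matrix (Fin 4) (Fin 4) ℂ :=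
  !![-s * S 1 0, -c - s * S 1 1, s * T 1 0, s * T 1 1;
     c * S 1 0, -r + c * S 1 1, -c * T 1 0, -c * T 1 1;
     -c * conj (T 0 1), -c * conj (T 1 1), 0, -s;
     -r * conj (T 0 1), -r * conj (T 1 1), 0, c]

/-- The coefficient of the horizontal phase in the Bloch matrix. -/
def blochHorizontal (S T : Matrix (Fin 2) (Fin 2) ℂ) : Matrix (Fin 4) (Fin 4) ℂ :=
  !![1, 0, 0, 0; S 0 0, S 0 1, -T 0 0, -T 0 1; 0, 0, 0, 0; 0, 0, 0, 0]

/-- The coefficient of the vertical phase in the Bloch matrix. -/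
def blochVertical (T : Matrix (Fin 2) (Fin 2) ℂ) : Matrix (Fin 4) (Fin 4) ℂ :=
  !![0, 0, 0, 0; 0, 0, 0, 0; conj (T 0 0), conj (T 1 0), 0, 0; 0, 0, 1, 0]

theorem phase_mul_conj (θ : ℝ) : phase θ * conj (phase θ) = 1 := by
  rw [Complex.mul_conj, phase_eq, Complex.normSq_apply]
  norm_cast
  linear_combination Real.sin_sq_add_cos_sq θ

theorem norm_phase (θ : ℝ) : ‖phase θ‖ = 1 := by
  unfold phase
  rw [mul_comm, Complex.norm_exp_ofReal_mul_I]

theorem pencilDiag_cast {S T : Matrix (Fin 2) (Fin 2) ℂ} (hS : S.IsHermitian) (u s θ : ℝ)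
    (i : Fin 2) :
    (pencilDiag S T u s θ i : ℂ) = u * (1 + T i 0 * conj (T i 0) + T i 1 * conj (T i 1)) +
      s * S i i - (T i 0 * conj (T i 1) * conj (phase θ) + T i 1 * conj (T i 0) * phase θ) := by
  have h1 : ((S i i).re : ℂ) = S i i := hS.coe_re_apply_self i
  have h2 := Complex.add_conj (T i 0 * conj (T i 1) * conj (phase θ))
  simp only [map_mul, Complex.conj_conj] at h2
  simp only [pencilDiag, Complex.mul_conj, Complex.normSq_eq_norm_sq]
  push_cast at h2 ⊢
  rw [h1]
  linear_combination h2

theorem _root_.Matrix.det_fin_four {R : Type*} [CommRing R] (A : Matrix (Fin 4) (Fin 4) R) :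
    A.det =
      A 0 0 * (A 1 1 * (A 2 2 * A 3 3 - A 2 3 * A 3 2) - A 1 2 * (A 2 1 * A 3 3 - A 2 3 * A 3 1)
        + A 1 3 * (A 2 1 * A 3 2 - A 2 2 * A 3 1))
      - A 0 1 * (A 1 0 * (A 2 2 * A 3 3 - A 2 3 * A 3 2) - A 1 2 * (A 2 0 * A 3 3 - A 2 3 * A 3 0)
        + A 1 3 * (A 2 0 * A 3 2 - A 2 2 * A 3 0))
      + A 0 2 * (A 1 0 * (A 2 1 * A 3 3 - A 2 3 * A 3 1) - A 1 1 * (A 2 0 * A 3 3 - A 2 3 * A 3 0)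
        + A 1 3 * (A 2 0 * A 3 1 - A 2 1 * A 3 0))
      - A 0 3 * (A 1 0 * (A 2 1 * A 3 2 - A 2 2 * A 3 1) - A 1 1 * (A 2 0 * A 3 2 - A 2 2 * A 3 0)
        + A 1 2 * (A 2 0 * A 3 1 - A 2 1 * A 3 0)) := by
  rw [Matrix.det_succ_row_zero, Fin.sum_univ_four]
  simp only [Matrix.det_fin_three, Matrix.submatrix_apply]
  simp [Fin.succAbove, Fin.lt_def]
  ring

/-- Eliminating y from the four equations leaves the 2×2 equation for x. The hypothesis r s + c² = 1
says that the transfer matrix of an edge has determinant one; no division by s occurs, so s = 0 is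
allowed. -/
theorem bloch_det {S T : Matrix (Fin 2) (Fin 2) ℂ} (hS : S.IsHermitian) {c s r : ℝ}
    (h : r * s + c ^ 2 = 1) (θ₁ θ₂ : ℝ) :
    (blochConst S T c s r + phase θ₁ • blochHorizontal S T + phase θ₂ • blochVertical T).det =
      phase θ₁ * phase θ₂ * pencilDet S T c s θ₁ θ₂ := by
  have h' : (r : ℂ) * s + c ^ 2 = 1 := by exact_mod_cast h
  have h1 := phase_mul_conj θ₁
  have h2 := phase_mul_conj θ₂
  have hS' : conj (S 0 1) = S 1 0 := hS.apply 1 0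
  have hoff : ((‖pencilOff S T c s θ₁ θ₂‖ ^ 2 : ℝ) : ℂ) = pencilOff S T c s θ₁ θ₂ *
      conj (pencilOff S T c s θ₁ θ₂) := by
    rw [Complex.mul_conj, Complex.normSq_eq_norm_sq]
  rw [pencilDet, Complex.ofReal_sub, Complex.ofReal_mul, hoff, pencilDiag_cast hS,
    pencilDiag_cast hS, pencilOff]
  simp only [map_sub, map_add, map_mul, Complex.conj_conj, Complex.conj_ofReal, hS']
  rw [Matrix.det_fin_four]
  simp only [blochConst, blochHorizontal, blochVertical, Matrix.add_apply, Matrix.smul_apply,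
    smul_eq_mul, Matrix.of_apply, Matrix.cons_val]
  generalize conj (phase θ₁) = w1 at *
  generalize conj (phase θ₂) = w2 at *
  generalize phase θ₁ = z1 at *
  generalize phase θ₂ = z2 at *
  linear_combination (-conj (T 0 0) * T 1 0 * c * z2 - conj (T 0 1) * T 1 1 * c * z2 - S 1 0 * s *
    z2 + z1 * z2 + conj (T 0 1) * T 1 0 * w2 * z2 + conj (T 0 0) * T 1 1 * z2 * z2) * h1 + (conj
    (T 1 1) * T 1 0 * c * z1 + conj (T 1 1) * S 0 0 * T 1 0 * s * z1 + conj (T 0 1) * T 0 0 * c *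
    z1 + conj (T 0 1) * S 1 1 * T 0 0 * s * z1 - conj (T 0 1) * conj (T 1 0) * T 0 0 * T 1 1 * z1
    * z2 - conj (T 0 0) * conj (T 1 1) * T 0 1 * T 1 0 * z1 * z2 - conj (T 0 1) * S 0 1 * T 1 0 *
    s * z1 - conj (T 1 1) * S 1 0 * T 0 0 * s * z1 + conj (T 1 1) * T 0 0 * z1 * z1 + conj (T 0 0)
    * conj (T 1 1) * T 0 0 * T 1 1 * z1 * z2 + conj (T 0 1) * conj (T 1 0) * T 0 1 * T 1 0 * z1 *
    z2 + conj (T 0 1) * T 1 0) * h2 + (-z1 * z2 + S 1 0 * s * z2 - conj (T 1 1) * T 0 0 * z1 * z1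
    - conj (T 1 1) * T 1 0 * c * z1 + conj (T 1 1) * S 1 0 * T 0 0 * s * z1 - conj (T 0 1) * T 0 0
    * c * z1 - conj (T 0 1) * T 1 0 * c * c - conj (T 0 1) * S 1 1 * T 0 0 * s * z1 - conj (T 1 1)
    * S 0 0 * T 1 0 * s * z1 + conj (T 0 0) * T 1 0 * c * z2 + conj (T 0 1) * S 0 1 * T 1 0 * s *
    z1 - conj (T 0 1) * T 1 0 * r * s + conj (T 0 0) * conj (T 1 1) * T 0 1 * T 1 0 * z1 * z2 -
    conj (T 0 1) * conj (T 1 0) * T 0 1 * T 1 0 * z1 * z2 - conj (T 0 0) * T 1 1 * z2 * z2 + conj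
    (T 0 1) * T 1 1 * c * z2 - conj (T 0 0) * conj (T 1 1) * T 0 0 * T 1 1 * z1 * z2 + conj (T 0
    1) * conj (T 1 0) * T 0 0 * T 1 1 * z1 * z2 - conj (T 0 1) * T 1 0) * h'

end SquareLattice

end

/-! ### Inverting difference operators on the lattice by Gelfand theory -/

noncomputable section

namespace SquareLattice

/-- The norm of a character value of an element of norm at most one. -/
theorem norm_character_le {A : Type*} [NormedCommRing A] [NormedAlgebra ℂ A] [CompleteSpace A]
    (χ : WeakDual.characterSpace ℂ A) {x y : A} (hx : ‖x‖ ≤ 1) (h1 : ‖(1 : A)‖ ≤ 1) (hy : x = y) :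
    ‖χ y‖ ≤ 1 := by
  subst hy
  calc ‖χ x‖ ≤ ‖x‖ * ‖(1 : A)‖ := AlgHom.norm_apply_le_self_mul_norm_one χ x
    _ ≤ 1 * 1 := by gcongr
    _ = 1 := one_mul 1

/-- A character sends an invertible contraction with contractive inverse to such a pair z, z', so
its value is unimodular. -/
theorem exists_phase_eq {z z' : ℂ} (hz : ‖z‖ ≤ 1) (hz' : ‖z'‖ ≤ 1) (h : z * z' = 1) :
    ∃ θ : ℝ, phase θ = z := by
  have h1 : ‖z‖ * ‖z'‖ = 1 := by rw [← norm_mul, h, norm_one]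
  have h2 : ‖z‖ = 1 := by nlinarith [norm_nonneg z, norm_nonneg z']
  refine ⟨z.arg, ?_⟩
  unfold phase
  have := Complex.norm_mul_exp_arg_mul_I z
  rw [h2, Complex.ofReal_one, one_mul] at this
  rw [mul_comm, this]

/-- The value of a matrix polynomial of degree one at two elements of an algebra. -/
def matrixSymbol {n : Type*} {A : Type*} [Ring A] [Algebra ℂ A] (M₀ M₁ M₂ : Matrix n n ℂ)
    (U V : A) : Matrix n n A :=
  fun i j => algebraMap ℂ A (M₀ i j) + M₁ i j • U + M₂ i j • V

/-- In a commutative Banach algebra a non-unit is annihilated by some character. A character maps U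
and V to phases, hence the determinant to the determinant of the symbol at these phases, which does
not vanish. -/
theorem isUnit_det_matrixSymbol {n : Type*} [Fintype n] [DecidableEq n] {A : Type*}
    [NormedCommRing A] [NormedAlgebra ℂ A] [CompleteSpace A] (h1 : ‖(1 : A)‖ ≤ 1)
    (M₀ M₁ M₂ : Matrix n n ℂ) {U U' V V' : A} (hU : U * U' = 1) (hV : V * V' = 1)
    (hU1 : ‖U‖ ≤ 1) (hU1' : ‖U'‖ ≤ 1) (hV1 : ‖V‖ ≤ 1) (hV1' : ‖V'‖ ≤ 1)
    (h : ∀ θ₁ θ₂, (M₀ + phase θ₁ • M₁ + phase θ₂ • M₂).det ≠ 0) :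
    IsUnit (matrixSymbol M₀ M₁ M₂ U V).det := by
  by_contra hu
  obtain ⟨χ, hχ⟩ := WeakDual.CharacterSpace.exists_apply_eq_zero hu
  have key : ∀ {W W' : A}, W * W' = 1 → ‖W‖ ≤ 1 → ‖W'‖ ≤ 1 → ∃ θ, phase θ = χ W := by
    intro W W' hW h2 h3
    refine exists_phase_eq (norm_character_le χ h2 h1 rfl) (norm_character_le χ h3 h1 rfl) ?_
    rw [← map_mul, hW, map_one]
  obtain ⟨θ₁, hθ₁⟩ := key hU hU1 hU1'
  obtain ⟨θ₂, hθ₂⟩ := key hV hV1 hV1'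
  apply h θ₁ θ₂
  let f : A →ₐ[ℂ] ℂ := WeakDual.CharacterSpace.toAlgHom χ
  have hf : ∀ x, f x = χ x := fun _ => rfl
  rw [← hχ, ← hf, AlgHom.map_det]
  congr 1
  ext i j
  have h3 : χ (algebraMap ℂ A (M₀ i j)) = M₀ i j := f.commutes _
  simp [matrixSymbol, AlgHom.mapMatrix_apply, hf, hθ₁, hθ₂, mul_comm, h3]

/-- The operator algebra is not commutative, so the argument is run in the bicommutant of {U, V}: it
is closed, commutative because U and V commute, and it contains their inverses. -/
theorem exists_inverse_matrixSymbol {n : Type*} [Fintype n] [DecidableEq n] {A : Type*}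
    [NormedRing A] [NormedAlgebra ℂ A] [CompleteSpace A] (h1 : ‖(1 : A)‖ ≤ 1)
    (M₀ M₁ M₂ : Matrix n n ℂ) {U U' V V' : A} (hU : U * U' = 1) (hU' : U' * U = 1)
    (hV : V * V' = 1) (hV' : V' * V = 1) (hUV : U * V = V * U)
    (hU1 : ‖U‖ ≤ 1) (hU1' : ‖U'‖ ≤ 1) (hV1 : ‖V‖ ≤ 1) (hV1' : ‖V'‖ ≤ 1)
    (h : ∀ θ₁ θ₂, (M₀ + phase θ₁ • M₁ + phase θ₂ • M₂).det ≠ 0) :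
    ∃ K : Matrix n n A, K * matrixSymbol M₀ M₁ M₂ U V = 1 ∧
      matrixSymbol M₀ M₁ M₂ U V * K = 1 := by
  let s : Set A := {U, V}
  have hs : s ⊆ s.centralizer := by
    rintro x hx y hy
    rcases hx with rfl | rfl <;> rcases hy with rfl | rfl <;> simp_all
  let B : Subalgebra ℂ A := Subalgebra.centralizer ℂ s.centralizer
  have hcomm : ∀ x y : B, x * y = y * x := by
    rintro ⟨x, hx⟩ ⟨y, hy⟩
    ext1
    exact hy x (fun w hw => hx w (hs hw)) 
  have hclosed : IsClosed (B : Set A) := Set.isClosed_centralizer _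
  let _ : NormedCommRing B := { (inferInstance : NormedRing B) with mul_comm := hcomm }
  have : CompleteSpace B := hclosed.completeSpace_coe
  -- An inverse commutes with everything that its element commutes with.
  have inv_mem : ∀ {W W' : A}, W ∈ B → W * W' = 1 → W' * W = 1 → W' ∈ B := by
    intro W W' hW e e' y hy
    have := hW y hy
    calc y * W' = W' * W * y * W' := by rw [e', one_mul]
      _ = W' * (y * W) * W' := by rw [this]; simp only [mul_assoc]
      _ = W' * y := by rw [mul_assoc, mul_assoc, e, mul_one]
  have hUB : U ∈ B := Set.subset_centralizer_centralizer (by simp [s])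
  have hVB : V ∈ B := Set.subset_centralizer_centralizer (by simp [s])
  have hu := isUnit_det_matrixSymbol (A := B) h1 M₀ M₁ M₂ (U := ⟨U, hUB⟩)
    (U' := ⟨U', inv_mem hUB hU hU'⟩) (V := ⟨V, hVB⟩) (V' := ⟨V', inv_mem hVB hV hV'⟩)
    (Subtype.ext hU) (Subtype.ext hV) hU1 hU1' hV1 hV1' h
  have hu1 := Matrix.nonsing_inv_mul _ hu
  have hu2 := Matrix.mul_nonsing_inv _ hu
  have hmap : (matrixSymbol M₀ M₁ M₂ (⟨U, hUB⟩ : B) ⟨V, hVB⟩).map B.val =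
      matrixSymbol M₀ M₁ M₂ U V := by
    ext i j
    simp [matrixSymbol]
  refine ⟨(matrixSymbol M₀ M₁ M₂ (⟨U, hUB⟩ : B) ⟨V, hVB⟩)⁻¹.map B.val, ?_, ?_⟩
  · rw [← hmap, ← Matrix.map_mul, hu1, Matrix.map_one _ (map_zero _) (map_one _)]
  · rw [← hmap, ← Matrix.map_mul, hu2, Matrix.map_one _ (map_zero _) (map_one _)]

/-- Composition with an injective map, as an operator on square summable families. -/
def lpComp {ι κ E : Type*} [NormedAddCommGroup E] [NormedSpace ℂ E] (ρ : ι → κ)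
    (hρ : ρ.Injective) : lp (fun _ : κ => E) 2 →L[ℂ] lp (fun _ : ι => E) 2 :=
  LinearMap.mkContinuous
    { toFun v := ⟨fun i => v (ρ i), by
        have := lp.memℓp v
        rw [memℓp_gen_iff (by norm_num)] at this
        exact memℓp_gen (this.comp_injective hρ)⟩
      map_add' _ _ := rfl
      map_smul' _ _ := rfl }
    1
    fun v => by
      rw [one_mul]
      refine lp.norm_le_of_forall_sum_le (by norm_num) (norm_nonneg v) fun s => ?_
      have h := lp.sum_rpow_le_norm_rpow (by norm_num) v (s.map ⟨ρ, hρ⟩)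
      rwa [Finset.sum_map] at h

@[simp]
theorem lpComp_apply {ι κ E : Type*} [NormedAddCommGroup E] [NormedSpace ℂ E] (ρ : ι → κ)
    (hρ : ρ.Injective) (v : lp (fun _ : κ => E) 2) (i : ι) : lpComp ρ hρ v i = v (ρ i) := rfl

theorem norm_lpComp_le {ι κ E : Type*} [NormedAddCommGroup E] [NormedSpace ℂ E] (ρ : ι → κ)
    (hρ : ρ.Injective) : ‖(lpComp ρ hρ : lp (fun _ : κ => E) 2 →L[ℂ] _)‖ ≤ 1 :=
  LinearMap.mkContinuous_norm_le _ zero_le_one _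

/-- Square summable functions on the vertices. -/
abbrev LatticeSpace := lp (fun _ : ℤ × ℤ => ℂ) 2

/-- The translation by `p`. -/
def shift (p : ℤ × ℤ) : LatticeSpace →L[ℂ] LatticeSpace :=
  lpComp (fun q => q + p) (add_left_injective p)

@[simp]
theorem shift_apply (p : ℤ × ℤ) (v : LatticeSpace) (q : ℤ × ℤ) : shift p v q = v (q + p) := rfl

theorem shift_mul_shift (p q : ℤ × ℤ) : shift p * shift q = shift (p + q) := by
  ext v r
  simp [add_assoc]

theorem shift_zero : shift 0 = 1 := by
  ext v r
  simp

/-- A constant coefficient difference operator on the lattice is invertible if its symbol is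
invertible everywhere on the torus. -/
theorem exists_lattice_inverse {n : Type*} [Fintype n] [DecidableEq n]
    (M₀ M₁ M₂ : Matrix n n ℂ)
    (h : ∀ θ₁ θ₂, (M₀ + phase θ₁ • M₁ + phase θ₂ • M₂).det ≠ 0) :
    ∃ K : Matrix n n (LatticeSpace →L[ℂ] LatticeSpace),
      K * matrixSymbol M₀ M₁ M₂ (shift (1, 0)) (shift (0, 1)) = 1 ∧
      matrixSymbol M₀ M₁ M₂ (shift (1, 0)) (shift (0, 1)) * K = 1 := by
  have hn : ∀ p, ‖shift p‖ ≤ 1 := fun p => norm_lpComp_le _ _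
  refine exists_inverse_matrixSymbol (U' := shift (-1, 0)) (V' := shift (0, -1))
    ContinuousLinearMap.norm_id_le M₀ M₁ M₂ ?_ ?_ ?_ ?_ ?_ (hn _) (hn _) (hn _) (hn _) h <;>
  · simp only [shift_mul_shift, ← shift_zero]
    rfl

end SquareLattice

end

/-! ### Integration by parts and norm estimates on one edge -/

noncomputable section

namespace SquareLattice

/-- Integration by parts for the product of a continuously differentiable function and the
primitive of an integrable function. -/
theorem mul_primitive {φ : ℝ → ℂ} {x : ℝ} (hx : 0 ≤ x) (hφ : IntervalIntegrable φ volume 0 x)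
    {h h' : ℝ → ℂ} (hh : ∀ t, HasDerivAt h (h' t) t) (hc : Continuous h') :
    h x * ∫ t in (0 : ℝ)..x, φ t =
      ∫ s in (0 : ℝ)..x, (h' s * (∫ t in (0 : ℝ)..s, φ t) + h s * φ s) := by
  have hch : Continuous h := continuous_iff_continuousAt.2 fun t => (hh t).continuousAt
  have hsub : ∀ {s}, s ∈ Icc 0 x → IntervalIntegrable φ volume 0 s := fun hs =>
    hφ.mono_set (by rw [uIcc_of_le hs.1, uIcc_of_le hx]; exact Icc_subset_Icc_right hs.2)
  have hftc : ∀ s, ∫ t in (0 : ℝ)..s, h' t = h s - h 0 := fun s =>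
    intervalIntegral.integral_eq_sub_of_hasDerivAt (fun t _ => hh t) (hc.intervalIntegrable _ _)
  -- Fubini for φ(t) h'(s) on the triangle s ≤ t: since φ is only integrable, its primitive cannot
  -- be differentiated everywhere.
  have hswap := intervalIntegral_intervalIntegral_swap (a := 0) (b := x) (c := 0) (d := x)
    (F := fun t s => φ t * indicator {s | s ≤ t} h' s) (by
      have h1 : IntegrableOn (fun p : ℝ × ℝ => φ p.1 * h' p.2) (uIoc 0 x ×ˢ uIoc 0 x) := by
        unfold IntegrableOn
        rw [Measure.volume_eq_prod, ← Measure.prod_restrict]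
        exact Integrable.mul_prod (intervalIntegrable_iff.1 hφ)
          (intervalIntegrable_iff.1 (hc.intervalIntegrable 0 x))
      have h2 : MeasurableSet {p : ℝ × ℝ | p.2 ≤ p.1} :=
        measurableSet_le measurable_snd measurable_fst
      refine (Integrable.indicator h1 h2).congr (Eventually.of_forall ?_)
      rintro ⟨t, s⟩
      by_cases hst : s ≤ t <;> simp [hst])
  have hl : ∫ t in (0 : ℝ)..x, ∫ s in (0 : ℝ)..x, φ t * indicator {s | s ≤ t} h' s =
      ∫ t in (0 : ℝ)..x, (h t * φ t - h 0 * φ t) := by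
    refine intervalIntegral.integral_congr fun t ht => ?_
    rw [uIcc_of_le hx] at ht
    rw [intervalIntegral.integral_const_mul, intervalIntegral.integral_indicator ht, hftc]
    ring
  have hr : ∫ s in (0 : ℝ)..x, ∫ t in (0 : ℝ)..x, φ t * indicator {s | s ≤ t} h' s =
      ∫ s in (0 : ℝ)..x, (h' s * (∫ t in (0 : ℝ)..x, φ t) - h' s * ∫ t in (0 : ℝ)..s, φ t) := by
    refine intervalIntegral.integral_congr fun s hs => ?_
    rw [uIcc_of_le hx] at hs
    have h1 := intervalIntegral.integral_add_adjacent_intervals (hsub hs)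
      ((hsub hs).symm.trans hφ)
    have h2 : ∫ t in (0 : ℝ)..x, φ t * indicator {s | s ≤ t} h' s =
        ∫ t in s..x, h' s * φ t := by
      rw [intervalIntegral.integral_of_le hx, intervalIntegral.integral_of_le hs.2,
        integral_Ioc_eq_integral_Ioo, integral_Ioc_eq_integral_Ioo,
        ← integral_indicator measurableSet_Ioo, ← integral_indicator measurableSet_Ioo]
      refine integral_congr_ae ?_
      -- The indicator of s ≤ t and the open interval (s, x) differ at t = s only, a null set.
      filter_upwards [compl_mem_ae_iff.2 (measure_singleton s)] with t ht
      have hts : t ≠ s := ht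
      by_cases h3 : s ≤ t
      · have h4 : s < t := lt_of_le_of_ne h3 (Ne.symm hts)
        have h5 : t ∈ Ioo 0 x ↔ t ∈ Ioo s x :=
          ⟨fun h => ⟨h4, h.2⟩, fun h => ⟨hs.1.trans_lt h4, h.2⟩⟩
        by_cases h6 : t ∈ Ioo s x
        · rw [indicator_of_mem (h5.2 h6), indicator_of_mem h6,
            indicator_of_mem (s := {s | s ≤ t}) h3, mul_comm]
        · rw [indicator_of_notMem (mt h5.1 h6), indicator_of_notMem h6]
      · rw [indicator_of_notMem (s := Ioo s x) fun h => h3 h.1.le]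
        by_cases h6 : t ∈ Ioo 0 x
        · rw [indicator_of_mem h6, indicator_of_notMem (s := {s | s ≤ t}) h3, mul_zero]
        · rw [indicator_of_notMem h6]
    rw [h2, intervalIntegral.integral_const_mul, ← h1]
    ring
  have hQ : ContinuousOn (fun s => ∫ t in (0 : ℝ)..s, φ t) (uIcc 0 x) :=
    intervalIntegral.continuousOn_primitive_interval
      ((intervalIntegrable_iff' ).1 hφ)
  have i1 : IntervalIntegrable (fun s => h' s * ∫ t in (0 : ℝ)..s, φ t) volume 0 x :=
    (hc.continuousOn.mul hQ).intervalIntegrable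
  have i2 : IntervalIntegrable (fun s => h s * φ s) volume 0 x :=
    hφ.continuousOn_mul hch.continuousOn
  rw [hl, hr, intervalIntegral.integral_sub i2 (hφ.const_mul _),
    intervalIntegral.integral_sub ((hc.intervalIntegrable 0 x).mul_const _) i1,
    intervalIntegral.integral_const_mul, intervalIntegral.integral_mul_const, hftc] at hswap
  rw [intervalIntegral.integral_add i1 i2]
  linear_combination -hswap

/-- A function that is continuous on `[0, a]`, as an element of `L²(0, a)`. -/
theorem memLp_edge {a : ℝ} {f : ℝ → ℂ} (hf : ContinuousOn f (Icc 0 a)) :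
    MemLp f 2 (volume.restrict (Ioo (0 : ℝ) a)) := by
  obtain ⟨C, hC⟩ := isCompact_Icc.exists_bound_of_continuousOn hf
  refine MemLp.of_bound ((hf.mono Ioo_subset_Icc_self).aestronglyMeasurable measurableSet_Ioo) C ?_
  rw [ae_restrict_iff' measurableSet_Ioo]
  exact Eventually.of_forall fun x hx => hC x (Ioo_subset_Icc_self hx)

theorem integral_norm_edge_le {a : ℝ} (ha : 0 ≤ a) (φ : EdgeSpace a) :
    ∫ t in Ioo (0 : ℝ) a, ‖φ t‖ ≤ Real.sqrt a * ‖φ‖ := by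
  have h1 := eLpNorm_le_eLpNorm_mul_rpow_measure_univ (p := 1) (q := 2) (by norm_num)
    (Lp.memLp φ).aestronglyMeasurable
  rw [integral_norm_eq_lintegral_enorm (Lp.memLp φ).aestronglyMeasurable, Lp.norm_def,
    ← eLpNorm_one_eq_lintegral_enorm]
  have h2 := ENNReal.toReal_mono (ENNReal.mul_ne_top (Lp.memLp φ).eLpNorm_ne_top
    (ENNReal.rpow_ne_top_of_nonneg (by norm_num) (by simp))) h1
  refine h2.trans (le_of_eq ?_)
  rw [ENNReal.toReal_mul, mul_comm]
  congr 1
  rw [← ENNReal.toReal_rpow, Real.sqrt_eq_rpow]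
  have h3 : 1 / ENNReal.toReal 1 - 1 / ENNReal.toReal 2 = 1 / 2 := by norm_num
  rw [h3]
  simp [ha]

theorem norm_integral_edge_le {a : ℝ} (φ : EdgeSpace a) {h : ℝ → ℂ} (hh : ∀ t, ‖h t‖ ≤ 1) {x : ℝ}
    (hx : x ∈ Icc 0 a) : ‖∫ t in (0 : ℝ)..x, h t * φ t‖ ≤ Real.sqrt a * ‖φ‖ := by
  refine le_trans ?_ (integral_norm_edge_le (hx.1.trans hx.2) φ)
  rw [intervalIntegral.integral_of_le hx.1, integral_Ioc_eq_integral_Ioo]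
  calc ‖∫ t in Ioo (0 : ℝ) x, h t * φ t‖ ≤ ∫ t in Ioo (0 : ℝ) x, ‖φ t‖ := by
        refine norm_integral_le_of_norm_le
          ((integrableOn_edge φ).mono_set (Ioo_subset_Ioo_right hx.2)).norm
          (Eventually.of_forall fun t => ?_)
        rw [norm_mul]
        exact mul_le_of_le_one_left (norm_nonneg _) (hh t)
    _ ≤ ∫ t in Ioo (0 : ℝ) a, ‖φ t‖ :=
        setIntegral_mono_set (integrableOn_edge φ).norm
          (Eventually.of_forall fun t => norm_nonneg _)
          (Ioo_subset_Ioo_right hx.2).eventuallyLE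

end SquareLattice

end

/-! ### The equation -ψ'' - k²ψ = φ on one edge -/

noncomputable section

namespace SquareLattice

/-- A function that is continuous on `[0, a]`, as an element of `L²(0, a)`. -/
def edgeLp {a : ℝ} {f : ℝ → ℂ} (hf : ContinuousOn f (Icc 0 a)) : EdgeSpace a :=
  (memLp_edge hf).toLp f

theorem edgeLp_ae_eq {a : ℝ} {f : ℝ → ℂ} (hf : ContinuousOn f (Icc 0 a)) :
    ∀ᵐ x ∂(volume.restrict (Ioo (0 : ℝ) a)), edgeLp hf x = f x :=
  (memLp_edge hf).coeFn_toLp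

theorem isSobolevRep_of_hasDerivAt {a : ℝ} {f f' f'' : ℝ → ℂ} (h : ∀ t, HasDerivAt f (f' t) t)
    (h' : ∀ t, HasDerivAt f' (f'' t) t) (hf : ContinuousOn f (Icc 0 a))
    (hc : Continuous f'') :
    IsSobolevRep a (edgeLp hf) (edgeLp (hc.continuousOn (s := Icc 0 a))) f f' where
  ae_eq := edgeLp_ae_eq hf
  prim x hx := by
    have hc' : Continuous f' := continuous_iff_continuousAt.2 fun t => (h' t).continuousAt
    rw [intervalIntegral.integral_eq_sub_of_hasDerivAt (fun t _ => h t)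
      (hc'.intervalIntegrable _ _)]
    ring
  prim' x hx := by
    rw [integral_congr_edge (edgeLp_ae_eq _) hx,
      intervalIntegral.integral_eq_sub_of_hasDerivAt (fun t _ => h' t) (hc.intervalIntegrable _ _)]
    ring

/-- `cos kt` as a complex valued function -/
def waveCos (k t : ℝ) : ℂ := (Real.cos (k * t) : ℝ)

/-- `sin kt` as a complex valued function -/
def waveSin (k t : ℝ) : ℂ := (Real.sin (k * t) : ℝ)

theorem hasDerivAt_waveCos (k t : ℝ) : HasDerivAt (waveCos k) (-k * waveSin k t) t := by
  have h := ((Real.hasDerivAt_cos (k * t)).comp t ((hasDerivAt_id t).const_mul k)).ofReal_comp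
  refine h.congr_deriv ?_
  simp [waveSin]
  ring

theorem hasDerivAt_waveSin (k t : ℝ) : HasDerivAt (waveSin k) (k * waveCos k t) t := by
  have h := ((Real.hasDerivAt_sin (k * t)).comp t ((hasDerivAt_id t).const_mul k)).ofReal_comp
  refine h.congr_deriv ?_
  simp [waveCos]
  ring

theorem continuous_waveCos (k : ℝ) : Continuous (waveCos k) := by
  unfold waveCos
  fun_prop

theorem continuous_waveSin (k : ℝ) : Continuous (waveSin k) := by
  unfold waveSin
  fun_prop

theorem norm_waveCos_le (k t : ℝ) : ‖waveCos k t‖ ≤ 1 := by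
  rw [waveCos, Complex.norm_real]
  exact Real.abs_cos_le_one _

theorem norm_waveSin_le (k t : ℝ) : ‖waveSin k t‖ ≤ 1 := by
  rw [waveSin, Complex.norm_real]
  exact Real.abs_sin_le_one _

theorem waveCos_sq_add (k t : ℝ) : waveCos k t ^ 2 + waveSin k t ^ 2 = 1 := by
  unfold waveCos waveSin
  exact_mod_cast Real.cos_sq_add_sin_sq (k * t)

@[simp]
theorem waveCos_zero (k : ℝ) : waveCos k 0 = 1 := by simp [waveCos]

@[simp]
theorem waveSin_zero (k : ℝ) : waveSin k 0 = 0 := by simp [waveSin]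

/-- The solution of `-ψ'' - k² ψ = φ` with vanishing data at `0`. -/
def particular {a : ℝ} (k : ℝ) (φ : EdgeSpace a) (x : ℝ) : ℂ :=
  -(waveSin k x * (∫ t in (0 : ℝ)..x, waveCos k t * φ t) -
    waveCos k x * ∫ t in (0 : ℝ)..x, waveSin k t * φ t) / k

/-- The derivative of the solution of `-ψ'' - k² ψ = φ` with vanishing data at `0`. -/
def particularDeriv {a : ℝ} (k : ℝ) (φ : EdgeSpace a) (x : ℝ) : ℂ :=
  -(waveCos k x * (∫ t in (0 : ℝ)..x, waveCos k t * φ t) +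
    waveSin k x * ∫ t in (0 : ℝ)..x, waveSin k t * φ t)

section
variable {a : ℝ} (k : ℝ) (φ : EdgeSpace a)

theorem intervalIntegrable_mul_edge {h : ℝ → ℂ} (hh : Continuous h) {x : ℝ} (hx : x ∈ Icc 0 a) :
    IntervalIntegrable (fun t => h t * φ t) volume 0 x :=
  (intervalIntegrable_edge φ hx).continuousOn_mul hh.continuousOn

theorem continuousOn_primitive_edge {h : ℝ → ℂ} (hh : Continuous h) :
    ContinuousOn (fun x => ∫ t in (0 : ℝ)..x, h t * φ t) (Icc 0 a) := by
  rcases le_or_gt 0 a with ha | ha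
  · have h1 := intervalIntegrable_mul_edge φ hh (right_mem_Icc.2 ha)
    have h2 := intervalIntegral.continuousOn_primitive_interval ((intervalIntegrable_iff').1 h1)
    rwa [uIcc_of_le ha] at h2
  · simp [Icc_eq_empty (not_le.2 ha)]

theorem continuousOn_particular : ContinuousOn (particular k φ) (Icc 0 a) := by
  have h1 := continuousOn_primitive_edge φ (continuous_waveCos k)
  have h2 := continuousOn_primitive_edge φ (continuous_waveSin k)
  have h3 := continuous_waveCos k
  have h4 := continuous_waveSin k
  unfold particular
  fun_prop

/-- Variation of constants: `mul_primitive` differentiates both products, and the two terms that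
contain φ itself cancel. -/
theorem particular_eq_integral {k : ℝ} (hk : k ≠ 0) {x : ℝ} (hx : x ∈ Icc 0 a) :
    particular k φ x = ∫ t in (0 : ℝ)..x, particularDeriv k φ t := by
  have hk' : (k : ℂ) ≠ 0 := by exact_mod_cast hk
  have c1 := continuous_waveCos k
  have c2 := continuous_waveSin k
  have hu : uIcc 0 x ⊆ Icc 0 a := by
    rw [uIcc_of_le hx.1]; exact Icc_subset_Icc_right hx.2
  have p1 := (continuousOn_primitive_edge φ c1).mono hu
  have p2 := (continuousOn_primitive_edge φ c2).mono hu
  have e1 := mul_primitive hx.1 (intervalIntegrable_mul_edge φ c1 hx) (hasDerivAt_waveSin k)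
    (by fun_prop)
  have e2 := mul_primitive hx.1 (intervalIntegrable_mul_edge φ c2 hx) (hasDerivAt_waveCos k)
    (by fun_prop)
  have i1 : IntervalIntegrable (fun s => waveSin k s * (waveCos k s * φ s)) volume 0 x :=
    (intervalIntegrable_mul_edge φ c1 hx).continuousOn_mul c2.continuousOn
  have i2 : IntervalIntegrable (fun s => waveCos k s * (waveSin k s * φ s)) volume 0 x :=
    (intervalIntegrable_mul_edge φ c2 hx).continuousOn_mul c1.continuousOn
  have j1 : IntervalIntegrable (fun s => k * waveCos k s * ∫ t in (0 : ℝ)..s, waveCos k t * φ t)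
      volume 0 x := ((by fun_prop : Continuous fun s => k * waveCos k s).continuousOn.mul
        p1).intervalIntegrable
  have j2 : IntervalIntegrable (fun s => -k * waveSin k s * ∫ t in (0 : ℝ)..s, waveSin k t * φ t)
      volume 0 x := ((by fun_prop : Continuous fun s => -k * waveSin k s).continuousOn.mul
        p2).intervalIntegrable
  have e3 : ∀ s, (k * waveCos k s * (∫ t in (0 : ℝ)..s, waveCos k t * φ t) +
      waveSin k s * (waveCos k s * φ s)) - (-k * waveSin k s *
      (∫ t in (0 : ℝ)..s, waveSin k t * φ t) + waveCos k s * (waveSin k s * φ s)) =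
      -k * particularDeriv k φ s := by
    intro s
    unfold particularDeriv
    ring
  rw [particular, e1, e2, ← intervalIntegral.integral_sub (j1.add i1) (j2.add i2)]
  simp only [e3, intervalIntegral.integral_const_mul]
  field_simp

/-- Here the two terms that contain φ itself add up to φ, because cos² + sin² = 1. -/
theorem particularDeriv_eq_integral {k : ℝ} (hk : k ≠ 0) {x : ℝ} (hx : x ∈ Icc 0 a) :
    particularDeriv k φ x = ∫ t in (0 : ℝ)..x, -(φ t + k ^ 2 * particular k φ t) := by
  have hk' : (k : ℂ) ≠ 0 := by exact_mod_cast hk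
  have c1 := continuous_waveCos k
  have c2 := continuous_waveSin k
  have hu : uIcc 0 x ⊆ Icc 0 a := by
    rw [uIcc_of_le hx.1]; exact Icc_subset_Icc_right hx.2
  have p1 := (continuousOn_primitive_edge φ c1).mono hu
  have p2 := (continuousOn_primitive_edge φ c2).mono hu
  have e1 := mul_primitive hx.1 (intervalIntegrable_mul_edge φ c1 hx) (hasDerivAt_waveCos k)
    (by fun_prop)
  have e2 := mul_primitive hx.1 (intervalIntegrable_mul_edge φ c2 hx) (hasDerivAt_waveSin k)
    (by fun_prop)
  have i1 : IntervalIntegrable (fun s => waveCos k s * (waveCos k s * φ s)) volume 0 x :=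
    (intervalIntegrable_mul_edge φ c1 hx).continuousOn_mul c1.continuousOn
  have i2 : IntervalIntegrable (fun s => waveSin k s * (waveSin k s * φ s)) volume 0 x :=
    (intervalIntegrable_mul_edge φ c2 hx).continuousOn_mul c2.continuousOn
  have j1 : IntervalIntegrable (fun s => -k * waveSin k s * ∫ t in (0 : ℝ)..s, waveCos k t * φ t)
      volume 0 x := ((by fun_prop : Continuous fun s => -k * waveSin k s).continuousOn.mul
        p1).intervalIntegrable
  have j2 : IntervalIntegrable (fun s => k * waveCos k s * ∫ t in (0 : ℝ)..s, waveSin k t * φ t)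
      volume 0 x := ((by fun_prop : Continuous fun s => k * waveCos k s).continuousOn.mul
        p2).intervalIntegrable
  have e3 : ∀ s, (-k * waveSin k s * (∫ t in (0 : ℝ)..s, waveCos k t * φ t) +
      waveCos k s * (waveCos k s * φ s)) + (k * waveCos k s *
      (∫ t in (0 : ℝ)..s, waveSin k t * φ t) + waveSin k s * (waveSin k s * φ s)) =
      φ s + k ^ 2 * particular k φ s := by
    intro s
    unfold particular
    field_simp
    linear_combination φ s * waveCos_sq_add k s
  rw [particularDeriv, e1, e2, ← intervalIntegral.integral_add (j1.add i1) (j2.add i2)]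
  simp only [e3, intervalIntegral.integral_neg]

theorem norm_particular_le {k : ℝ} {x : ℝ} (hx : x ∈ Icc 0 a) :
    ‖particular k φ x‖ ≤ 2 * Real.sqrt a / |k| * ‖φ‖ := by
  have h1 := norm_integral_edge_le φ (norm_waveCos_le k) hx
  have h2 := norm_integral_edge_le φ (norm_waveSin_le k) hx
  rw [particular, norm_div, norm_neg, Complex.norm_real, Real.norm_eq_abs, div_mul_eq_mul_div]
  gcongr
  refine (norm_sub_le _ _).trans ?_
  rw [norm_mul, norm_mul]
  have h3 := mul_le_mul (norm_waveSin_le k x) h1 (norm_nonneg _) zero_le_one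
  have h4 := mul_le_mul (norm_waveCos_le k x) h2 (norm_nonneg _) zero_le_one
  linarith

end

section
variable {a : ℝ} (k : ℝ)

theorem integral_mul_add_edge {h : ℝ → ℂ} (hc : Continuous h) (φ ψ : EdgeSpace a) {x : ℝ}
    (hx : x ∈ Icc 0 a) : ∫ t in (0 : ℝ)..x, h t * (φ + ψ : EdgeSpace a) t =
      (∫ t in (0 : ℝ)..x, h t * φ t) + ∫ t in (0 : ℝ)..x, h t * ψ t := by
  rw [← intervalIntegral.integral_add (intervalIntegrable_mul_edge φ hc hx)
    (intervalIntegrable_mul_edge ψ hc hx)]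
  refine integral_congr_edge ?_ hx
  filter_upwards [Lp.coeFn_add φ ψ] with x hx
  rw [hx, Pi.add_apply]
  ring

theorem integral_mul_smul_edge {h : ℝ → ℂ} (c : ℂ) (φ : EdgeSpace a) {x : ℝ}
    (hx : x ∈ Icc 0 a) : ∫ t in (0 : ℝ)..x, h t * (c • φ : EdgeSpace a) t =
      c * ∫ t in (0 : ℝ)..x, h t * φ t := by
  rw [← intervalIntegral.integral_const_mul]
  refine integral_congr_edge ?_ hx
  filter_upwards [Lp.coeFn_smul c φ] with x hx
  rw [hx, Pi.smul_apply, smul_eq_mul]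
  ring

/-- The integral against a bounded continuous function, as a functional on `L²(0, a)`. -/
def integralCLM (ha : 0 ≤ a) {h : ℝ → ℂ} (hc : Continuous h) (hh : ∀ t, ‖h t‖ ≤ 1) :
    EdgeSpace a →L[ℂ] ℂ :=
  LinearMap.mkContinuous
    { toFun φ := ∫ t in (0 : ℝ)..a, h t * φ t
      map_add' φ ψ := integral_mul_add_edge hc φ ψ (right_mem_Icc.2 ha)
      map_smul' c φ := integral_mul_smul_edge c φ (right_mem_Icc.2 ha) }
    (Real.sqrt a) fun φ => norm_integral_edge_le φ hh (right_mem_Icc.2 ha)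

/-- The value at `a` of the solution of `-ψ'' - k² ψ = φ` with vanishing data at `0`. -/
def endValueCLM (ha : 0 ≤ a) : EdgeSpace a →L[ℂ] ℂ :=
  (-(waveSin k a / k)) • integralCLM ha (continuous_waveCos k) (norm_waveCos_le k) +
    (waveCos k a / k) • integralCLM ha (continuous_waveSin k) (norm_waveSin_le k)

theorem endValueCLM_apply (ha : 0 ≤ a) (φ : EdgeSpace a) :
    endValueCLM k ha φ = particular k φ a := by
  change -(waveSin k a / k) * (∫ t in (0 : ℝ)..a, waveCos k t * φ t) +
    (waveCos k a / k) * (∫ t in (0 : ℝ)..a, waveSin k t * φ t) = particular k φ a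
  unfold particular
  ring

/-- The derivative at `a` of the solution of `-ψ'' - k² ψ = φ` with vanishing data at `0`. -/
def endDerivCLM (ha : 0 ≤ a) : EdgeSpace a →L[ℂ] ℂ :=
  (-waveCos k a) • integralCLM ha (continuous_waveCos k) (norm_waveCos_le k) +
    (-waveSin k a) • integralCLM ha (continuous_waveSin k) (norm_waveSin_le k)

theorem endDerivCLM_apply (ha : 0 ≤ a) (φ : EdgeSpace a) :
    endDerivCLM k ha φ = particularDeriv k φ a := by
  change -waveCos k a * (∫ t in (0 : ℝ)..a, waveCos k t * φ t) +
    -waveSin k a * (∫ t in (0 : ℝ)..a, waveSin k t * φ t) = particularDeriv k φ a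
  unfold particularDeriv
  ring

/-- The solution of `-ψ'' - k² ψ = φ` with vanishing data at `0`, as an operator on
`L²(0, a)`. -/
def particularCLM (a k : ℝ) : EdgeSpace a →L[ℂ] EdgeSpace a :=
  LinearMap.mkContinuous
    { toFun φ := edgeLp (continuousOn_particular k φ)
      map_add' φ ψ := by
        refine Lp.ext ?_
        refine EventuallyEq.trans ?_ (Lp.coeFn_add _ _).symm
        filter_upwards [edgeLp_ae_eq (continuousOn_particular k (φ + ψ)),
          edgeLp_ae_eq (continuousOn_particular k φ), edgeLp_ae_eq (continuousOn_particular k ψ),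
          ae_restrict_mem measurableSet_Ioo] with x h1 h2 h3 hx
        have hx' := Ioo_subset_Icc_self hx
        rw [h1, Pi.add_apply, h2, h3, particular,
          integral_mul_add_edge (continuous_waveCos k) _ _ hx',
          integral_mul_add_edge (continuous_waveSin k) _ _ hx', particular, particular]
        ring
      map_smul' c φ := by
        refine Lp.ext ?_
        refine EventuallyEq.trans ?_ (Lp.coeFn_smul _ _).symm
        filter_upwards [edgeLp_ae_eq (continuousOn_particular k (c • φ)),
          edgeLp_ae_eq (continuousOn_particular k φ),
          ae_restrict_mem measurableSet_Ioo] with x h1 h2 hx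
        have hx' := Ioo_subset_Icc_self hx
        rw [h1, Pi.smul_apply, RingHom.id_apply, h2, particular,
          integral_mul_smul_edge _ _ hx', integral_mul_smul_edge _ _ hx', particular, smul_eq_mul]
        ring }
    ((volume.restrict (Ioo (0 : ℝ) a)).real univ ^ ((2 : ENNReal).toReal⁻¹) *
      (2 * Real.sqrt a / |k|)) fun φ => by
      rw [mul_assoc]
      refine Lp.norm_le_of_ae_bound (by positivity) ?_
      filter_upwards [edgeLp_ae_eq (continuousOn_particular k φ),
        ae_restrict_mem measurableSet_Ioo] with x h1 hx
      simp only [LinearMap.coe_mk, AddHom.coe_mk]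
      rw [h1]
      exact norm_particular_le φ (Ioo_subset_Icc_self hx)

theorem isSobolevRep_particular {k : ℝ} (hk : k ≠ 0) (φ : EdgeSpace a) :
    IsSobolevRep a (particularCLM a k φ) (-(φ + (k ^ 2 : ℂ) • particularCLM a k φ))
      (particular k φ) (particularDeriv k φ) where
  ae_eq := edgeLp_ae_eq (continuousOn_particular k φ)
  prim x hx := by
    rw [particular_eq_integral φ hk hx]
    simp [particular]
  prim' x hx := by
    rw [particularDeriv_eq_integral φ hk hx]
    simp only [particularDeriv, intervalIntegral.integral_same, mul_zero, add_zero, neg_zero,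
      zero_add]
    refine integral_congr_edge ?_ hx
    filter_upwards [Lp.coeFn_neg (φ + (k ^ 2 : ℂ) • particularCLM a k φ),
      Lp.coeFn_add φ ((k ^ 2 : ℂ) • particularCLM a k φ),
      Lp.coeFn_smul (k ^ 2 : ℂ) (particularCLM a k φ),
      edgeLp_ae_eq (continuousOn_particular k φ)] with x h1 h2 h3 h4
    rw [h1, Pi.neg_apply, h2, Pi.add_apply, h3, Pi.smul_apply, smul_eq_mul]
    congr 3
    exact h4.symm

/-- Solutions of `-f'' = k² f` are twice weakly differentiable. -/
theorem isSobolevRep_wave (a : ℝ) {k : ℝ} {f f' : ℝ → ℂ} (h : ∀ t, HasDerivAt f (f' t) t)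
    (h' : ∀ t, HasDerivAt f' (-(k ^ 2 * f t)) t) (hf : ContinuousOn f (Icc 0 a)) :
    IsSobolevRep a (edgeLp hf) (-((k ^ 2 : ℂ) • edgeLp hf)) f f' := by
  have hc : Continuous f := continuous_iff_continuousAt.2 fun t => (h t).continuousAt
  have e : -((k ^ 2 : ℂ) • edgeLp hf) =
      edgeLp ((by fun_prop : Continuous fun t => -(k ^ 2 * f t)).continuousOn (s := Icc 0 a)) := by
    refine Lp.ext ?_
    filter_upwards [Lp.coeFn_neg ((k ^ 2 : ℂ) • edgeLp hf), Lp.coeFn_smul (k ^ 2 : ℂ) (edgeLp hf),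
      edgeLp_ae_eq hf, edgeLp_ae_eq
        ((by fun_prop : Continuous fun t => -(k ^ 2 * f t)).continuousOn (s := Icc 0 a))]
      with x h1 h2 h3 h4
    rw [h1, Pi.neg_apply, h2, Pi.smul_apply, h3, h4, smul_eq_mul]
  rw [e]
  exact isSobolevRep_of_hasDerivAt h h' hf (by fun_prop)

theorem hasDerivAt_waveCos_deriv (k t : ℝ) :
    HasDerivAt (fun t => -k * waveSin k t) (-(k ^ 2 * waveCos k t)) t :=
  ((hasDerivAt_waveSin k t).const_mul (-k : ℂ)).congr_deriv (by ring)

theorem hasDerivAt_waveSin_deriv (k t : ℝ) :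
    HasDerivAt (fun t => k * waveCos k t) (-(k ^ 2 * waveSin k t)) t :=
  ((hasDerivAt_waveCos k t).const_mul (k : ℂ)).congr_deriv (by ring)

/-- On an edge, the solutions of `-ψ'' = k² ψ` are the combinations of `cos kt` and `sin kt`. -/
theorem IsSobolevRep.eq_wave {k : ℝ} (hk : k ≠ 0) {u : EdgeSpace a} {f g : ℝ → ℂ}
    (h : IsSobolevRep a u (-((k ^ 2 : ℂ) • u)) f g) {x : ℝ} (hx : x ∈ Icc 0 a) :
    f x = f 0 * waveCos k x + g 0 / k * waveSin k x ∧
      g x = g 0 * waveCos k x - f 0 * k * waveSin k x := by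
  have hk' : (k : ℂ) ≠ 0 := by exact_mod_cast hk
  have hg : ∀ x ∈ Icc 0 a, g x = g 0 + ∫ t in (0 : ℝ)..x, -(k ^ 2 * f t) := by
    intro x hx
    rw [h.prim' x hx]
    congr 1
    refine integral_congr_edge ?_ hx
    filter_upwards [Lp.coeFn_neg ((k ^ 2 : ℂ) • u), Lp.coeFn_smul (k ^ 2 : ℂ) u, h.ae_eq]
      with x h1 h2 h3
    rw [h1, Pi.neg_apply, h2, Pi.smul_apply, h3, smul_eq_mul]
  -- The integrands are continuous on [0, a] only, so one-sided derivatives are taken; these suffice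
  -- to recognise constants.
  have key : ∀ {F G : ℝ → ℂ}, ContinuousOn G (Icc 0 a) →
      (∀ x ∈ Icc 0 a, F x = F 0 + ∫ t in (0 : ℝ)..x, G t) →
      ∀ x ∈ Ico 0 a, HasDerivWithinAt F (G x) (Ici x) x := by
    intro F G hG hF x hx
    have ha : 0 ≤ a := hx.1.trans hx.2.le
    have hi : IntervalIntegrable G volume 0 x := by
      apply ContinuousOn.intervalIntegrable
      rw [uIcc_of_le hx.1]
      exact hG.mono (Icc_subset_Icc_right hx.2.le)
    have hm : Icc 0 a ∈ nhdsWithin x (Ioi x) :=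
      mem_of_superset (Ioo_mem_nhdsGT hx.2)
        fun y hy => ⟨hx.1.trans hy.1.le, hy.2.le⟩
    have h1 : HasDerivWithinAt (fun y => F 0 + ∫ t in (0 : ℝ)..y, G t) (G x) (Ici x) x := by
      refine HasDerivWithinAt.const_add _ (intervalIntegral.integral_hasDerivWithinAt_right hi
        (s := Ici x) (t := Ioi x) ?_ ?_)
      · exact ⟨Icc 0 a, hm, hG.aestronglyMeasurable measurableSet_Icc⟩
      · exact (hG x ⟨hx.1, hx.2.le⟩).mono_of_mem_nhdsWithin hm
    refine h1.congr_of_eventuallyEq ?_ (hF x ⟨hx.1, hx.2.le⟩)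
    exact mem_of_superset (Ico_mem_nhdsGE hx.2) fun y hy => hF y ⟨hx.1.trans hy.1, hy.2.le⟩
  have df := key h.continuousOn_deriv h.prim
  have dg := key (G := fun t => -(k ^ 2 * f t)) (by have := h.continuousOn; fun_prop) hg
  have dcos := fun y => (hasDerivAt_waveCos k y).hasDerivWithinAt (s := Ici y)
  have dsin := fun y => (hasDerivAt_waveSin k y).hasDerivWithinAt (s := Ici y)
  have cf := h.continuousOn
  have cg := h.continuousOn_deriv
  have ccos := continuous_waveCos k
  have csin := continuous_waveSin k
  -- The pair (f, g/k) rotates with angular velocity k; rotating it back through the angle kx gives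
  -- two conserved quantities.
  have e1 : f x * waveCos k x - g x / k * waveSin k x =
      f 0 * waveCos k 0 - g 0 / k * waveSin k 0 := by
    refine constant_of_has_deriv_right_zero (f := fun x => f x * waveCos k x -
      g x / k * waveSin k x) (by fun_prop) (fun y hy => ?_) x hx
    refine (((df y hy).mul (dcos y)).sub (((dg y hy).div_const (k : ℂ)).mul (dsin y))).congr_deriv ?_
    field_simp
    ring
  have e2 : f x * waveSin k x + g x / k * waveCos k x =
      f 0 * waveSin k 0 + g 0 / k * waveCos k 0 := by
    refine constant_of_has_deriv_right_zero (f := fun x => f x * waveSin k x +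
      g x / k * waveCos k x) (by fun_prop) (fun y hy => ?_) x hx
    refine (((df y hy).mul (dsin y)).add (((dg y hy).div_const (k : ℂ)).mul (dcos y))).congr_deriv ?_
    field_simp
    ring
  simp only [waveCos_zero, waveSin_zero] at e1 e2
  have e3 := waveCos_sq_add k x
  constructor
  · linear_combination waveCos k x * e1 + waveSin k x * e2 - f x * e3
  · field_simp at e1 e2
    linear_combination waveCos k x * e2 - waveSin k x * e1 - g x * e3

end

end SquareLattice

end

/-! ### Truncated plane waves and extension by zero -/

noncomputable section

namespace SquareLattice

open ComplexConjugate

theorem norm_sq_eq_sum (v : LatticeSpace) {s : Finset (ℤ × ℤ)} (hs : ∀ p ∉ s, v p = 0) :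
    ‖v‖ ^ 2 = ∑ p ∈ s, ‖v p‖ ^ 2 := by
  have h := lp.norm_rpow_eq_tsum (p := 2) (by norm_num) v
  rw [tsum_eq_sum (s := s) fun p hp => by rw [hs p hp]; norm_num] at h
  norm_num at h
  exact h

/-- The deviation of a function on the lattice from the Bloch condition in one direction. -/
def blochDefect (p : ℤ × ℤ) (θ : ℝ) (w : LatticeSpace) : LatticeSpace :=
  conj (phase θ) • shift p w - w

/-- Every point of the torus is a joint approximate eigenvalue of the two translations. -/
theorem exists_approx_bloch (θ₁ θ₂ C : ℝ) :
    ∃ w : LatticeSpace,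
      C * (‖blochDefect (1, 0) θ₁ w‖ + ‖blochDefect (0, 1) θ₂ w‖) < ‖w‖ := by
  -- The truncation to an N × N box has norm² equal to N², while each defect lives on 2N sites and
  -- has norm² at most 2N. As (x + y)² ≤ 2(x² + y²), the claim holds once 8C² < N.
  obtain ⟨N, hN⟩ := exists_nat_gt (8 * C ^ 2)
  have hN0 : (0 : ℝ) < N := lt_of_le_of_lt (by positivity) hN
  let I : Finset ℤ := Finset.Ico 0 (N : ℤ)
  let b : Finset (ℤ × ℤ) := I ×ˢ I
  let f : ℤ × ℤ → ℂ := fun p => if p ∈ b then phase θ₁ ^ p.1 * phase θ₂ ^ p.2 else 0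
  have hn : ∀ p : ℤ × ℤ, ‖phase θ₁ ^ p.1 * phase θ₂ ^ p.2‖ = 1 := by
    intro p
    rw [norm_mul, norm_zpow, norm_zpow, norm_phase, norm_phase, one_zpow, one_zpow, one_mul]
  have hf : Memℓp f 2 := by
    refine memℓp_gen (summable_of_ne_finset_zero (s := b) fun p hp => ?_)
    simp [f, hp]
  let w : LatticeSpace := ⟨f, hf⟩
  have hw : ∀ p, w p = f p := fun _ => rfl
  have hI : (I.card : ℝ) = N := by simp [I]
  have hwn : ‖w‖ ^ 2 = N * N := by
    have h1 : ∀ p ∈ b, ‖w p‖ ^ 2 = 1 := by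
      intro p hp
      rw [hw]
      simp only [f, hp, if_true]
      rw [hn, one_pow]
    rw [norm_sq_eq_sum w (s := b) fun p hp => by simp [hw, f, hp], Finset.sum_congr rfl h1,
      Finset.sum_const, Finset.card_product, nsmul_eq_mul, mul_one]
    push_cast
    rw [hI]
  -- Inside the box the two terms of the defect cancel; what remains sits where exactly one of p and
  -- p + q is in the box, and this is contained in s.
  have bound : ∀ (q : ℤ × ℤ) (θ : ℝ) (s : Finset (ℤ × ℤ)), s.card ≤ 2 * I.card →
      (∀ p, conj (phase θ) * (phase θ₁ ^ (p + q).1 * phase θ₂ ^ (p + q).2) =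
        phase θ₁ ^ p.1 * phase θ₂ ^ p.2) →
      (∀ p ∉ s, (p + q ∈ b ↔ p ∈ b)) → ‖blochDefect q θ w‖ ^ 2 ≤ 2 * N := by
    intro q θ s hs hq hb
    have hd : ∀ p, blochDefect q θ w p = (if p + q ∈ b then phase θ₁ ^ p.1 * phase θ₂ ^ p.2 else 0)
        - if p ∈ b then phase θ₁ ^ p.1 * phase θ₂ ^ p.2 else 0 := by
      intro p
      change conj (phase θ) * f (p + q) - f p = _
      by_cases h1 : p + q ∈ b
      · simp only [f, h1, if_true]
        rw [hq]
      · simp only [f, h1, if_false, mul_zero]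
    rw [norm_sq_eq_sum _ (s := s) fun p hp => by rw [hd]; simp only [hb p hp, sub_self]]
    calc ∑ p ∈ s, ‖blochDefect q θ w p‖ ^ 2 ≤ ∑ p ∈ s, (1 : ℝ) := by
          refine Finset.sum_le_sum fun p _ => ?_
          rw [hd]
          split_ifs <;> simp [norm_phase]
      _ = s.card := by simp
      _ ≤ 2 * N := by rw [← hI]; exact_mod_cast hs
  have z1 : phase θ₁ ≠ 0 := left_ne_zero_of_mul_eq_one (phase_mul_conj θ₁)
  have z2 : phase θ₂ ≠ 0 := left_ne_zero_of_mul_eq_one (phase_mul_conj θ₂)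
  -- Translation by one column changes membership in the box only in the columns -1 and N - 1.
  have b1 := bound (1, 0) θ₁ (({-1, (N : ℤ) - 1} : Finset ℤ) ×ˢ I) (by
      rw [Finset.card_product]; gcongr; exact Finset.card_le_two)
    (fun p => by
      simp only [Prod.fst_add, Prod.snd_add, add_zero]
      rw [zpow_add₀ z1, zpow_one]
      linear_combination (phase θ₁ ^ p.1 * phase θ₂ ^ p.2) * phase_mul_conj θ₁)
    (fun p hp => by
      obtain ⟨m, n⟩ := p
      simp [b, I] at hp ⊢
      omega)
  have b2 := bound (0, 1) θ₂ (I ×ˢ ({-1, (N : ℤ) - 1} : Finset ℤ)) (by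
      rw [Finset.card_product, mul_comm]; gcongr; exact Finset.card_le_two)
    (fun p => by
      simp only [Prod.fst_add, Prod.snd_add, add_zero]
      rw [zpow_add₀ z2, zpow_one]
      linear_combination (phase θ₁ ^ p.1 * phase θ₂ ^ p.2) * phase_mul_conj θ₂)
    (fun p hp => by
      obtain ⟨m, n⟩ := p
      simp [b, I] at hp ⊢
      omega)
  refine ⟨w, lt_of_pow_lt_pow_left₀ 2 (norm_nonneg w) ?_⟩
  rw [hwn, mul_pow]
  nlinarith [sq_nonneg (‖blochDefect (1, 0) θ₁ w‖ - ‖blochDefect (0, 1) θ₂ w‖), sq_nonneg C,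
    mul_le_mul_of_nonneg_left (add_le_add b1 b2) (sq_nonneg C)]

/-- Extension by zero along an injective map, as an operator on square summable families. -/
def lpExtend {ι κ E : Type*} [NormedAddCommGroup E] [NormedSpace ℂ E] (ρ : ι → κ)
    (hρ : ρ.Injective) : lp (fun _ : ι => E) 2 →L[ℂ] lp (fun _ : κ => E) 2 :=
  have key (v : lp (fun _ : ι => E) 2) :
      HasSum (fun j => ‖Function.extend ρ v 0 j‖ ^ (2 : ENNReal).toReal)
        (‖v‖ ^ (2 : ENNReal).toReal) := by
    have h := lp.hasSum_norm (p := 2) (by norm_num) v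
    refine (hρ.hasSum_iff ?_).1 ?_
    · intro j hj
      rw [Function.extend_apply' _ _ _ hj]
      norm_num
    · simpa only [Function.comp_def, hρ.extend_apply] using h
  LinearMap.mkContinuous
    { toFun v := ⟨Function.extend ρ v 0, memℓp_gen (key v).summable⟩
      map_add' v w := by
        ext j
        change Function.extend ρ (⇑(v + w)) 0 j = Function.extend ρ v 0 j + Function.extend ρ w 0 j
        by_cases hj : ∃ i, ρ i = j
        · obtain ⟨i, rfl⟩ := hj
          simp only [hρ.extend_apply]
          rfl
        · rw [Function.extend_apply' _ _ _ hj, Function.extend_apply' _ _ _ hj,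
            Function.extend_apply' _ _ _ hj]
          simp
      map_smul' c v := by
        ext j
        change Function.extend ρ (⇑(c • v)) 0 j = c • Function.extend ρ v 0 j
        by_cases hj : ∃ i, ρ i = j
        · obtain ⟨i, rfl⟩ := hj
          simp only [hρ.extend_apply]
          rfl
        · simp [Function.extend_apply' _ _ _ hj] }
    1
    fun v => by
      rw [one_mul]
      exact lp.norm_le_of_tsum_le (by norm_num) (norm_nonneg v) (key v).tsum_eq.le

theorem lpExtend_apply {ι κ E : Type*} [NormedAddCommGroup E] [NormedSpace ℂ E] (ρ : ι → κ)
    (hρ : ρ.Injective) (v : lp (fun _ : ι => E) 2) (i : ι) : lpExtend ρ hρ v (ρ i) = v i :=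
  hρ.extend_apply _ _ _

theorem lpExtend_apply' {ι κ E : Type*} [NormedAddCommGroup E] [NormedSpace ℂ E] (ρ : ι → κ)
    (hρ : ρ.Injective) (v : lp (fun _ : ι => E) 2) (j : κ) (hj : ¬∃ i, ρ i = j) :
    lpExtend ρ hρ v j = 0 :=
  Function.extend_apply' _ _ _ hj

end SquareLattice

end

/-! ### From the vertex coupling to a difference equation, and the right inverse of H - k² -/

noncomputable section

namespace SquareLattice

open ComplexConjugate

/-- In this form the coupling is solved by Ψ = (x, T*x) and Ψ' = (Sx - Ty, y), with x the two
horizontal values and y the two vertical outward derivatives. These are the four unknowns per vertex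
of the Bloch matrix. -/
theorem vertexCoupling_iff (a : ℝ) (S T : Matrix (Fin 2) (Fin 2) ℂ) (f g : Edge → ℝ → ℂ)
    (m n : ℤ) :
    VertexCoupling S T (boundaryValue a f m n) (boundaryDeriv a g m n) ↔
      (-g ((m - 1, n), .horizontal) a - T 0 0 * g ((m, n - 1), .vertical) a +
          T 0 1 * g ((m, n), .vertical) 0 =
        S 0 0 * f ((m - 1, n), .horizontal) a + S 0 1 * f ((m, n), .horizontal) 0) ∧
      (g ((m, n), .horizontal) 0 - T 1 0 * g ((m, n - 1), .vertical) a +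
          T 1 1 * g ((m, n), .vertical) 0 =
        S 1 0 * f ((m - 1, n), .horizontal) a + S 1 1 * f ((m, n), .horizontal) 0) ∧
      f ((m, n - 1), .vertical) a = conj (T 0 0) * f ((m - 1, n), .horizontal) a +
        conj (T 1 0) * f ((m, n), .horizontal) 0 ∧
      f ((m, n), .vertical) 0 = conj (T 0 1) * f ((m - 1, n), .horizontal) a +
        conj (T 1 1) * f ((m, n), .horizontal) 0 := by
  unfold VertexCoupling boundaryValue boundaryDeriv
  simp only [funext_iff, Sum.forall, Fin.forall_fin_two]
  simp [Matrix.mulVec, dotProduct, Fin.sum_univ_two]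
  constructor
  · rintro ⟨⟨h1, h2⟩, h3, h4⟩
    exact ⟨by linear_combination h1, by linear_combination h2, by linear_combination -h3,
      by linear_combination -h4⟩
  · rintro ⟨h1, h2, h3, h4⟩
    exact ⟨⟨by linear_combination h1, by linear_combination h2⟩, by linear_combination -h3,
      by linear_combination -h4⟩

theorem hamiltonian_mem {a : ℝ} (ha : 0 < a) {S T : Matrix (Fin 2) (Fin 2) ℂ}
    {p : StateSpace a × StateSpace a} (hp : p ∈ hamiltonianGraph a S T) :
    ∃ x : (hamiltonian a S T).domain, (x : StateSpace a) = p.1 ∧ hamiltonian a S T x = p.2 := by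
  rw [← hamiltonian_graph ha] at hp
  obtain ⟨x, h1, h2⟩ := (LinearPMap.mem_graph_iff _).1 hp
  exact ⟨x, h1, h2⟩

theorem hamiltonian_apply_mem {a : ℝ} (ha : 0 < a) {S T : Matrix (Fin 2) (Fin 2) ℂ}
    (x : (hamiltonian a S T).domain) :
    ((x : StateSpace a), hamiltonian a S T x) ∈ hamiltonianGraph a S T := by
  rw [← hamiltonian_graph ha]
  exact (hamiltonian a S T).mem_graph x

/-- A functional on the edges of one direction, as an operator to functions on the lattice. -/
def edgeFunctional {a : ℝ} (d : Direction) (l : EdgeSpace a →L[ℂ] ℂ) :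
    StateSpace a →L[ℂ] LatticeSpace :=
  (lp.mapCLM 2 (fun _ => l) (norm_nonneg l) fun _ => le_rfl).comp
    (lpComp (fun p : ℤ × ℤ => (p, d)) (Prod.mk_left_injective d))

/-- The state that is a multiple of `u` on each edge of one direction and vanishes on the other
edges. -/
def spread {a : ℝ} (d : Direction) (u : EdgeSpace a) : LatticeSpace →L[ℂ] StateSpace a :=
  (lpExtend (fun p : ℤ × ℤ => (p, d)) (Prod.mk_left_injective d)).comp
    (lp.mapCLM 2 (fun _ => ContinuousLinearMap.toSpanSingleton ℂ u) (norm_nonneg _)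
      fun _ => le_rfl)

theorem spread_apply {a : ℝ} (d : Direction) (u : EdgeSpace a) (w : LatticeSpace) (p : ℤ × ℤ) :
    spread d u w (p, d) = w p • u :=
  lpExtend_apply (fun p : ℤ × ℤ => (p, d)) (Prod.mk_left_injective d) _ p

theorem spread_apply_ne {a : ℝ} {d d' : Direction} (h : d ≠ d') (u : EdgeSpace a)
    (w : LatticeSpace) (p : ℤ × ℤ) : spread d u w (p, d') = 0 := by
  refine lpExtend_apply' (fun p : ℤ × ℤ => (p, d)) (Prod.mk_left_injective d) _ _ ?_
  rintro ⟨q, hq⟩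
  exact h (congrArg Prod.snd hq)

theorem matrixSymbol_shift_apply {n : Type*} [Fintype n] (M₀ M₁ M₂ : Matrix n n ℂ)
    (X : n → LatticeSpace) (i : n) (p : ℤ × ℤ) :
    (∑ j, matrixSymbol M₀ M₁ M₂ (shift (1, 0)) (shift (0, 1)) i j (X j) : LatticeSpace) p =
      ∑ j, (M₀ i j * X j p + M₁ i j * X j (p + (1, 0)) + M₂ i j * X j (p + (0, 1))) := by
  rw [lp.coeFn_sum, Finset.sum_apply]
  rfl

/-- The rows transport the near-end data of the horizontal and of the vertical edge to the far end,
where they must agree with the data u or v of the next vertex; y is the contribution of an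
inhomogeneity on the edge. -/
theorem bloch_mul_iff (S T : Matrix (Fin 2) (Fin 2) ℂ) (c s r : ℂ) (x u v y : Fin 4 → ℂ) :
    (∀ i, ∑ j, (blochConst S T c s r i j * x j + blochHorizontal S T i j * u j +
      blochVertical T i j * v j) = y i) ↔
    (u 0 - c * x 1 - s * (S 1 0 * x 0 + S 1 1 * x 1 - T 1 0 * x 2 - T 1 1 * x 3) = y 0 ∧
    (S 0 0 * u 0 + S 0 1 * u 1 - T 0 0 * u 2 - T 0 1 * u 3) - r * x 1 +
      c * (S 1 0 * x 0 + S 1 1 * x 1 - T 1 0 * x 2 - T 1 1 * x 3) = y 1 ∧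
    (conj (T 0 0) * v 0 + conj (T 1 0) * v 1) - c * (conj (T 0 1) * x 0 + conj (T 1 1) * x 1) -
      s * x 3 = y 2 ∧
    v 2 - r * (conj (T 0 1) * x 0 + conj (T 1 1) * x 1) + c * x 3 = y 3) := by
  have h4 : ∀ P : Fin 4 → Prop, (∀ i, P i) ↔ P 0 ∧ P 1 ∧ P 2 ∧ P 3 := fun P =>
    ⟨fun h => ⟨h 0, h 1, h 2, h 3⟩, fun ⟨h0, h1, h2, h3⟩ i => by fin_cases i <;> assumption⟩
  rw [h4]
  simp only [Fin.sum_univ_four, blochConst, blochHorizontal, blochVertical, Matrix.of_apply,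
    Matrix.cons_val]
  refine and_congr ?_ (and_congr ?_ (and_congr ?_ ?_)) <;> refine Eq.congr_left ?_ <;> ring


set_option maxHeartbeats 1000000 in
/-- If the difference operator has a right inverse then `H - k²` has a bounded right inverse. -/
theorem exists_right_inverse {a : ℝ} (ha : 0 < a) {k : ℝ} (hk : k ≠ 0)
    (S T : Matrix (Fin 2) (Fin 2) ℂ) {K : Matrix (Fin 4) (Fin 4) (LatticeSpace →L[ℂ] LatticeSpace)}
    (hK : matrixSymbol (blochConst S T (waveCos k a) (waveSin k a / k) (k * waveSin k a))
      (blochHorizontal S T) (blochVertical T) (shift (1, 0)) (shift (0, 1)) * K = 1) :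
    ∃ R : StateSpace a →L[ℂ] StateSpace a,
      ∀ φ, (R φ, φ + (k ^ 2 : ℂ) • R φ) ∈ hamiltonianGraph a S T := by
  have hk' : (k : ℂ) ≠ 0 := by exact_mod_cast hk
  -- The particular solutions have vanishing data at the near ends, so they disturb the coupling at
  -- the far ends only. The signs of the derivative entries come from the outward orientation there.
  let rhs : Fin 4 → (StateSpace a →L[ℂ] LatticeSpace) :=
    ![edgeFunctional .horizontal (endValueCLM k ha.le),
      -edgeFunctional .horizontal (endDerivCLM k ha.le),
      edgeFunctional .vertical (endValueCLM k ha.le),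
      -edgeFunctional .vertical (endDerivCLM k ha.le)]
  let X : Fin 4 → (StateSpace a →L[ℂ] LatticeSpace) := fun j => ∑ l, (K j l).comp (rhs l)
  have hX : ∀ φ i, ∑ j, matrixSymbol (blochConst S T (waveCos k a) (waveSin k a / k)
      (k * waveSin k a)) (blochHorizontal S T) (blochVertical T) (shift (1, 0)) (shift (0, 1)) i j
      (X j φ) = rhs i φ := by
    intro φ i
    have h1 : ∀ j, X j φ = ∑ l, K j l (rhs l φ) := fun j => by
      simp [X]
    simp only [h1, map_sum]
    rw [Finset.sum_comm]
    have h2 : ∀ l, ∑ j, matrixSymbol (blochConst S T (waveCos k a) (waveSin k a / k)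
      (k * waveSin k a)) (blochHorizontal S T) (blochVertical T) (shift (1, 0)) (shift (0, 1)) i j
      (K j l (rhs l φ)) = (1 : Matrix (Fin 4) (Fin 4) (LatticeSpace →L[ℂ] LatticeSpace)) i l
        (rhs l φ) := by
      intro l
      rw [← hK, Matrix.mul_apply, sum_apply]
      rfl
    rw [Finset.sum_congr rfl fun l _ => h2 l, Finset.sum_eq_single i]
    · simp
    · intro l _ hl
      rw [Matrix.one_apply_ne hl.symm]
      rfl
    · simp
  have heq : ∀ φ p, _ := fun φ p => (bloch_mul_iff S T (waveCos k a) (waveSin k a / k)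
    (k * waveSin k a) (fun j => X j φ p) (fun j => X j φ (p + (1, 0)))
    (fun j => X j φ (p + (0, 1))) (fun i => rhs i φ p)).1 fun i => by
      rw [← matrixSymbol_shift_apply, hX]
  let A : Direction → (StateSpace a →L[ℂ] LatticeSpace) := fun d => match d with
    | .horizontal => X 1
    | .vertical => conj (T 0 1) • X 0 + conj (T 1 1) • X 1
  let B : Direction → (StateSpace a →L[ℂ] LatticeSpace) := fun d => match d with
    | .horizontal => S 1 0 • X 0 + S 1 1 • X 1 - T 1 0 • X 2 - T 1 1 • X 3
    | .vertical => X 3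
  let uc : EdgeSpace a := edgeLp ((continuous_waveCos k).continuousOn (s := Icc 0 a))
  let us : EdgeSpace a := edgeLp ((continuous_waveSin k).continuousOn (s := Icc 0 a))
  let R : StateSpace a →L[ℂ] StateSpace a :=
    lp.mapCLM 2 (fun _ => particularCLM a k) (norm_nonneg (particularCLM a k)) (fun _ => le_rfl) +
      (spread .horizontal uc).comp (A .horizontal) + (spread .vertical uc).comp (A .vertical) +
      (spread .horizontal us).comp ((1 / k : ℂ) • B .horizontal) +
      (spread .vertical us).comp ((1 / k : ℂ) • B .vertical)
  have hR : ∀ φ e, R φ e = particularCLM a k (φ e) + A e.2 φ e.1 • uc +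
      ((1 / k : ℂ) * B e.2 φ e.1) • us := by
    rintro φ ⟨p, d⟩
    change particularCLM a k (φ (p, d)) + spread .horizontal uc (A .horizontal φ) (p, d) +
      spread .vertical uc (A .vertical φ) (p, d) +
      spread .horizontal us ((1 / k : ℂ) • B .horizontal φ) (p, d) +
      spread .vertical us ((1 / k : ℂ) • B .vertical φ) (p, d) = _
    cases d
    · rw [spread_apply, spread_apply, spread_apply_ne (by simp), spread_apply_ne (by simp),
        add_zero, add_zero]
      rfl
    · rw [spread_apply, spread_apply, spread_apply_ne (by simp), spread_apply_ne (by simp),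
        add_zero, add_zero]
      rfl
  refine ⟨R, fun φ => ⟨fun e => particular k (φ e) + A e.2 φ e.1 • waveCos k +
    ((1 / k : ℂ) * B e.2 φ e.1) • waveSin k, fun e => particularDeriv k (φ e) +
    A e.2 φ e.1 • (fun t => -k * waveSin k t) +
    ((1 / k : ℂ) * B e.2 φ e.1) • (fun t => k * waveCos k t), fun e => ?_, fun m n => ?_⟩⟩
  · have h1 := (isSobolevRep_particular hk (φ e)).add ((isSobolevRep_wave a (hasDerivAt_waveCos k)
      (hasDerivAt_waveCos_deriv k) (continuous_waveCos k).continuousOn).smul (A e.2 φ e.1))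
    have h2 := h1.add ((isSobolevRep_wave a (hasDerivAt_waveSin k)
      (hasDerivAt_waveSin_deriv k) (continuous_waveSin k).continuousOn).smul
      ((1 / k : ℂ) * B e.2 φ e.1))
    have h3 : (φ + (k ^ 2 : ℂ) • R φ) e = φ e + (k ^ 2 : ℂ) • R φ e := rfl
    rw [h3, hR]
    convert h2 using 1
    module
  · rw [vertexCoupling_iff]
    -- The coupling at (m, n) involves the far ends of the edges that arrive from the left and from
    -- below, hence the rows at these two neighbours.
    have e1 := heq φ (m - 1, n)
    have e2 := heq φ (m, n - 1)
    have p1 : ((m - 1, n) + (1, 0) : ℤ × ℤ) = (m, n) := by simp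
    have p2 : ((m, n - 1) + (0, 1) : ℤ × ℤ) = (m, n) := by simp
    have r0 : ∀ p, rhs 0 φ p = particular k (φ (p, .horizontal)) a := fun p => 
      endValueCLM_apply k ha.le _
    have r1 : ∀ p, rhs 1 φ p = -particularDeriv k (φ (p, .horizontal)) a := fun p => 
      congrArg Neg.neg (endDerivCLM_apply k ha.le _)
    have r2 : ∀ p, rhs 2 φ p = particular k (φ (p, .vertical)) a := fun p => 
      endValueCLM_apply k ha.le _
    have r3 : ∀ p, rhs 3 φ p = -particularDeriv k (φ (p, .vertical)) a := fun p => 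
      congrArg Neg.neg (endDerivCLM_apply k ha.le _)
    simp only [p1, r0, r1] at e1
    simp only [p2, r2, r3] at e2
    obtain ⟨e1, e1', -, -⟩ := e1
    obtain ⟨-, -, e2, e2'⟩ := e2
    have a1 : ∀ p, A .horizontal φ p = X 1 φ p := fun _ => rfl
    have a2 : ∀ p, A .vertical φ p = conj (T 0 1) * X 0 φ p + conj (T 1 1) * X 1 φ p :=
      fun _ => rfl
    have b1 : ∀ p, B .horizontal φ p = S 1 0 * X 0 φ p + S 1 1 * X 1 φ p - T 1 0 * X 2 φ p -
      T 1 1 * X 3 φ p := fun _ => rfl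
    have b2 : ∀ p, B .vertical φ p = X 3 φ p := fun _ => rfl
    have z1 : ∀ e, particular k (φ e) 0 = 0 := fun e => by simp [particular]
    have z2 : ∀ e, particularDeriv k (φ e) 0 = 0 := fun e => by simp [particularDeriv]
    simp only [Pi.add_apply, Pi.smul_apply, smul_eq_mul, a1, a2, b1, b2, z1, z2, waveCos_zero,
      waveSin_zero, mul_zero, mul_one, zero_add, add_zero]
    -- Only κ k = 1 is kept of κ = 1/k, which makes the four remaining identities polynomial.
    have hkk : 1 / (k : ℂ) * k = 1 := by field_simp
    rw [div_eq_mul_one_div] at e1 e2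
    clear_value X
    generalize 1 / (k : ℂ) = κ at e1 e2 hkk ⊢
    clear heq hX hR r0 r1 r2 r3 a1 a2 b1 b2
    generalize (X 0 φ).1 = x0 at e1 e1' e2 e2' ⊢
    generalize (X 1 φ).1 = x1 at e1 e1' e2 e2' ⊢
    generalize (X 2 φ).1 = x2 at e1 e1' e2 e2' ⊢
    generalize (X 3 φ).1 = x3 at e1 e1' e2 e2' ⊢
    refine ⟨?_, ?_, ?_, ?_⟩
    · linear_combination S 0 0 * e1 - e1' - T 0 0 * e2' + (T 0 1 * x3 (m, n) -
        T 0 0 * waveCos k a * x3 (m, n - 1) - waveCos k a * (S 1 0 * x0 (m - 1, n) +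
        S 1 1 * x1 (m - 1, n) - T 1 0 * x2 (m - 1, n) - T 1 1 * x3 (m - 1, n))) * hkk
    · linear_combination S 1 0 * e1 - T 1 0 * e2' + (T 1 1 * x3 (m, n) -
        T 1 0 * waveCos k a * x3 (m, n - 1) + (S 1 0 * x0 (m, n) +
        S 1 1 * x1 (m, n) - T 1 0 * x2 (m, n) - T 1 1 * x3 (m, n))) * hkk
    · linear_combination conj (T 0 0) * e1 - e2
    · linear_combination conj (T 0 1) * e1

end SquareLattice

end

/-! ### Injectivity of H - k², and the resolvent set -/

noncomputable section

namespace SquareLattice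

open ComplexConjugate

theorem ae_eq_wave {a k : ℝ} (α β : ℂ) :
    ∀ᵐ x ∂(volume.restrict (Ioo (0 : ℝ) a)),
      (α • edgeLp ((continuous_waveCos k).continuousOn (s := Icc 0 a)) +
        β • edgeLp ((continuous_waveSin k).continuousOn (s := Icc 0 a)) : EdgeSpace a) x =
      α * waveCos k x + β * waveSin k x := by
  filter_upwards [Lp.coeFn_add (α • edgeLp ((continuous_waveCos k).continuousOn (s := Icc 0 a)))
      (β • edgeLp ((continuous_waveSin k).continuousOn (s := Icc 0 a))),
    Lp.coeFn_smul α (edgeLp ((continuous_waveCos k).continuousOn (s := Icc 0 a))),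
    Lp.coeFn_smul β (edgeLp ((continuous_waveSin k).continuousOn (s := Icc 0 a))),
    edgeLp_ae_eq ((continuous_waveCos k).continuousOn (s := Icc 0 a)),
    edgeLp_ae_eq ((continuous_waveSin k).continuousOn (s := Icc 0 a))] with x h1 h2 h3 h4 h5
  rw [h1, Pi.add_apply, h2, h3, Pi.smul_apply, Pi.smul_apply, h4, h5, smul_eq_mul, smul_eq_mul]

theorem wave_eq_zero {a k : ℝ} (ha : 0 < a) (hk : 0 < k) {α β : ℂ}
    (h : ∀ x ∈ Icc 0 a, α * waveCos k x + β * waveSin k x = 0) : α = 0 ∧ β = 0 := by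
  have h0 := h 0 (left_mem_Icc.2 ha.le)
  rw [waveCos_zero, waveSin_zero, mul_one, mul_zero, add_zero] at h0
  refine ⟨h0, ?_⟩
  -- A point t of (0, a] with kt ≤ 1 < π, where sin kt cannot vanish.
  have hm : 0 < min a (1 / k) := lt_min ha (by positivity)
  have h1 := h (min a (1 / k)) ⟨hm.le, min_le_left _ _⟩
  rw [h0, zero_mul, zero_add] at h1
  refine (mul_eq_zero.1 h1).resolve_right ?_
  have h2 : k * min a (1 / k) ≤ 1 := by
    calc k * min a (1 / k) ≤ k * (1 / k) := by gcongr; exact min_le_right _ _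
      _ = 1 := by field_simp
  have h3 := Real.sin_pos_of_pos_of_lt_pi (x := k * min a (1 / k)) (by positivity)
    (by linarith [Real.pi_gt_three])
  rw [waveSin]
  exact_mod_cast h3.ne'

/-- The boundary data of a solution of `-ψ'' = k² ψ` are bounded by its norm. -/
theorem exists_norm_boundary_le {a k : ℝ} (ha : 0 < a) (hk : 0 < k) :
    ∃ C : ℝ, ∀ (u : EdgeSpace a) (f g : ℝ → ℂ), IsSobolevRep a u (-((k ^ 2 : ℂ) • u)) f g →
      ‖f 0‖ ≤ C * ‖u‖ ∧ ‖g 0‖ ≤ C * ‖u‖ := by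
  let uc : EdgeSpace a := edgeLp ((continuous_waveCos k).continuousOn (s := Icc 0 a))
  let us : EdgeSpace a := edgeLp ((continuous_waveSin k).continuousOn (s := Icc 0 a))
  let l : ℂ × ℂ →ₗ[ℂ] EdgeSpace a :=
    (LinearMap.toSpanSingleton ℂ _ uc).coprod (LinearMap.toSpanSingleton ℂ _ us)
  have hl : ∀ p, l p = p.1 • uc + p.2 • us := fun p => by
    simp [l, LinearMap.toSpanSingleton_apply]
  have hker : LinearMap.ker l = ⊥ := by
    refine LinearMap.ker_eq_bot'.2 ?_
    rintro ⟨α, β⟩ h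
    rw [hl] at h
    have h1 := wave_eq_zero ha hk (α := α) (β := β) (eqOn_zero_of_ae ha
      (by have := continuous_waveCos k; have := continuous_waveSin k; fun_prop) (by
        filter_upwards [ae_eq_wave (a := a) (k := k) α β,
          Lp.coeFn_zero ℂ 2 (volume.restrict (Ioo (0 : ℝ) a))] with x h2 h3
        rw [← h2]
        have h4 : α • uc + β • us = 0 := h
        rw [h4, h3, Pi.zero_apply]))
    rw [h1.1, h1.2]
    rfl
  -- An injective linear map on the finite-dimensional space of wave coefficients is bounded below.
  obtain ⟨K, -, hK⟩ := l.exists_antilipschitzWith hker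
  have hK' : ∀ p, ‖p‖ ≤ K * ‖l p‖ := fun p => by
    simpa using hK.le_mul_dist p 0
  refine ⟨max K (k * K), fun u f g h => ?_⟩
  have hu : u = l (f 0, g 0 / k) := by
    rw [hl]
    refine Lp.ext ?_
    filter_upwards [h.ae_eq, ae_eq_wave (a := a) (k := k) (f 0) (g 0 / k),
      ae_restrict_mem measurableSet_Ioo] with x h1 h2 hx
    rw [h1, (h.eq_wave hk.ne' (Ioo_subset_Icc_self hx)).1, ← h2]
  have h1 := hK' (f 0, g 0 / k)
  rw [← hu] at h1
  have h2 := (norm_fst_le (f 0, g 0 / (k : ℂ))).trans h1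
  have h3 := (norm_snd_le (f 0, g 0 / (k : ℂ))).trans h1
  constructor
  · exact h2.trans (by gcongr; exact le_max_left _ _)
  · simp only [norm_div, Complex.norm_real, Real.norm_eq_abs, abs_of_pos hk] at h3
    rw [div_le_iff₀ hk] at h3
    refine h3.trans ?_
    rw [mul_right_comm, mul_comm (K : ℝ) k]
    gcongr
    exact le_max_right _ _

theorem eq_zero_of_boundary_eq_zero {a k : ℝ} (hk : k ≠ 0) {u : EdgeSpace a} {f g : ℝ → ℂ}
    (h : IsSobolevRep a u (-((k ^ 2 : ℂ) • u)) f g) (hf : f 0 = 0) (hg : g 0 = 0) : u = 0 := by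
  rw [Lp.eq_zero_iff_ae_eq_zero]
  filter_upwards [h.ae_eq, ae_restrict_mem measurableSet_Ioo] with x h1 hx
  rw [h1, (h.eq_wave hk (Ioo_subset_Icc_self hx)).1, hf, hg]
  simp

/-- If the difference operator has a left inverse then `k²` is not an eigenvalue. -/
theorem eq_zero_of_mem_graph {a : ℝ} (ha : 0 < a) {k : ℝ} (hk : 0 < k)
    (S T : Matrix (Fin 2) (Fin 2) ℂ) {K : Matrix (Fin 4) (Fin 4) (LatticeSpace →L[ℂ] LatticeSpace)}
    (hK : K * matrixSymbol (blochConst S T (waveCos k a) (waveSin k a / k) (k * waveSin k a))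
      (blochHorizontal S T) (blochVertical T) (shift (1, 0)) (shift (0, 1)) = 1)
    {ψ : StateSpace a} (hψ : (ψ, (k ^ 2 : ℂ) • ψ) ∈ hamiltonianGraph a S T) : ψ = 0 := by
  have hk' : (k : ℂ) ≠ 0 := by exact_mod_cast hk.ne'
  obtain ⟨f, g, hfg, hc⟩ := hψ
  replace hfg : ∀ e, IsSobolevRep a (ψ e) (-((k ^ 2 : ℂ) • ψ e)) (f e) (g e) := hfg
  obtain ⟨C, hC⟩ := exists_norm_boundary_le (a := a) ha hk
  -- The boundary data are square summable over the lattice, being dominated edge by edge by the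
  -- norms of ψ. This puts them in the space on which K acts.
  have hmem : ∀ (d : Direction) (F : ℤ × ℤ → ℂ), (∀ p, ‖F p‖ ≤ C * ‖ψ (p, d)‖) → Memℓp F 2 := by
    intro d F hF
    exact Memℓp.mono ((lp.memℓp (lpComp (fun p : ℤ × ℤ => (p, d))
      (Prod.mk_left_injective d) ψ)).norm.const_mul C) hF
  let A : Direction → LatticeSpace := fun d => ⟨fun p => f (p, d) 0, hmem d _ fun p =>
    (hC _ _ _ (hfg (p, d))).1⟩
  let B : Direction → LatticeSpace := fun d => ⟨fun p => g (p, d) 0, hmem d _ fun p =>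
    (hC _ _ _ (hfg (p, d))).2⟩
  -- The far-end data are expressed through near-end data of the preceding edges, so that square
  -- summability is inherited by the shifts.
  let X : Fin 4 → LatticeSpace :=
    ![shift (-1, 0) (waveCos k a • A .horizontal + (waveSin k a / k) • B .horizontal),
      A .horizontal,
      shift (0, -1) ((k * waveSin k a) • A .vertical - waveCos k a • B .vertical),
      B .vertical]
  have hend := fun e => (hfg e).eq_wave hk.ne' (right_mem_Icc.2 ha.le)
  have x0 : ∀ m n, X 0 (m, n) = f ((m - 1, n), .horizontal) a := by
    intro m n
    rw [(hend _).1]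
    change waveCos k a * f ((m + -1, n + 0), .horizontal) 0 +
      (waveSin k a / k) * g ((m + -1, n + 0), .horizontal) 0 = _
    rw [add_zero, ← sub_eq_add_neg]
    ring
  have x1 : ∀ m n, X 1 (m, n) = f ((m, n), .horizontal) 0 := fun _ _ => rfl
  have x2 : ∀ m n, X 2 (m, n) = -g ((m, n - 1), .vertical) a := by
    intro m n
    rw [(hend _).2]
    change (k * waveSin k a) * f ((m + 0, n + -1), .vertical) 0 -
      waveCos k a * g ((m + 0, n + -1), .vertical) 0 = _
    rw [add_zero, ← sub_eq_add_neg]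
    ring
  have x3 : ∀ m n, X 3 (m, n) = g ((m, n), .vertical) 0 := fun _ _ => rfl
  have hc' : ∀ m n, _ := fun m n => (vertexCoupling_iff a S T f g m n).1 (hc m n)
  have hMX : ∀ i, ∑ j, matrixSymbol (blochConst S T (waveCos k a) (waveSin k a / k)
      (k * waveSin k a)) (blochHorizontal S T) (blochVertical T) (shift (1, 0)) (shift (0, 1)) i j
      (X j) = 0 := by
    intro i
    ext p
    rw [matrixSymbol_shift_apply]
    revert i
    refine (bloch_mul_iff S T (waveCos k a) (waveSin k a / k) (k * waveSin k a)
      (fun j => X j p) (fun j => X j (p + (1, 0))) (fun j => X j (p + (0, 1)))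
      (fun _ => 0)).2 ?_
    obtain ⟨m, n⟩ := p
    have p1 : ((m, n) + (1, 0) : ℤ × ℤ) = (m + 1, n) := by simp
    have p2 : ((m, n) + (0, 1) : ℤ × ℤ) = (m, n + 1) := by simp
    obtain ⟨-, c2, -, c4⟩ := hc' m n
    obtain ⟨d1, -, -, -⟩ := hc' (m + 1) n
    obtain ⟨-, -, b3, -⟩ := hc' m (n + 1)
    have w1 := hend ((m, n), .horizontal)
    have w2 := hend ((m, n), .vertical)
    simp only [p1, p2, x0, x1, x2, x3, add_sub_cancel_right] at d1 b3 ⊢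
    refine ⟨?_, ?_, ?_, ?_⟩
    · linear_combination w1.1 + waveSin k a / k * c2
    · linear_combination -d1 - w1.2 - waveCos k a * c2
    · linear_combination w2.1 - b3 + waveCos k a * c4
    · linear_combination -w2.2 + k * waveSin k a * c4
  have hX : ∀ i, X i = 0 := by
    intro i
    have h1 : X i = ∑ j, (K * matrixSymbol (blochConst S T (waveCos k a) (waveSin k a / k)
      (k * waveSin k a)) (blochHorizontal S T) (blochVertical T) (shift (1, 0)) (shift (0, 1))) i j
      (X j) := by
      rw [hK, Finset.sum_eq_single i]
      · simp
      · intro l _ hl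
        rw [Matrix.one_apply_ne hl.symm]
        rfl
      · simp
    rw [h1]
    simp only [Matrix.mul_apply, sum_apply]
    rw [Finset.sum_comm]
    have h2 : ∀ l, ∑ j, (K i l * matrixSymbol (blochConst S T (waveCos k a) (waveSin k a / k)
      (k * waveSin k a)) (blochHorizontal S T) (blochVertical T) (shift (1, 0)) (shift (0, 1)) l j)
      (X j) = 0 := by
      intro l
      have h3 := congrArg (K i l) (hMX l)
      rw [map_sum, map_zero] at h3
      exact h3
    exact Finset.sum_eq_zero fun l _ => h2 l
  have hX' : ∀ i p, X i p = 0 := fun i p => by rw [hX]; rfl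
  ext1
  funext e
  obtain ⟨⟨m, n⟩, d⟩ := e
  obtain ⟨-, c2, -, c4⟩ := hc' m n
  have y0 := (x0 m n).symm.trans (hX' 0 _)
  have y1 := (x1 m n).symm.trans (hX' 1 _)
  have y2 := (x2 m n).symm.trans (hX' 2 _)
  have y3 := (x3 m n).symm.trans (hX' 3 _)
  rw [neg_eq_zero] at y2
  rw [y0, y1, y2, y3] at c2
  rw [y0, y1] at c4
  simp only [mul_zero, add_zero, sub_zero] at c2 c4
  cases d
  · exact eq_zero_of_boundary_eq_zero hk.ne' (hfg _) y1 c2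
  · exact eq_zero_of_boundary_eq_zero hk.ne' (hfg _) c4 y3

theorem bloch_det_wave {a k : ℝ} (hk : k ≠ 0) {S T : Matrix (Fin 2) (Fin 2) ℂ}
    (hS : S.IsHermitian) (θ₁ θ₂ : ℝ) :
    (blochConst S T (waveCos k a) (waveSin k a / k) (k * waveSin k a) +
      phase θ₁ • blochHorizontal S T + phase θ₂ • blochVertical T).det =
      phase θ₁ * phase θ₂ * pencilDet S T (Real.cos (k * a)) (Real.sin (k * a) / k) θ₁ θ₂ := by
  have h := bloch_det (T := T) hS (c := Real.cos (k * a)) (s := Real.sin (k * a) / k)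
    (r := k * Real.sin (k * a)) (by field_simp; exact Real.sin_sq_add_cos_sq _) θ₁ θ₂
  rw [Complex.ofReal_div, Complex.ofReal_mul] at h
  exact h

theorem phase_ne_zero (θ : ℝ) : phase θ ≠ 0 := left_ne_zero_of_mul_eq_one (phase_mul_conj θ)

/-- Energies without Bloch waves belong to the resolvent set. -/
theorem not_mem_opSpectrum {a : ℝ} (ha : 0 < a) {k : ℝ} (hk : 0 < k)
    {S T : Matrix (Fin 2) (Fin 2) ℂ} (hS : S.IsHermitian)
    (h : ∀ θ₁ θ₂, pencilDet S T (Real.cos (k * a)) (Real.sin (k * a) / k) θ₁ θ₂ ≠ 0) :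
    (k ^ 2 : ℂ) ∉ opSpectrum (hamiltonian a S T) := by
  obtain ⟨K, hK1, hK2⟩ := exists_lattice_inverse
    (blochConst S T (waveCos k a) (waveSin k a / k) (k * waveSin k a))
    (blochHorizontal S T) (blochVertical T) (fun θ₁ θ₂ => by
      rw [bloch_det_wave hk.ne' hS]
      exact mul_ne_zero (mul_ne_zero (phase_ne_zero _) (phase_ne_zero _))
        (by exact_mod_cast h θ₁ θ₂))
  obtain ⟨R, hR⟩ := exists_right_inverse ha hk.ne' S T hK2
  refine not_not.2 ⟨R, fun y => ?_, fun x => ?_⟩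
  · obtain ⟨x, h1, h2⟩ := hamiltonian_mem ha (hR y)
    refine ⟨x, h1, ?_⟩
    rw [h1, h2]
    simp
  · have h1 := hamiltonian_apply_mem ha x
    -- R applied to (H - k²)x and x itself solve the same equation; their difference is an
    -- eigenvector for k², hence zero.
    have h2 := Submodule.sub_mem _ (hR (hamiltonian a S T x - (k ^ 2 : ℂ) • (x : StateSpace a))) h1
    rw [← sub_eq_zero]
    refine eq_zero_of_mem_graph ha hk S T hK1 ?_
    convert h2 using 1
    ext1
    · rfl
    · simp only [Prod.snd_sub]
      module

end SquareLattice

end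

/-! ### Bloch waves give approximate eigenfunctions: the dispersion relation -/

noncomputable section

namespace SquareLattice

open ComplexConjugate

/-- Hermite interpolation by a cubic polynomial with vanishing data at `0`. -/
theorem exists_cubic {a : ℝ} (ha : a ≠ 0) (P Q : ℂ) :
    ∃ η η' η'' : ℝ → ℂ, (∀ t, HasDerivAt η (η' t) t) ∧ (∀ t, HasDerivAt η' (η'' t) t) ∧
      Continuous η'' ∧ η 0 = 0 ∧ η' 0 = 0 ∧ η a = P ∧ η' a = Q := by
  have ha' : (a : ℂ) ≠ 0 := by exact_mod_cast ha
  let A : ℂ := 3 * P / a ^ 2 - Q / a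
  let B : ℂ := Q / a ^ 2 - 2 * P / a ^ 3
  have h1 : ∀ t : ℝ, HasDerivAt (fun t : ℝ => (t : ℂ)) 1 t := fun t =>
    (hasDerivAt_id t).ofReal_comp
  refine ⟨fun t => A * t ^ 2 + B * t ^ 3, fun t => A * (2 * t) + B * (3 * t ^ 2),
    fun t => A * 2 + B * (6 * t), fun t => ?_, fun t => ?_, by fun_prop, by simp, by simp, ?_, ?_⟩
  · refine ((((h1 t).pow 2).const_mul A).add (((h1 t).pow 3).const_mul B)).congr_deriv ?_
    norm_num
  · refine ((((h1 t).const_mul 2).const_mul A).add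
      ((((h1 t).pow 2).const_mul 3).const_mul B)).congr_deriv ?_
    norm_num
    ring_nf
    tauto
  · simp only [A, B]
    field_simp
    ring
  · simp only [A, B]
    field_simp
    ring

/-- Restriction to the edges of one direction is a contraction. This bounds the truncated Bloch
waves from below. -/
theorem norm_mul_le_norm_spread {a : ℝ} (F : Direction → EdgeSpace a) (d : Direction)
    (w : LatticeSpace) :
    ‖F d‖ * ‖w‖ ≤
      ‖spread .horizontal (F .horizontal) w + spread .vertical (F .vertical) w‖ := by
  let Φ := spread .horizontal (F .horizontal) w + spread .vertical (F .vertical) w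
  let G : lp (fun _ : ℤ × ℤ => EdgeSpace a) 2 :=
    lpComp (fun p : ℤ × ℤ => (p, d)) (Prod.mk_left_injective d) Φ
  have hG : ∀ p, G p = w p • F d := by
    intro p
    change spread .horizontal (F .horizontal) w (p, d) + spread .vertical (F .vertical) w (p, d) = _
    cases d
    · rw [spread_apply, spread_apply_ne (by simp), add_zero]
    · rw [spread_apply, spread_apply_ne (by simp), zero_add]
  calc ‖F d‖ * ‖w‖ = ‖(‖F d‖ : ℂ) • w‖ := by
        rw [norm_smul, Complex.norm_real, norm_norm]
    _ ≤ ‖G‖ := by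
        refine lp.norm_mono (by norm_num) fun p => ?_
        rw [hG, norm_smul, lp.coeFn_smul, Pi.smul_apply, norm_smul, Complex.norm_real, norm_norm,
          mul_comm]
    _ ≤ 1 * ‖Φ‖ := ContinuousLinearMap.le_of_opNorm_le _ (norm_lpComp_le _ _) _
    _ = ‖Φ‖ := one_mul _

/-- The direction dependent choice of two values. -/
def Direction.pick {α : Type*} (x y : α) : Direction → α
  | .horizontal => x
  | .vertical => y

/-- Energies of Bloch waves belong to the spectrum. -/
theorem mem_opSpectrum {a : ℝ} (ha : 0 < a) {k : ℝ} (hk : 0 < k)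
    {S T : Matrix (Fin 2) (Fin 2) ℂ} (hS : S.IsHermitian) {θ₁ θ₂ : ℝ}
    (h : pencilDet S T (Real.cos (k * a)) (Real.sin (k * a) / k) θ₁ θ₂ = 0) :
    (k ^ 2 : ℂ) ∈ opSpectrum (hamiltonian a S T) := by
  have hk' : (k : ℂ) ≠ 0 := by exact_mod_cast hk.ne'
  have hdet := bloch_det_wave (a := a) (T := T) hk.ne' hS θ₁ θ₂
  rw [h, Complex.ofReal_zero, mul_zero] at hdet
  -- The kernel vector v is the set of vertex data of a Bloch wave with phases θ₁ and θ₂.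
  obtain ⟨v, hv0, hv⟩ := Matrix.exists_mulVec_eq_zero_iff.2 hdet
  have hrows := (bloch_mul_iff S T (waveCos k a) (waveSin k a / k) (k * waveSin k a) v
    (fun j => phase θ₁ * v j) (fun j => phase θ₂ * v j) (fun _ => 0)).1 fun i => by
      have h1 := congrFun hv i
      rw [Matrix.mulVec, dotProduct] at h1
      rw [← Pi.zero_apply (M := fun _ => ℂ) i, ← h1]
      refine Finset.sum_congr rfl fun j _ => ?_
      simp only [Matrix.add_apply, Matrix.smul_apply, smul_eq_mul]
      ring
  obtain ⟨r1, r2, r3, r4⟩ := hrows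
  let α : Direction → ℂ := Direction.pick (v 1) (conj (T 0 1) * v 0 + conj (T 1 1) * v 1)
  let β : Direction → ℂ :=
    Direction.pick (S 1 0 * v 0 + S 1 1 * v 1 - T 1 0 * v 2 - T 1 1 * v 3) (v 3)
  let δ : Direction → LatticeSpace → LatticeSpace :=
    Direction.pick (blochDefect (1, 0) θ₁) (blochDefect (0, 1) θ₂)
  let f : Direction → ℝ → ℂ := fun d t => α d * waveCos k t + β d / k * waveSin k t
  let f' : Direction → ℝ → ℂ := fun d t => β d * waveCos k t - α d * k * waveSin k t
  have cc := continuous_waveCos k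
  have cs := continuous_waveSin k
  have hf : ∀ d t, HasDerivAt (f d) (f' d t) t := fun d t => by
    refine (((hasDerivAt_waveCos k t).const_mul (α d)).add
      ((hasDerivAt_waveSin k t).const_mul (β d / k))).congr_deriv ?_
    simp only [f']
    field_simp
    ring
  have hf' : ∀ d t, HasDerivAt (f' d) (-(k ^ 2 * f d t)) t := fun d t => by
    refine (((hasDerivAt_waveCos k t).const_mul (β d)).sub
      ((hasDerivAt_waveSin k t).const_mul (α d * k))).congr_deriv ?_
    simp only [f]
    field_simp
    ring
  -- The truncated wave violates the coupling where its amplitude w is not a plane wave. The cubic η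
  -- corrects value and derivative at the far end and leaves the near end untouched.
  choose η η' η'' hη hη' hcη hη0 hη'0 hηa hη'a using fun d =>
    exists_cubic ha.ne' (f d a) (f' d a)
  have hcη0 : ∀ d, Continuous (η d) := fun d =>
    continuous_iff_continuousAt.2 fun t => (hη d t).continuousAt
  have hcf : ∀ d, ContinuousOn (f d) (Icc 0 a) := fun d => by simp only [f]; fun_prop
  let F : Direction → EdgeSpace a := fun d => edgeLp (hcf d)
  let H : Direction → EdgeSpace a := fun d => edgeLp ((hcη0 d).continuousOn (s := Icc 0 a))
  let Z : Direction → EdgeSpace a := fun d =>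
    edgeLp ((hcη d).continuousOn (s := Icc 0 a)) + (k ^ 2 : ℂ) • H d
  -- If the wave vanished on both edges, so would v₁, v₃ and, by the first and the fourth row, v₀
  -- and v₂.
  have hF : ∃ d, F d ≠ 0 := by
    by_contra! hF
    have h1 : ∀ d, α d = 0 ∧ β d / k = 0 := fun d => by
      refine wave_eq_zero ha hk (eqOn_zero_of_ae ha (hcf d) ?_)
      filter_upwards [edgeLp_ae_eq (hcf d),
        Lp.coeFn_zero ℂ 2 (volume.restrict (Ioo (0 : ℝ) a))] with x h2 h3
      have h4 : F d x = f d x := h2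
      rw [hF, h3, Pi.zero_apply] at h4
      exact h4.symm
    have a1 : v 1 = 0 := (h1 .horizontal).1
    have a2 : conj (T 0 1) * v 0 + conj (T 1 1) * v 1 = 0 := (h1 .vertical).1
    have b1 : S 1 0 * v 0 + S 1 1 * v 1 - T 1 0 * v 2 - T 1 1 * v 3 = 0 := by
      have := (h1 .horizontal).2
      rwa [div_eq_zero_iff, or_iff_left hk'] at this
    have b2 : v 3 = 0 := by
      have := (h1 .vertical).2
      rwa [div_eq_zero_iff, or_iff_left hk'] at this
    rw [b1, a1, mul_zero, mul_zero, sub_zero, sub_zero, mul_eq_zero] at r1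
    rw [a2, b2, mul_zero, mul_zero, sub_zero, add_zero, mul_eq_zero] at r4
    have a0 := r1.resolve_left (phase_ne_zero _)
    have a3 := r4.resolve_left (phase_ne_zero _)
    apply hv0
    ext i
    fin_cases i <;> assumption
  obtain ⟨d₀, hd₀⟩ := hF
  -- With the correction the far-end data carry the amplitude w(p) + δw(p), that is, the conjugate
  -- phase times w at the next vertex. Hence every vertex sees w times the Bloch data, and Ψ w is in
  -- the domain exactly.
  let Ψ : LatticeSpace → StateSpace a := fun w =>
    (spread .horizontal (F .horizontal) w + spread .vertical (F .vertical) w) +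
    (spread .horizontal (H .horizontal) (δ .horizontal w) +
      spread .vertical (H .vertical) (δ .vertical w))
  let Θ : LatticeSpace → StateSpace a := fun w =>
    spread .horizontal (Z .horizontal) (δ .horizontal w) +
      spread .vertical (Z .vertical) (δ .vertical w)
  have hΨ : ∀ w p d, Ψ w (p, d) = w p • F d + δ d w p • H d := by
    intro w p d
    change (spread .horizontal (F .horizontal) w (p, d) + spread .vertical (F .vertical) w (p, d)) +
      (spread .horizontal (H .horizontal) (δ .horizontal w) (p, d) +
      spread .vertical (H .vertical) (δ .vertical w) (p, d)) = _
    cases d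
    · rw [spread_apply, spread_apply, spread_apply_ne (by simp), spread_apply_ne (by simp),
        add_zero, add_zero]
    · rw [spread_apply, spread_apply, spread_apply_ne (by simp), spread_apply_ne (by simp),
        zero_add, zero_add]
  have hΘ : ∀ w p d, Θ w (p, d) = δ d w p • Z d := by
    intro w p d
    change spread .horizontal (Z .horizontal) (δ .horizontal w) (p, d) +
      spread .vertical (Z .vertical) (δ .vertical w) (p, d) = _
    cases d
    · rw [spread_apply, spread_apply_ne (by simp), add_zero]
    · rw [spread_apply, spread_apply_ne (by simp), zero_add]
  have hgraph : ∀ w, (Ψ w, (k ^ 2 : ℂ) • Ψ w - Θ w) ∈ hamiltonianGraph a S T := by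
    intro w
    refine ⟨fun e => w e.1 • f e.2 + δ e.2 w e.1 • η e.2,
      fun e => w e.1 • f' e.2 + δ e.2 w e.1 • η' e.2, ?_, fun m n => ?_⟩
    · rintro ⟨p, d⟩
      have h1 := ((isSobolevRep_wave a (hf d) (hf' d) (hcf d)).smul (w p)).add
        ((isSobolevRep_of_hasDerivAt (hη d) (hη' d) ((hcη0 d).continuousOn (s := Icc 0 a))
          (hcη d)).smul (δ d w p))
      have h2 : ((k ^ 2 : ℂ) • Ψ w - Θ w) (p, d) = (k ^ 2 : ℂ) • Ψ w (p, d) - Θ w (p, d) := rfl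
      change IsSobolevRep a (Ψ w (p, d)) (-(((k ^ 2 : ℂ) • Ψ w - Θ w) (p, d))) _ _
      rw [h2, hΨ, hΘ]
      convert h1 using 1
      simp only [F, Z, H]
      module
    · rw [vertexCoupling_iff]
      have d1 : δ .horizontal w (m - 1, n) = conj (phase θ₁) * w (m, n) - w (m - 1, n) := by
        change conj (phase θ₁) * w (m - 1 + 1, n + 0) - w (m - 1, n) = _
        rw [sub_add_cancel, add_zero]
      have d2 : δ .vertical w (m, n - 1) = conj (phase θ₂) * w (m, n) - w (m, n - 1) := by
        change conj (phase θ₂) * w (m + 0, n - 1 + 1) - w (m, n - 1) = _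
        rw [sub_add_cancel, add_zero]
      have z1 := phase_mul_conj θ₁
      have z2 := phase_mul_conj θ₂
      have f0 : ∀ d, f d 0 = α d := fun d => by simp [f]
      have f'0 : ∀ d, f' d 0 = β d := fun d => by simp [f']
      have fh : f .horizontal a = phase θ₁ * v 0 := by
        simp only [f, α, β, Direction.pick]
        linear_combination -r1
      have fh' : f' .horizontal a = -phase θ₁ *
          (S 0 0 * v 0 + S 0 1 * v 1 - T 0 0 * v 2 - T 0 1 * v 3) := by
        simp only [f', α, β, Direction.pick]
        linear_combination r2
      have fv : f .vertical a = phase θ₂ * (conj (T 0 0) * v 0 + conj (T 1 0) * v 1) := by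
        simp only [f, α, β, Direction.pick]
        linear_combination -r3
      have fv' : f' .vertical a = -phase θ₂ * v 2 := by
        simp only [f', α, β, Direction.pick]
        linear_combination r4
      simp only [Pi.add_apply, Pi.smul_apply, smul_eq_mul, hη0, hη'0, hηa, hη'a, f0, f'0, fh, fh',
        fv, fv', d1, d2, α, β, Direction.pick, mul_zero, add_zero]
      generalize w (m, n) = W
      refine ⟨?_, ?_, ?_, ?_⟩
      · linear_combination (W * (S 0 0 * v 0 + S 0 1 * v 1 - T 0 0 * v 2 - T 0 1 * v 3) -
          S 0 0 * W * v 0) * z1 + T 0 0 * W * v 2 * z2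
      · linear_combination -S 1 0 * W * v 0 * z1 + T 1 0 * W * v 2 * z2
      · linear_combination W * (conj (T 0 0) * v 0 + conj (T 1 0) * v 1) * z2 -
          conj (T 0 0) * W * v 0 * z1
      · linear_combination -conj (T 0 1) * W * v 0 * z1
  -- Since (H - k²)Ψ w = -Θ w, a bounded left inverse would bound w by its Bloch defects, against
  -- `exists_approx_bloch`.
  rintro ⟨R, -, hR⟩
  obtain ⟨C, hC0, hC⟩ : ∃ C : ℝ, 0 ≤ C ∧ ∀ w, ‖F d₀‖ * ‖w‖ ≤
      C * (‖δ .horizontal w‖ + ‖δ .vertical w‖) := by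
    let c₁ := ‖spread .horizontal (H .horizontal)‖ + ‖spread .vertical (H .vertical)‖
    let c₂ := ‖spread .horizontal (Z .horizontal)‖ + ‖spread .vertical (Z .vertical)‖
    refine ⟨‖R‖ * c₂ + c₁, by positivity, fun w => ?_⟩
    have bound : ∀ G : Direction → EdgeSpace a, ‖spread .horizontal (G .horizontal)
        (δ .horizontal w) + spread .vertical (G .vertical) (δ .vertical w)‖ ≤
        (‖spread .horizontal (G .horizontal)‖ + ‖spread .vertical (G .vertical)‖) *
        (‖δ .horizontal w‖ + ‖δ .vertical w‖) := fun G => by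
      refine (norm_add_le _ _).trans ?_
      have h1 := (spread .horizontal (G .horizontal)).le_opNorm (δ .horizontal w)
      have h2 := (spread .vertical (G .vertical)).le_opNorm (δ .vertical w)
      nlinarith [mul_nonneg (norm_nonneg (spread .horizontal (G .horizontal)))
        (norm_nonneg (δ .vertical w)), mul_nonneg (norm_nonneg (spread .vertical (G .vertical)))
        (norm_nonneg (δ .horizontal w))]
    obtain ⟨x, hx1, hx2⟩ := hamiltonian_mem ha (hgraph w)
    have h1 := hR x
    rw [hx1, hx2] at h1
    simp only [sub_sub_cancel_left] at h1
    have h2 : ‖Ψ w‖ ≤ ‖R‖ * ‖Θ w‖ := by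
      rw [← h1]
      refine (R.le_opNorm _).trans (le_of_eq ?_)
      rw [norm_neg]
    have h3 := norm_mul_le_norm_spread F d₀ w
    have h4 := bound H
    have h5 := mul_le_mul_of_nonneg_left (bound Z) (norm_nonneg R)
    have h6 : ‖spread .horizontal (F .horizontal) w + spread .vertical (F .vertical) w‖ ≤
        ‖Ψ w‖ + ‖spread .horizontal (H .horizontal) (δ .horizontal w) +
          spread .vertical (H .vertical) (δ .vertical w)‖ := by
      refine le_trans (le_of_eq ?_) (norm_sub_le _ _)
      simp only [Ψ, add_sub_cancel_right]
    calc _ ≤ _ := h3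
      _ ≤ _ := h6
      _ ≤ ‖R‖ * (c₂ * (‖δ .horizontal w‖ + ‖δ .vertical w‖)) +
          c₁ * (‖δ .horizontal w‖ + ‖δ .vertical w‖) := add_le_add (h2.trans h5) h4
      _ = _ := by ring
  have hF0 : 0 < ‖F d₀‖ := norm_pos_iff.2 hd₀
  obtain ⟨w, hw⟩ := exists_approx_bloch θ₁ θ₂ (C / ‖F d₀‖)
  have h1 := hC w
  have h2 : C / ‖F d₀‖ * (‖δ .horizontal w‖ + ‖δ .vertical w‖) < ‖w‖ := hw
  rw [div_mul_eq_mul_div, div_lt_iff₀ hF0] at h2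
  linarith

/-- The dispersion relation. -/
theorem mem_opSpectrum_iff {a : ℝ} (ha : 0 < a) {k : ℝ} (hk : 0 < k)
    {S T : Matrix (Fin 2) (Fin 2) ℂ} (hS : S.IsHermitian) :
    ((k ^ 2 : ℝ) : ℂ) ∈ opSpectrum (hamiltonian a S T) ↔
      ∃ θ₁ θ₂, pencilDet S T (Real.cos (k * a)) (Real.sin (k * a) / k) θ₁ θ₂ = 0 := by
  rw [Complex.ofReal_pow]
  constructor
  · intro h
    by_contra! h'
    exact not_mem_opSpectrum ha hk hS h' h
  · rintro ⟨θ₁, θ₂, h⟩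
    exact mem_opSpectrum ha hk hS h

end SquareLattice

end

/-! ### The determinant as a function of u, s and the phases -/

noncomputable section

namespace SquareLattice

open ComplexConjugate

theorem phase_add_pi (θ : ℝ) : phase (θ + Real.pi) = -phase θ := by
  rw [phase_eq, phase_eq, Real.cos_add_pi, Real.sin_add_pi]
  rfl

/-- At `s = 0` the determinant is a quadratic polynomial in `u`. -/
theorem pencilDet_zero (S T : Matrix (Fin 2) (Fin 2) ℂ) (u θ₁ θ₂ : ℝ) :
    pencilDet S T u 0 θ₁ θ₂ = (Kc T + Ks T) / 4 * u ^ 2 + -Lc T θ₁ θ₂ / 4 * u +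
      -(L T θ₁ θ₂ + Ks T) / 4 := by
  obtain ⟨a, a', ha⟩ : ∃ a a' : ℝ, T 0 0 = ⟨a, a'⟩ := ⟨_, _, rfl⟩
  obtain ⟨b, b', hb⟩ : ∃ a a' : ℝ, T 0 1 = ⟨a, a'⟩ := ⟨_, _, rfl⟩
  obtain ⟨c, c', hc⟩ : ∃ a a' : ℝ, T 1 0 = ⟨a, a'⟩ := ⟨_, _, rfl⟩
  obtain ⟨d, d', hd⟩ : ∃ a a' : ℝ, T 1 1 = ⟨a, a'⟩ := ⟨_, _, rfl⟩
  have h1 := Real.sin_sq_add_cos_sq θ₁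
  have h2 := Real.sin_sq_add_cos_sq θ₂
  simp only [Kc, Ks, Lc, L, pencilDet, pencilDiag, pencilOff, ha, hb, hc, hd, phase_eq,
    Complex.sq_norm, Complex.normSq_apply, Real.cos_sub, Real.sin_sub, Real.cos_add, Real.sin_add]
  generalize Real.cos θ₁ = c₁ at h1 ⊢
  generalize Real.sin θ₁ = s₁ at h1 ⊢
  generalize Real.cos θ₂ = c₂ at h2 ⊢
  generalize Real.sin θ₂ = s₂ at h2 ⊢
  simp
  linear_combination
    - h1 - ((a*d-a'*d'-b*c+b'*c')^2 + (a*d'+a'*d-b*c'-b'*c)^2) * h2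

theorem pencilDet_neg (S T : Matrix (Fin 2) (Fin 2) ℂ) (u s θ₁ θ₂ : ℝ) :
    pencilDet S T (-u) (-s) (θ₁ + Real.pi) (θ₂ + Real.pi) = pencilDet S T u s θ₁ θ₂ := by
  have h0 : ∀ i, pencilDiag S T (-u) (-s) (θ₂ + Real.pi) i = -pencilDiag S T u s θ₂ i := fun i => by
    simp only [pencilDiag, phase_add_pi, map_neg, mul_neg, Complex.neg_re]
    ring
  have h1 : pencilOff S T (-u) (-s) (θ₁ + Real.pi) (θ₂ + Real.pi) = -pencilOff S T u s θ₁ θ₂ := by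
    simp only [pencilOff, phase_add_pi, map_neg, Complex.ofReal_neg]
    ring
  rw [pencilDet, h0, h0, h1, norm_neg, pencilDet]
  ring

theorem continuous_pencilDet (S T : Matrix (Fin 2) (Fin 2) ℂ) :
    Continuous fun x : ℝ × ℝ × ℝ × ℝ => pencilDet S T x.1 x.2.1 x.2.2.1 x.2.2.2 := by
  have := continuous_phase
  have : Continuous fun z : ℂ => conj z := Complex.continuous_conj
  unfold pencilDet pencilDiag pencilOff
  fun_prop

theorem exists_mem_Ioc_phase (θ : ℝ) : ∃ t ∈ Ioc (-Real.pi) Real.pi, phase t = phase θ := by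
  refine ⟨toIocMod Real.two_pi_pos (-Real.pi) θ, ?_, ?_⟩
  · have h := toIocMod_mem_Ioc Real.two_pi_pos (-Real.pi) θ
    exact ⟨h.1, h.2.trans (by linarith)⟩
  · have h : Function.Periodic phase (2 * Real.pi) := phase_add_two_pi
    have h2 := toIocMod_add_toIocDiv_zsmul Real.two_pi_pos (-Real.pi) θ
    conv_rhs => rw [← h2]
    exact (h.zsmul _ _).symm

theorem pencilDet_congr {S T : Matrix (Fin 2) (Fin 2) ℂ} {θ₁ θ₂ t₁ t₂ : ℝ}
    (h₁ : phase t₁ = phase θ₁) (h₂ : phase t₂ = phase θ₂) (u s : ℝ) :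
    pencilDet S T u s t₁ t₂ = pencilDet S T u s θ₁ θ₂ := by
  simp only [pencilDet, pencilDiag, pencilOff, h₁, h₂]

/-- The square that represents all pairs of phases. -/
def torusSquare : Set (ℝ × ℝ) := Icc (-Real.pi) Real.pi ×ˢ Icc (-Real.pi) Real.pi

theorem isCompact_torusSquare : IsCompact torusSquare := isCompact_Icc.prod isCompact_Icc

theorem exists_mem_Ioc_pencilDet (S T : Matrix (Fin 2) (Fin 2) ℂ) (p : ℝ × ℝ) :
    ∃ q : ℝ × ℝ, q.1 ∈ Ioc (-Real.pi) Real.pi ∧ q.2 ∈ Ioc (-Real.pi) Real.pi ∧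
      ∀ u s, pencilDet S T u s q.1 q.2 = pencilDet S T u s p.1 p.2 := by
  obtain ⟨t₁, h₁, e₁⟩ := exists_mem_Ioc_phase p.1
  obtain ⟨t₂, h₂, e₂⟩ := exists_mem_Ioc_phase p.2
  exact ⟨(t₁, t₂), h₁, h₂, pencilDet_congr e₁ e₂⟩

theorem exists_mem_torusSquare (S T : Matrix (Fin 2) (Fin 2) ℂ) (p : ℝ × ℝ) :
    ∃ q ∈ torusSquare, ∀ u s, pencilDet S T u s q.1 q.2 = pencilDet S T u s p.1 p.2 := by
  obtain ⟨q, h₁, h₂, h⟩ := exists_mem_Ioc_pencilDet S T p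
  exact ⟨q, ⟨Ioc_subset_Icc_self h₁, Ioc_subset_Icc_self h₂⟩, h⟩

/-- The dependence of the determinant on `S` is a perturbation of first order in `s`. -/
theorem exists_abs_pencilDet_sub_le (S T : Matrix (Fin 2) (Fin 2) ℂ) :
    ∃ C : ℝ, 0 ≤ C ∧ ∀ u s θ₁ θ₂, |u| ≤ 1 → |s| ≤ 1 →
      |pencilDet S T u s θ₁ θ₂ - pencilDet S T u 0 θ₁ θ₂| ≤ C * |s| := by
  -- The difference quotient of the determinant in s, a polynomial in s with continuous
  -- coefficients, hence bounded on the compact set below.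
  let g : ℝ × ℝ × ℝ × ℝ → ℝ := fun x =>
    (S 0 0).re * pencilDiag S T x.1 0 x.2.2.2 1 + (S 1 1).re * pencilDiag S T x.1 0 x.2.2.2 0 +
      x.2.1 * ((S 0 0).re * (S 1 1).re - ‖S 0 1‖ ^ 2) -
      2 * (pencilOff S T x.1 0 x.2.2.1 x.2.2.2 * conj (S 0 1)).re
  have hg : Continuous g := by
    have := continuous_phase
    have : Continuous fun z : ℂ => conj z := Complex.continuous_conj
    unfold g pencilDiag pencilOff
    fun_prop
  have hK : IsCompact (Icc (-1 : ℝ) 1 ×ˢ Icc (-1 : ℝ) 1 ×ˢ torusSquare) :=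
    isCompact_Icc.prod (isCompact_Icc.prod isCompact_torusSquare)
  obtain ⟨C, hC⟩ := hK.exists_bound_of_continuousOn hg.continuousOn
  refine ⟨|C|, abs_nonneg _, fun u s θ₁ θ₂ hu hs => ?_⟩
  obtain ⟨⟨t₁, t₂⟩, hq, e⟩ := exists_mem_torusSquare S T (θ₁, θ₂)
  rw [← e, ← e]
  have h := hC (u, s, t₁, t₂) ⟨abs_le.1 hu, abs_le.1 hs, hq⟩
  have e : pencilDet S T u s t₁ t₂ - pencilDet S T u 0 t₁ t₂ = g (u, s, t₁, t₂) * s := by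
    have d : ∀ i, pencilDiag S T u s t₂ i = pencilDiag S T u 0 t₂ i + s * (S i i).re := fun i => by
      simp only [pencilDiag]
      ring
    have o : pencilOff S T u s t₁ t₂ = pencilOff S T u 0 t₁ t₂ + s * S 0 1 := by
      simp only [pencilOff, Complex.ofReal_zero]
      ring
    simp only [pencilDet, d, o, g, Complex.sq_norm, Complex.normSq_add, map_mul,
      Complex.conj_ofReal, Complex.normSq_ofReal, mul_left_comm _ (s : ℂ), Complex.re_ofReal_mul]
    ring
  rw [e, abs_mul]
  exact mul_le_mul_of_nonneg_right (h.trans (le_abs_self C)) (abs_nonneg s)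

/-- If this entry vanished at some θ₂, nonnegativity would force the off-diagonal entry to vanish
for every θ₁, but it contains the phase of θ₁. Being continuous without zeros, with a positive sum
over θ₂ and θ₂ + π, the entry is positive. -/
theorem pencilDiag_zero_pos {S T : Matrix (Fin 2) (Fin 2) ℂ} {u : ℝ} (hu : 0 < u)
    (h : ∀ θ₁ θ₂, 0 ≤ pencilDet S T u 0 θ₁ θ₂) (θ₂ : ℝ) : 0 < pencilDiag S T u 0 θ₂ 0 := by
  have hne : ∀ θ₂, pencilDiag S T u 0 θ₂ 0 ≠ 0 := by
    intro θ₂ h0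
    have h1 : ∀ θ₁, pencilOff S T u 0 θ₁ θ₂ = 0 := fun θ₁ => by
      have := h θ₁ θ₂
      rw [pencilDet, h0, zero_mul, zero_sub, neg_nonneg] at this
      exact norm_eq_zero.1 (pow_eq_zero_iff two_ne_zero |>.1 (le_antisymm this (sq_nonneg _)))
    have h2 := h1 0
    have h3 := h1 (0 + Real.pi)
    simp only [pencilOff, phase_add_pi, map_neg] at h2 h3
    have h4 : conj (phase 0) = 0 := by linear_combination (h3 - h2) / 2
    have h5 := phase_mul_conj 0
    rw [h4, mul_zero] at h5
    exact zero_ne_one h5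
  have hc : Continuous fun θ => pencilDiag S T u 0 θ 0 := by
    have := continuous_phase
    have : Continuous fun z : ℂ => conj z := Complex.continuous_conj
    unfold pencilDiag
    fun_prop
  by_contra! hθ
  have hsum : pencilDiag S T u 0 θ₂ 0 + pencilDiag S T u 0 (θ₂ + Real.pi) 0 =
      2 * u * (1 + ‖T 0 0‖ ^ 2 + ‖T 0 1‖ ^ 2) := by
    simp only [pencilDiag, phase_add_pi, map_neg, mul_neg, Complex.neg_re]
    ring
  have hpos : 0 < 2 * u * (1 + ‖T 0 0‖ ^ 2 + ‖T 0 1‖ ^ 2) := by positivity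
  obtain ⟨t, ht⟩ := mem_range_of_exists_le_of_exists_ge hc ⟨θ₂, hθ⟩
    ⟨θ₂ + Real.pi, by linarith⟩
  exact hne t ht

/-- A nonzero positive semidefinite and a positive definite matrix have a positive mixed
discriminant. -/
theorem mixed_discriminant_pos {n₁ n₂ p₁ p₂ : ℝ} {n p : ℂ} (hn₁ : 0 < n₁)
    (hn : ‖n‖ ^ 2 < n₁ * n₂) (hp₁ : 0 < p₁) (hp : ‖p‖ ^ 2 ≤ p₁ * p₂) :
    0 < n₁ * p₂ + n₂ * p₁ - 2 * (n * conj p).re := by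
  have h1 : (n * conj p).re ≤ ‖n‖ * ‖p‖ := by
    refine (Complex.re_le_norm _).trans (le_of_eq ?_)
    rw [norm_mul, Complex.norm_conj]
  -- The left side exceeds (n₁‖p‖ - ‖n‖p₁)².
  have h2 : 0 < n₁ * p₁ * (n₁ * p₂ + n₂ * p₁ - 2 * (‖n‖ * ‖p‖)) := by
    have h3 := mul_lt_mul_of_pos_right hn (pow_pos hp₁ 2)
    have h4 := mul_le_mul_of_nonneg_left hp (pow_pos hn₁ 2).le
    nlinarith [sq_nonneg (n₁ * ‖p‖ - ‖n‖ * p₁)]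
  have h5 := (mul_pos_iff_of_pos_left (mul_pos hn₁ hp₁)).1 h2
  linarith

/-- The matrix P at u is positive semidefinite with positive upper left entry, and it changes with u
at the rate N = 1 + TT*, which is positive definite. The derivative of the determinant is the mixed
discriminant of N and P. -/
theorem derivative_pos_of_pencilDet_nonneg {S T : Matrix (Fin 2) (Fin 2) ℂ} {u : ℝ} (hu : 0 < u)
    (h : ∀ θ₁ θ₂, 0 ≤ pencilDet S T u 0 θ₁ θ₂) (θ₁ θ₂ : ℝ) :
    0 < 2 * ((Kc T + Ks T) / 4) * u + -Lc T θ₁ θ₂ / 4 := by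
  have h1 := pencilDiag_zero_pos hu h θ₂
  have h2 := h θ₁ θ₂
  rw [pencilDet, sub_nonneg] at h2
  have hA : (1 + ‖T 0 0‖ ^ 2 + ‖T 0 1‖ ^ 2) * (1 + ‖T 1 0‖ ^ 2 + ‖T 1 1‖ ^ 2) -
      ‖T 0 0 * conj (T 1 0) + T 0 1 * conj (T 1 1)‖ ^ 2 = (Kc T + Ks T) / 4 := by
    simp only [Kc, Ks, Complex.sq_norm, Complex.normSq_apply]
    simp
    ring
  have hA' : 0 < (Kc T + Ks T) / 4 := by
    unfold Kc Ks
    positivity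
  have h3 := mixed_discriminant_pos (n := T 0 0 * conj (T 1 0) + T 0 1 * conj (T 1 1))
    (n₁ := 1 + ‖T 0 0‖ ^ 2 + ‖T 0 1‖ ^ 2) (n₂ := 1 + ‖T 1 0‖ ^ 2 + ‖T 1 1‖ ^ 2)
    (by positivity) (by linarith) h1 h2
  -- The step from u to u + 1 replaces P by P + N. Expanding det(P + N) and comparing with the
  -- quadratic polynomial, whose increment is A + (2Au + B) with A = det N, identifies 2Au + B.
  have d : ∀ i, pencilDiag S T (u + 1) 0 θ₂ i =
      pencilDiag S T u 0 θ₂ i + (1 + ‖T i 0‖ ^ 2 + ‖T i 1‖ ^ 2) := fun i => by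
    simp only [pencilDiag]
    ring
  have o : pencilOff S T (u + 1) 0 θ₁ θ₂ = (T 0 0 * conj (T 1 0) + T 0 1 * conj (T 1 1)) +
      pencilOff S T u 0 θ₁ θ₂ := by
    simp only [pencilOff, Complex.ofReal_add, Complex.ofReal_one]
    ring
  have e : pencilDet S T (u + 1) 0 θ₁ θ₂ = pencilDet S T u 0 θ₁ θ₂ + (Kc T + Ks T) / 4 +
      ((1 + ‖T 0 0‖ ^ 2 + ‖T 0 1‖ ^ 2) * pencilDiag S T u 0 θ₂ 1 +
        (1 + ‖T 1 0‖ ^ 2 + ‖T 1 1‖ ^ 2) * pencilDiag S T u 0 θ₂ 0 -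
        2 * ((T 0 0 * conj (T 1 0) + T 0 1 * conj (T 1 1)) *
          conj (pencilOff S T u 0 θ₁ θ₂)).re) := by
    rw [← hA]
    simp only [pencilDet, d, o, Complex.sq_norm, Complex.normSq_add]
    ring
  rw [pencilDet_zero, pencilDet_zero] at e
  linarith

theorem exists_L_nonneg (T : Matrix (Fin 2) (Fin 2) ℂ) : ∃ θ₁ θ₂, 0 ≤ L T θ₁ θ₂ := by
  have h : L T (0 + Real.pi) 0 = -L T 0 0 := by
    unfold L
    rw [add_sub_right_comm, add_right_comm, phase_add_pi, phase_add_pi]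
    simp only [mul_neg, Complex.neg_re]
    ring
  rcases le_total 0 (L T 0 0) with h0 | h0
  · exact ⟨_, _, h0⟩
  · exact ⟨0 + Real.pi, 0, by linarith⟩

/-- Lc + L sums to zero over the four points with phases in {0, π}. -/
theorem exists_Lc_add_L_nonpos (T : Matrix (Fin 2) (Fin 2) ℂ) :
    ∃ θ₁ θ₂, Lc T θ₁ θ₂ + L T θ₁ θ₂ ≤ 0 := by
  by_contra! h
  have h1 := h 0 0
  have h2 := h (0 + Real.pi) 0
  have h3 := h 0 (0 + Real.pi)
  have h4 := h (0 + Real.pi) (0 + Real.pi)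
  have e1 : ∀ x, L T (0 + Real.pi) x = -L T 0 x := fun x => by
    unfold L
    rw [add_sub_right_comm, add_right_comm, phase_add_pi, phase_add_pi]
    simp only [mul_neg, Complex.neg_re]
    ring
  rw [e1] at h2 h4
  simp only [Lc, phase_add_pi, mul_neg, Complex.neg_re] at h1 h2 h3 h4
  linarith

end SquareLattice

end

/-! ### Extreme zeros of families of convex quadratic polynomials -/

noncomputable section

namespace SquareLattice

/-! Families of quadratic polynomials `A u² + B x u + C x` in `u`. -/

section Quadratic

variable {X : Type*} {A : ℝ} {B C : X → ℝ}

/-- Were all values nonnegative at some u in (0, 1], the tangents there would propagate this to u =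
1, against `h1`; τ reduces u < 0 to u > 0. For positive values, the mean over x and τ x is A u² + C
x. -/
theorem exists_quadratic_neg_and_pos (hA : 0 < A) {τ : X → X} (hτB : ∀ x, B (τ x) = -B x)
    (hτC : ∀ x, C (τ x) = C x)
    (hd : ∀ u, 0 < u → (∀ x, 0 ≤ A * u ^ 2 + B x * u + C x) → ∀ x, 0 < 2 * A * u + B x)
    (h0 : ∃ x, C x < 0) (h0' : ∃ x, 0 < C x) (h1 : ∃ x, A * 1 ^ 2 + B x * 1 + C x < 0)
    {u : ℝ} (hu : |u| ≤ 1) :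
    (∃ x, A * u ^ 2 + B x * u + C x < 0) ∧ ∃ x, 0 < A * u ^ 2 + B x * u + C x := by
  constructor
  · have key : ∀ u, 0 ≤ u → u ≤ 1 → ∃ x, A * u ^ 2 + B x * u + C x < 0 := by
      intro u hu0 hu1
      rcases hu0.eq_or_lt with rfl | hu0
      · obtain ⟨x, hx⟩ := h0
        exact ⟨x, by linarith⟩
      by_contra! h
      obtain ⟨x, hx⟩ := h1
      have e : A * 1 ^ 2 + B x * 1 + C x = (A * u ^ 2 + B x * u + C x) +
        (1 - u) * (2 * A * u + B x) + A * (1 - u) ^ 2 := by ring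
      have h2 := mul_nonneg (sub_nonneg.2 hu1) (hd u hu0 h x).le
      have h3 := mul_nonneg hA.le (sq_nonneg (1 - u))
      have h4 := h x
      linarith
    rcases le_total 0 u with h | h
    · rw [abs_of_nonneg h] at hu
      exact key u h hu
    · rw [abs_of_nonpos h] at hu
      obtain ⟨x, hx⟩ := key (-u) (neg_nonneg.2 h) hu
      refine ⟨τ x, ?_⟩
      rw [hτB, hτC]
      linarith
  · by_contra! h
    obtain ⟨x, hx⟩ := h0'
    have h2 := h x
    have h3 := h (τ x)
    rw [hτB, hτC] at h3
    have h4 := mul_nonneg hA.le (sq_nonneg u)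
    linarith

variable [TopologicalSpace X] {K : Set X}

/-- The largest zero of a family of quadratic polynomials. -/
theorem exists_last_zero (hB : Continuous B) (hC : Continuous C) (hA : 0 < A) (hK : IsCompact K)
    (hKX : ∀ x, ∃ y ∈ K, B y = B x ∧ C y = C x) (h0 : ∃ x, C x < 0)
    (h1 : ∀ x, 0 < A * 1 ^ 2 + B x * 1 + C x)
    (hd : ∀ u, 0 < u → (∀ x, 0 ≤ A * u ^ 2 + B x * u + C x) → ∀ x, 0 < 2 * A * u + B x) :
    ∃ M ∈ Ioo (0 : ℝ) 1, ∃ c > 0, ∃ δ > 0, ∃ x₀, A * M ^ 2 + B x₀ * M + C x₀ = 0 ∧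
      (∀ u ≥ M, ∀ x, c * (u - M) ≤ A * u ^ 2 + B x * u + C x) ∧
      (∀ u ∈ Icc (M - δ) M, A * u ^ 2 + B x₀ * u + C x₀ ≤ -(c * (M - u))) ∧
      ∀ u ∈ Ioo (0 : ℝ) 1, (∀ x, 0 ≤ A * u ^ 2 + B x * u + C x) →
        (∃ x, A * u ^ 2 + B x * u + C x = 0) → u = M := by
  -- M is the largest u in [0, 1] at which some member is nonpositive; all members are nonnegative
  -- from M on, so `hd` applies at M.
  have hcomp : IsCompact ((Icc (0 : ℝ) 1 ×ˢ K) ∩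
      {z : ℝ × X | A * z.1 ^ 2 + B z.2 * z.1 + C z.2 ≤ 0}) :=
    (isCompact_Icc.prod hK).inter_right (isClosed_le (by fun_prop) continuous_const)
  obtain ⟨M, ⟨⟨M', x₀⟩, ⟨⟨hM, hx₀⟩, hz⟩, rfl⟩, hmax⟩ :=
    (hcomp.image continuous_fst).exists_isGreatest <| by
      obtain ⟨x, hx⟩ := h0
      obtain ⟨y, hy, -, hxy⟩ := hKX x
      refine ⟨0, (0, y), ⟨⟨left_mem_Icc.2 zero_le_one, hy⟩, ?_⟩, rfl⟩
      simp only [mem_ofPred_eq]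
      linarith
  simp only [mem_ofPred_eq] at hM hz hmax
  have hgt : ∀ u ∈ Ioc M' 1, ∀ x, 0 ≤ A * u ^ 2 + B x * u + C x := by
    intro u hu x
    by_contra! hneg
    obtain ⟨y, hy, e1, e2⟩ := hKX x
    have := hmax ⟨(u, y), ⟨⟨⟨hM.1.trans hu.1.le, hu.2⟩, hy⟩, by
      simp only [mem_ofPred_eq, e1, e2]; exact hneg.le⟩, rfl⟩
    exact not_lt.2 this hu.1
  have hM1 : M' < 1 := hM.2.lt_of_ne fun h => by
    have := h1 x₀
    rw [h] at hz
    linarith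
  have hge : ∀ x, 0 ≤ A * M' ^ 2 + B x * M' + C x := by
    intro x
    have hlim : Tendsto (fun u => A * u ^ 2 + B x * u + C x) (nhdsWithin M' (Ioi M'))
        (nhds (A * M' ^ 2 + B x * M' + C x)) :=
      Continuous.tendsto' (by fun_prop) _ _ rfl |>.mono_left nhdsWithin_le_nhds
    refine ge_of_tendsto hlim ?_
    filter_upwards [Ioc_mem_nhdsGT hM1] with u hu
    exact hgt u hu x
  have hM0 : 0 < M' := hM.1.lt_of_ne fun h => by
    obtain ⟨x, hx⟩ := h0
    have := hge x
    rw [← h] at this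
    linarith
  have hd' := hd M' hM0 hge
  -- The slopes at M have a positive minimum c. The result uses c/2: for M - u ≤ c/(2A) the
  -- quadratic term consumes at most half of the linear one.
  obtain ⟨x₁, -, hx₁⟩ := hK.exists_isMinOn ⟨x₀, hx₀⟩
    (f := fun x => 2 * A * M' + B x) (by fun_prop)
  have hx₁' : ∀ x, 2 * A * M' + B x₁ ≤ 2 * A * M' + B x := fun x => by
    obtain ⟨y, hy, e1, e2⟩ := hKX x
    rw [← e1]
    exact hx₁ hy
  have hz' : A * M' ^ 2 + B x₀ * M' + C x₀ = 0 := le_antisymm hz (hge x₀)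
  set c := 2 * A * M' + B x₁
  have hc : 0 < c := hd' x₁
  refine ⟨M', ⟨hM0, hM1⟩, c / 2, by positivity, c / (2 * A), by positivity, x₀, hz', ?_, ?_, ?_⟩
  · intro u hu x
    have e : A * u ^ 2 + B x * u + C x = (A * M' ^ 2 + B x * M' + C x) +
        (u - M') * (2 * A * M' + B x) + A * (u - M') ^ 2 := by ring
    have h2 := mul_le_mul_of_nonneg_left (hx₁' x) (sub_nonneg.2 hu)
    have h3 := mul_nonneg hc.le (sub_nonneg.2 hu)
    have h4 := mul_nonneg hA.le (sq_nonneg (u - M'))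
    have h5 := hge x
    rw [e]
    linarith
  · rintro u ⟨hu1, hu2⟩
    have e : A * u ^ 2 + B x₀ * u + C x₀ = (A * M' ^ 2 + B x₀ * M' + C x₀) -
        (M' - u) * (2 * A * M' + B x₀) + (M' - u) * (A * (M' - u)) := by ring
    have h2 := mul_le_mul_of_nonneg_left (hx₁' x₀) (sub_nonneg.2 hu2)
    have h3 : A * (M' - u) ≤ c / 2 := by
      have : M' - u ≤ c / (2 * A) := by linarith
      rw [le_div_iff₀ (by positivity)] at this
      linarith
    have h4 := mul_le_mul_of_nonneg_left h3 (sub_nonneg.2 hu2)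
    rw [e, hz']
    linarith
  · rintro u ⟨hu0, hu1⟩ hu ⟨x, hx⟩
    have key : ∀ v w, v < w → (∀ x, 0 ≤ A * v ^ 2 + B x * v + C x) → 0 < v →
        ∀ x, 0 < A * w ^ 2 + B x * w + C x := by
      intro v w hvw hv hv0 x
      have e : A * w ^ 2 + B x * w + C x = (A * v ^ 2 + B x * v + C x) +
        (w - v) * (2 * A * v + B x) + A * (w - v) ^ 2 := by ring
      have h2 := mul_pos (sub_pos.2 hvw) (hd v hv0 hv x)
      have h4 := mul_nonneg hA.le (sq_nonneg (w - v))
      have h5 := hv x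
      rw [e]
      linarith
    rcases lt_trichotomy u M' with h | h | h
    · exact absurd hz' (key u M' h hu hu0 x₀).ne'
    · exact h
    · exact absurd hx (key M' u h hge hM0 x).ne'

/-- The smallest positive zero of a family of quadratic polynomials that are negative at `0`. -/
theorem exists_first_zero (hB : Continuous B) (hC : Continuous C) (hA : 0 < A) (hK : IsCompact K)
    (hKX : ∀ x, ∃ y ∈ K, B y = B x ∧ C y = C x) {τ : X → X} (hτB : ∀ x, B (τ x) = -B x)
    (hτC : ∀ x, C (τ x) = C x) (h0 : ∀ x, C x < 0)
    (h1 : ∃ x, 0 < A * 1 ^ 2 + B x * 1 + C x) :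
    ∃ m ∈ Ioo (0 : ℝ) 1, ∃ c > 0, ∃ x₀, A * m ^ 2 + B x₀ * m + C x₀ = 0 ∧
      (∀ u, |u| ≤ m → ∀ x, A * u ^ 2 + B x * u + C x ≤ -(c * (m - |u|))) ∧
      (∀ u ≥ m, c * (u - m) ≤ A * u ^ 2 + B x₀ * u + C x₀) ∧
      ∀ u ∈ Ioo (0 : ℝ) 1, (∀ x, A * u ^ 2 + B x * u + C x ≤ 0) →
        (∃ x, A * u ^ 2 + B x * u + C x = 0) → u = m := by
  -- m is the smallest u in [0, 1] at which some member is nonnegative.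
  have hcomp : IsCompact ((Icc (0 : ℝ) 1 ×ˢ K) ∩
      {z : ℝ × X | 0 ≤ A * z.1 ^ 2 + B z.2 * z.1 + C z.2}) :=
    (isCompact_Icc.prod hK).inter_right (isClosed_le continuous_const (by fun_prop))
  obtain ⟨m, ⟨⟨m', x₀⟩, ⟨⟨hm, hx₀⟩, hz⟩, rfl⟩, hmin⟩ :=
    (hcomp.image continuous_fst).exists_isLeast <| by
      obtain ⟨x, hx⟩ := h1
      obtain ⟨y, hy, hxy, hxy'⟩ := hKX x
      refine ⟨1, (1, y), ⟨⟨right_mem_Icc.2 zero_le_one, hy⟩, ?_⟩, rfl⟩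
      simp only [mem_ofPred_eq, hxy, hxy']
      exact hx.le
  simp only [mem_ofPred_eq] at hm hz hmin
  have hlt : ∀ u ∈ Ico 0 m', ∀ x, A * u ^ 2 + B x * u + C x ≤ 0 := by
    intro u hu x
    by_contra! hpos
    obtain ⟨y, hy, e1, e2⟩ := hKX x
    have := hmin ⟨(u, y), ⟨⟨⟨hu.1, hu.2.le.trans hm.2⟩, hy⟩, by
      simp only [mem_ofPred_eq, e1, e2]; exact hpos.le⟩, rfl⟩
    exact not_lt.2 this hu.2
  have hm0 : 0 < m' := hm.1.lt_of_ne fun h => by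
    have := h0 x₀
    rw [← h] at hz
    linarith
  have hle : ∀ x, A * m' ^ 2 + B x * m' + C x ≤ 0 := by
    intro x
    have hlim : Tendsto (fun u => A * u ^ 2 + B x * u + C x) (nhdsWithin m' (Iio m'))
        (nhds (A * m' ^ 2 + B x * m' + C x)) :=
      Continuous.tendsto' (by fun_prop) _ _ rfl |>.mono_left nhdsWithin_le_nhds
    refine le_of_tendsto hlim ?_
    filter_upwards [Ico_mem_nhdsLT hm0] with u hu
    exact hlt u hu x
  have hm1 : m' < 1 := hm.2.lt_of_ne fun h => by
    obtain ⟨x, hx⟩ := h1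
    have := hle x
    rw [h] at this
    linarith
  have hz' : A * m' ^ 2 + B x₀ * m' + C x₀ = 0 := le_antisymm (hle x₀) hz
  obtain ⟨x₁, -, hx₁⟩ := hK.exists_isMaxOn ⟨x₀, hx₀⟩ (f := C) (by fun_prop)
  have hx₁' : ∀ x, C x ≤ C x₁ := fun x => by
    obtain ⟨y, hy, e1, e2⟩ := hKX x
    rw [← e2]
    exact hx₁ hy
  have hη := h0 x₁
  -- By convexity a member lies below its chord over [0, m], which starts at most at max C < 0 and
  -- ends at most at 0; beyond m the member x₀ lies above its extended chord.
  have hpos : ∀ u, 0 ≤ u → u ≤ m' → ∀ x,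
      A * u ^ 2 + B x * u + C x ≤ -(-C x₁ / m' * (m' - u)) := by
    intro u hu0 hu x
    have e : m' * (A * u ^ 2 + B x * u + C x) = u * (A * m' ^ 2 + B x * m' + C x) +
        (m' - u) * C x - A * (u * (m' * (m' - u))) := by ring
    have h2 := mul_nonpos_of_nonneg_of_nonpos hu0 (hle x)
    have h3 := mul_le_mul_of_nonneg_left (hx₁' x) (sub_nonneg.2 hu)
    have h4 := mul_nonneg hA.le (mul_nonneg hu0 (mul_nonneg hm0.le (sub_nonneg.2 hu)))
    have e2 : -(-C x₁ / m' * (m' - u)) = (m' - u) * C x₁ / m' := by ring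
    rw [e2, le_div_iff₀ hm0]
    linarith
  have hge : ∀ u ≥ m', -C x₁ / m' * (u - m') ≤ A * u ^ 2 + B x₀ * u + C x₀ := by
    intro u hu
    have e : m' * (A * u ^ 2 + B x₀ * u + C x₀) = u * (A * m' ^ 2 + B x₀ * m' + C x₀) +
        (u - m') * (-C x₀) + A * (u * (m' * (u - m'))) := by ring
    have h3 := mul_le_mul_of_nonneg_left (hx₁' x₀) (sub_nonneg.2 hu)
    have h4 := mul_nonneg hA.le (mul_nonneg (hm0.le.trans hu) (mul_nonneg hm0.le (sub_nonneg.2 hu)))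
    have e2 : -C x₁ / m' * (u - m') = (u - m') * (-C x₁) / m' := by ring
    rw [e2, div_le_iff₀ hm0]
    rw [hz'] at e
    linarith
  have hc : 0 < -C x₁ / m' := div_pos (neg_pos.2 hη) hm0
  refine ⟨m', ⟨hm0, hm1⟩, -C x₁ / m', hc, x₀, hz', ?_, hge, ?_⟩
  · intro u hu x
    rcases le_total 0 u with h | h
    · rw [abs_of_nonneg h] at hu ⊢
      exact hpos u h hu x
    · rw [abs_of_nonpos h] at hu ⊢
      have := hpos (-u) (neg_nonneg.2 h) hu (τ x)
      rwa [hτB, hτC, neg_mul_neg, neg_sq] at this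
  · rintro u ⟨hu0, hu1⟩ hu ⟨x, hx⟩
    rcases lt_trichotomy u m' with h | h | h
    · have h2 := hpos u hu0.le h.le x
      have h3 := mul_pos hc (sub_pos.2 h)
      linarith
    · exact h
    · have h2 := hge u h.le
      have h3 := mul_pos hc (sub_pos.2 h)
      have h4 := hu x₀
      linarith

end Quadratic

/-! ### Uniform signs, and gaps from a dispersion relation -/

theorem exists_uniform_pos {U X : Type*} [TopologicalSpace U] {s : Set U} (hs : IsCompact s)
    {F : U → X → ℝ} (hF : ∀ x, Continuous fun u => F u x) (h : ∀ u ∈ s, ∃ x, 0 < F u x) :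
    ∃ ε > 0, ∀ u ∈ s, ∃ x, ε < F u x := by
  refine hs.induction_on (p := fun s => ∃ ε > 0, ∀ u ∈ s, ∃ x, ε < F u x)
    ⟨1, one_pos, by simp⟩ ?_ ?_ ?_
  · rintro s t hst ⟨ε, hε, h⟩
    exact ⟨ε, hε, fun u hu => h u (hst hu)⟩
  · rintro s t ⟨ε, hε, h⟩ ⟨ε', hε', h'⟩
    refine ⟨min ε ε', lt_min hε hε', ?_⟩
    rintro u (hu | hu)
    · obtain ⟨x, hx⟩ := h u hu
      exact ⟨x, (min_le_left _ _).trans_lt hx⟩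
    · obtain ⟨x, hx⟩ := h' u hu
      exact ⟨x, (min_le_right _ _).trans_lt hx⟩
  · intro u hu
    obtain ⟨x, hx⟩ := h u hu
    refine ⟨{v | F u x / 2 < F v x}, mem_nhdsWithin_of_mem_nhds ?_, F u x / 2, half_pos hx,
      fun v hv => ⟨x, hv⟩⟩
    exact (isOpen_lt continuous_const (hF x)).mem_nhds (half_lt_self hx)

/-- Gaps of a set of energies `k²` that are given by a dispersion relation `∃ p, G k p = 0`, where
`G` is bounded from below by `c (d - |y|) - C / k` for `|y| ≤ d`, `y = k a - (n π + x₀)`, and takes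
the corresponding negative values for some `p` if `y` is outside this interval. -/
theorem hasAsymptoticGaps_of_dispersion {X : Type*} [TopologicalSpace X] {K : Set X}
    (hK : IsCompact K) {σ : Set ℂ} {G : ℝ → X → ℝ}
    (hσ : ∀ k > 0, ((k ^ 2 : ℝ) : ℂ) ∈ σ ↔ ∃ p, G k p = 0)
    (hG : ContinuousOn (fun z : ℝ × X => G z.1 z.2) (Ioi 0 ×ˢ univ))
    (hKX : ∀ p, ∃ q ∈ K, ∀ k, G k q = G k p)
    {a x₀ d δ c C : ℝ} (ha : 0 < a) (hx₀ : 0 ≤ x₀) (hd : 0 < d) (hδ : 0 < δ) (hc : 0 < c)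
    (hC : 0 ≤ C)
    (h_in : ∀ (n : ℕ) (k : ℝ), 1 ≤ k → |k * a - (n * Real.pi + x₀)| ≤ d → ∀ p,
      c * (d - |k * a - (n * Real.pi + x₀)|) - C / k ≤ G k p)
    (h_right : ∀ n : ℕ, ∃ p, ∀ k, 1 ≤ k → k * a - (n * Real.pi + x₀) ∈ Icc d (d + δ) →
      G k p ≤ -(c * (k * a - (n * Real.pi + x₀) - d)) + C / k)
    (h_left : ∀ n : ℕ, ∃ p, ∀ k, 1 ≤ k → -(k * a - (n * Real.pi + x₀)) ∈ Icc d (d + δ) →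
      G k p ≤ -(c * (-(k * a - (n * Real.pi + x₀)) - d)) + C / k) :
    HasAsymptoticGaps σ
      (fun n => ((n * Real.pi + x₀) ^ 2 - 2 * d * n * Real.pi) / a ^ 2)
      (fun n => ((n * Real.pi + x₀) ^ 2 + 2 * d * n * Real.pi) / a ^ 2) := by
  have hpi := Real.pi_pos
  -- For large n one has k ≥ nπ/(2a) near the gap, so C/k ≤ E/n. The width ε n is chosen such that c
  -- ε n = E/n + 1/n strictly beats this error.
  set E := 2 * a * C / Real.pi with hE
  have hE0 : 0 ≤ E := by positivity
  let ε : ℕ → ℝ := fun n => (E + 1) / (c * n)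
  let κ : ℕ → ℝ → ℝ := fun n y => (n * Real.pi + x₀ + y) / a
  have hκ : ∀ n y, κ n y * a = n * Real.pi + x₀ + y := fun n y => div_mul_cancel₀ _ ha.ne'
  -- the zeros in a compact interval of wave numbers
  have hZ : ∀ k₁ k₂, 0 < k₁ → IsCompact {k | k ∈ Icc k₁ k₂ ∧ ∃ p, G k p = 0} := by
    intro k₁ k₂ hk
    have h1 : ContinuousOn (fun z : ℝ × X => G z.1 z.2) (Icc k₁ k₂ ×ˢ K) :=
      hG.mono (prod_mono (fun k h => hk.trans_le h.1) (subset_univ _))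
    have h2 : IsCompact ((Icc k₁ k₂ ×ˢ K) ∩ (fun z : ℝ × X => G z.1 z.2) ⁻¹' {0}) := by
      have h3 := isCompact_Icc (a := k₁) (b := k₂) |>.prod hK
      have : CompactSpace ↥(Icc k₁ k₂ ×ˢ K) := isCompact_iff_compactSpace.1 h3
      obtain ⟨u, hu, hu'⟩ := continuousOn_iff_isClosed.1 h1 {0} isClosed_singleton
      rw [inter_comm, hu']
      exact h3.inter_left hu
    convert h2.image continuous_fst using 1
    ext k
    constructor
    · rintro ⟨hk, p, hp⟩
      obtain ⟨q, hq, e⟩ := hKX p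
      exact ⟨(k, q), ⟨⟨hk, hq⟩, (e k).trans hp⟩, rfl⟩
    · rintro ⟨⟨k, q⟩, ⟨⟨hk, -⟩, hq⟩, rfl⟩
      exact ⟨hk, q, hq⟩
  have hε : Tendsto ε atTop (nhds 0) := by
    have := (tendsto_const_div_atTop_nhds_zero_nat ((E + 1) / c))
    refine this.congr fun n => ?_
    simp only [ε, div_div]
  have large : ∀ᶠ n : ℕ in atTop, 0 < n ∧ ε n ≤ δ ∧ ε n < d ∧
      ∀ y, |y| ≤ d + δ → 1 ≤ κ n y ∧ C / κ n y ≤ E / n := by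
    have l1 := tendsto_natCast_atTop_atTop (R := ℝ) |>.eventually_ge_atTop
      (2 * (a + d + δ) / Real.pi)
    filter_upwards [eventually_gt_atTop 0, hε.eventually_le_const hδ, hε.eventually_lt_const hd,
      l1] with n hn h1 h2 h3
    have hn' : (0 : ℝ) < n := Nat.cast_pos.2 hn
    refine ⟨hn, h1, h2, fun y hy => ?_⟩
    rw [div_le_iff₀ hpi] at h3
    have hy' := (abs_le.1 hy).1
    have h4 : n * Real.pi / (2 * a) ≤ κ n y := by
      rw [div_le_div_iff₀ (by positivity) ha]
      nlinarith
    refine ⟨?_, ?_⟩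
    · rw [le_div_iff₀ ha]
      nlinarith
    · calc C / κ n y ≤ C / (n * Real.pi / (2 * a)) :=
            div_le_div_of_nonneg_left hC (by positivity) h4
        _ = E / n := by
          rw [hE]
          field_simp
  have hcε : ∀ n : ℕ, 0 < n → c * ε n = E / n + 1 / n := fun n hn => by
    have hn' : (n : ℝ) ≠ 0 := Nat.cast_ne_zero.2 hn.ne'
    simp only [ε]
    field_simp
  have hκmono : ∀ n y z, κ n y ≤ κ n z ↔ y ≤ z := fun n y z => by
    simp only [κ, div_le_div_iff_of_pos_right ha, add_le_add_iff_left]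
  have hy : ∀ n y, κ n y * a - (n * Real.pi + x₀) = y := fun n y => by
    rw [hκ]
    ring
  -- no zeros inside
  have inside : ∀ᶠ n : ℕ in atTop, ∀ y, |y| ≤ d - ε n → ∀ p, 0 < G (κ n y) p := by
    filter_upwards [large] with n ⟨hn, h1, h2, h3⟩ y hyn p
    have hn' : (0 : ℝ) < n := Nat.cast_pos.2 hn
    have hε0 : 0 < ε n := by simp only [ε]; positivity
    have h4 := h3 y (by linarith)
    have h5 := h_in n (κ n y) h4.1 (by rw [hy]; linarith) p
    rw [hy] at h5
    have h6 := hcε n hn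
    have h7 : c * ε n ≤ c * (d - |y|) := mul_le_mul_of_nonneg_left (by linarith) hc.le
    have h8 : (0 : ℝ) < 1 / n := by positivity
    linarith [h4.2]
  have hκc : ∀ n p, ContinuousOn (fun y => G (κ n y) p) {y | 0 < κ n y} := fun n p => by
    refine hG.comp (f := fun y => (κ n y, p)) ?_ fun y hy => ⟨hy, mem_univ _⟩
    simp only [κ]
    fun_prop
  -- For a parameter p that is fixed while k varies, G changes sign between the offsets d - ε n and
  -- d + ε n; compactness then provides a first zero.
  have right : ∀ᶠ n : ℕ in atTop, ∃ β, IsLeast {k | k ∈ Icc (κ n (d - ε n)) (κ n (d + ε n)) ∧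
      ∃ p, G k p = 0} β := by
    filter_upwards [large, inside] with n ⟨hn, h1, h2, h3⟩ h4
    have hn' : (0 : ℝ) < n := Nat.cast_pos.2 hn
    have hε0 : 0 < ε n := by simp only [ε]; positivity
    have hk1 := (h3 (d - ε n) (by rw [abs_of_pos (by linarith)]; linarith)).1
    refine (hZ _ _ (by linarith)).exists_isLeast ?_
    obtain ⟨p, hp⟩ := h_right n
    have h5 := h3 (d + ε n) (by rw [abs_of_pos (by linarith)]; linarith)
    have h6 := hp (κ n (d + ε n)) h5.1 (by rw [hy]; constructor <;> linarith)
    rw [hy, add_sub_cancel_left, hcε n hn] at h6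
    have h7 : (0 : ℝ) < 1 / n := by positivity
    have h8 := h4 (d - ε n) (by rw [abs_of_pos (by linarith)]) p
    obtain ⟨y, hym, hy0⟩ := intermediate_value_Icc' (by linarith : d - ε n ≤ d + ε n)
      ((hκc n p).mono fun y hy => by
        have := (h3 y (by rw [abs_of_pos (by linarith [hy.1])]; linarith [hy.2])).1
        exact zero_lt_one.trans_le this) (mem_Icc.2 ⟨by linarith [h5.2], h8.le⟩)
    exact ⟨κ n y, ⟨(hκmono _ _ _).2 hym.1, (hκmono _ _ _).2 hym.2⟩, p, hy0⟩
  have left : ∀ᶠ n : ℕ in atTop, ∃ α, IsGreatest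
      {k | k ∈ Icc (κ n (-(d + ε n))) (κ n (-(d - ε n))) ∧ ∃ p, G k p = 0} α := by
    filter_upwards [large, inside] with n ⟨hn, h1, h2, h3⟩ h4
    have hn' : (0 : ℝ) < n := Nat.cast_pos.2 hn
    have hε0 : 0 < ε n := by simp only [ε]; positivity
    have h5 := h3 (-(d + ε n)) (by rw [abs_neg, abs_of_pos (by linarith)]; linarith)
    refine (hZ _ _ (by linarith [h5.1])).exists_isGreatest ?_
    obtain ⟨p, hp⟩ := h_left n
    have h6 := hp (κ n (-(d + ε n))) h5.1 (by rw [hy, neg_neg]; constructor <;> linarith)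
    rw [hy, neg_neg, add_sub_cancel_left, hcε n hn] at h6
    have h7 : (0 : ℝ) < 1 / n := by positivity
    have h8 := h4 (-(d - ε n)) (by rw [abs_neg, abs_of_pos (by linarith)]) p
    obtain ⟨y, hym, hy0⟩ := intermediate_value_Icc (by linarith : -(d + ε n) ≤ -(d - ε n))
      ((hκc n p).mono fun y hy => by
        have := (h3 y (by rw [abs_of_neg (by linarith [hy.2])]; linarith [hy.1])).1
        exact zero_lt_one.trans_le this) (mem_Icc.2 ⟨by linarith [h5.2], h8.le⟩)
    exact ⟨κ n y, ⟨(hκmono _ _ _).2 hym.1, (hκmono _ _ _).2 hym.2⟩, p, hy0⟩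
  -- The gap ends are the zeros closest to the centre; the values are meaningful only for those n
  -- for which the windows contain zeros.
  let α : ℕ → ℝ := fun n => sSup
    {k | k ∈ Icc (κ n (-(d + ε n))) (κ n (-(d - ε n))) ∧ ∃ p, G k p = 0}
  let β : ℕ → ℝ := fun n => sInf
    {k | k ∈ Icc (κ n (d - ε n)) (κ n (d + ε n)) ∧ ∃ p, G k p = 0}
  have hα : ∀ᶠ n : ℕ in atTop, IsGreatest
      {k | k ∈ Icc (κ n (-(d + ε n))) (κ n (-(d - ε n))) ∧ ∃ p, G k p = 0} (α n) := by
    filter_upwards [left] with n ⟨k, hk⟩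
    rwa [show α n = k from hk.csSup_eq]
  have hβ : ∀ᶠ n : ℕ in atTop, IsLeast
      {k | k ∈ Icc (κ n (d - ε n)) (κ n (d + ε n)) ∧ ∃ p, G k p = 0} (β n) := by
    filter_upwards [right] with n ⟨k, hk⟩
    rwa [show β n = k from hk.csInf_eq]
  -- Since ε n is of order 1/n, the cross term 2πne in the square stays bounded. The sign t treats
  -- both ends at once.
  have herr : ∃ B : ℝ, ∀ᶠ n : ℕ in atTop, ∀ e, |e| ≤ ε n → ∀ t : ℝ, t = 1 ∨ t = -1 →
      |κ n (t * (d + e)) ^ 2 - ((n * Real.pi + x₀) ^ 2 + t * (2 * d * n * Real.pi)) / a ^ 2| ≤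
        B := by
    refine ⟨(2 * Real.pi * ((E + 1) / c) + 2 * x₀ * (2 * d) + (2 * d) ^ 2) / a ^ 2, ?_⟩
    filter_upwards [large] with n ⟨hn, h1, h2, h3⟩ e he t ht
    have hn' : (0 : ℝ) < n := Nat.cast_pos.2 hn
    have ht2 : t ^ 2 = 1 := by rcases ht with rfl | rfl <;> norm_num
    have ht1 : |t| = 1 := by rcases ht with rfl | rfl <;> norm_num
    have e1 : κ n (t * (d + e)) ^ 2 - ((n * Real.pi + x₀) ^ 2 + t * (2 * d * n * Real.pi)) / a ^ 2 =
        (t * (2 * Real.pi * (n * e)) + t * (2 * x₀ * (d + e)) + (d + e) ^ 2) / a ^ 2 := by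
      simp only [κ]
      rw [div_pow, ← sub_div]
      congr 1
      linear_combination (d + e) ^ 2 * ht2
    have hde : |d + e| ≤ 2 * d := (abs_add_le _ _).trans (by rw [abs_of_pos hd]; linarith)
    have hne : |(n : ℝ) * e| ≤ (E + 1) / c := by
      rw [abs_mul, abs_of_pos hn']
      refine (mul_le_mul_of_nonneg_left he hn'.le).trans (le_of_eq ?_)
      simp only [ε]
      field_simp
    rw [e1, abs_div, abs_of_pos (pow_pos ha 2)]
    refine div_le_div_of_nonneg_right ((abs_add_three _ _ _).trans ?_) (by positivity)
    rw [abs_mul, abs_mul t, ht1, one_mul, one_mul, abs_mul, abs_mul (2 * x₀),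
      abs_of_pos (by positivity : 0 < 2 * Real.pi), abs_of_nonneg (by positivity : 0 ≤ 2 * x₀),
      abs_pow]
    gcongr
  obtain ⟨Bd, hBd⟩ := herr
  refine ⟨fun n => α n ^ 2, fun n => β n ^ 2, ?_, ?_, ?_⟩
  · refine Asymptotics.IsBigO.of_bound Bd ?_
    filter_upwards [hα, hBd] with n h1 h2
    have h3 := h2 (-(α n * a - (n * Real.pi + x₀)) - d) (by
      have h4 := h1.1.1
      simp only [κ, mem_Icc, div_le_iff₀ ha, le_div_iff₀ ha] at h4
      rw [abs_le]
      constructor <;> linarith [h4.1, h4.2]) (-1) (Or.inr rfl)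
    have e : κ n (-1 * (d + (-(α n * a - (n * Real.pi + x₀)) - d))) = α n := by
      simp only [κ]
      field_simp
      ring
    rw [e] at h3
    rw [norm_one, mul_one, Real.norm_eq_abs]
    convert h3 using 4
    ring
  · refine Asymptotics.IsBigO.of_bound Bd ?_
    filter_upwards [hβ, hBd] with n h1 h2
    have h3 := h2 (β n * a - (n * Real.pi + x₀) - d) (by
      have h4 := h1.1.1
      simp only [κ, mem_Icc, div_le_iff₀ ha, le_div_iff₀ ha] at h4
      rw [abs_le]
      constructor <;> linarith [h4.1, h4.2]) 1 (Or.inl rfl)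
    have e : κ n (1 * (d + (β n * a - (n * Real.pi + x₀) - d))) = β n := by
      simp only [κ]
      field_simp
      ring
    rw [e] at h3
    rw [norm_one, mul_one, Real.norm_eq_abs]
    convert h3 using 4
    ring
  · filter_upwards [hα, hβ, large, inside] with n h1 h2 ⟨hn, l1, l2, l3⟩ h4
    have hn' : (0 : ℝ) < n := Nat.cast_pos.2 hn
    have hε0 : 0 < ε n := by simp only [ε]; positivity
    have hα0 : 0 < α n := by
      have h5 := (l3 (-(d + ε n)) (by rw [abs_neg, abs_of_pos (by linarith)]; linarith)).1
      linarith [h1.1.1.1]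
    have hαβ : α n < β n := by
      have h5 : κ n (-(d - ε n)) < κ n (d - ε n) := by
        rw [← not_le, hκmono]
        linarith
      linarith [h1.1.1.2, h2.1.1.1]
    refine ⟨pow_lt_pow_left₀ hαβ hα0.le two_ne_zero, ?_, ?_, ?_⟩
    · rintro e ⟨he1, he2⟩ hmem
      have he0 : 0 ≤ e := (sq_nonneg _).trans he1.le
      have hk1 : α n < √e := Real.lt_sqrt_of_sq_lt he1
      have hk2 : √e < β n := (Real.sqrt_lt' (hα0.trans hαβ)).2 he2
      rw [← Real.sq_sqrt he0, hσ _ (hα0.trans hk1)] at hmem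
      have hy' : √e = κ n (√e * a - (n * Real.pi + x₀)) := by
        simp only [κ]
        field_simp
        ring
      rcases le_or_gt (√e) (κ n (-(d - ε n))) with h5 | h5
      · exact not_le.2 hk1 (h1.2 ⟨⟨h1.1.1.1.trans hk1.le, h5⟩, hmem⟩)
      rcases le_or_gt (κ n (d - ε n)) (√e) with h6 | h6
      · exact not_le.2 hk2 (h2.2 ⟨⟨h6, hk2.le.trans h2.1.1.2⟩, hmem⟩)
      obtain ⟨p, hp⟩ := hmem
      rw [hy'] at h5 h6 hp
      refine absurd hp (h4 _ (abs_le.2 ⟨?_, ?_⟩) p).ne'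
      · exact (hκmono _ _ _).1 h5.le
      · exact (hκmono _ _ _).1 h6.le
    · exact (hσ _ hα0).2 h1.1.2
    · exact (hσ _ (hα0.trans hαβ)).2 h2.1.2

end SquareLattice

end

/-! ### Translation to V₂ and proof of the three cases -/

noncomputable section

namespace SquareLattice

theorem exists_mem_Ioc_Lc_L (T : Matrix (Fin 2) (Fin 2) ℂ) (p : ℝ × ℝ) :
    ∃ q : ℝ × ℝ, q.1 ∈ Ioc (-Real.pi) Real.pi ∧ q.2 ∈ Ioc (-Real.pi) Real.pi ∧
      Lc T q.1 q.2 = Lc T p.1 p.2 ∧ L T q.1 q.2 = L T p.1 p.2 := by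
  obtain ⟨q, h₁, h₂, h⟩ := exists_mem_Ioc_pencilDet 0 T p
  have e₀ := h 0 0
  have e₁ := h 1 0
  rw [pencilDet_zero, pencilDet_zero] at e₀ e₁
  exact ⟨q, h₁, h₂, by linarith, by linarith⟩

theorem Lc_L_add_pi (T : Matrix (Fin 2) (Fin 2) ℂ) (p : ℝ × ℝ) :
    Lc T (p.1 + Real.pi) (p.2 + Real.pi) = -Lc T p.1 p.2 ∧
      L T (p.1 + Real.pi) (p.2 + Real.pi) = L T p.1 p.2 := by
  have e₀ := pencilDet_neg 0 T 0 0 p.1 p.2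
  have e₁ := pencilDet_neg 0 T 1 0 p.1 p.2
  rw [neg_zero, pencilDet_zero, pencilDet_zero] at e₀ e₁
  constructor <;> linarith

theorem continuous_Lc (T : Matrix (Fin 2) (Fin 2) ℂ) :
    Continuous fun p : ℝ × ℝ => Lc T p.1 p.2 := by
  have := continuous_phase
  unfold Lc
  fun_prop

theorem continuous_L (T : Matrix (Fin 2) (Fin 2) ℂ) :
    Continuous fun p : ℝ × ℝ => L T p.1 p.2 := by
  have := continuous_phase
  unfold L
  fun_prop

theorem exists_mem_Ioc_V2 (T : Matrix (Fin 2) (Fin 2) ℂ) (p : ℝ × ℝ) :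
    ∃ q : ℝ × ℝ, q.1 ∈ Ioc (-Real.pi) Real.pi ∧ q.2 ∈ Ioc (-Real.pi) Real.pi ∧
      ∀ x, V2 T x q.1 q.2 = V2 T x p.1 p.2 := by
  obtain ⟨q, h₁, h₂, h⟩ := exists_mem_Ioc_pencilDet 0 T p
  exact ⟨q, h₁, h₂, fun x => by rw [V2_eq_pencilDet 0, V2_eq_pencilDet 0, h]⟩

/-- The factor -4 between V₂ and the determinant turns a vanishing maximum into a vanishing minimum.
-/
theorem V2plus_eq_zero_iff (S T : Matrix (Fin 2) (Fin 2) ℂ) (x : ℝ) :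
    V2plus T x = 0 ↔ (∀ p : ℝ × ℝ, 0 ≤ pencilDet S T (Real.cos x) 0 p.1 p.2) ∧
      ∃ p : ℝ × ℝ, pencilDet S T (Real.cos x) 0 p.1 p.2 = 0 := by
  have h := isGreatest_V2plus T x
  constructor
  · intro h0
    rw [h0] at h
    obtain ⟨⟨t₁, -, t₂, -, h1⟩, h2⟩ := h
    refine ⟨fun p => ?_, (t₁, t₂), ?_⟩
    · obtain ⟨q, hq₁, hq₂, e⟩ := exists_mem_Ioc_V2 T p
      have h3 := h2 ⟨q.1, hq₁, q.2, hq₂, e x⟩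
      rw [V2_eq_pencilDet S] at h3
      linarith
    · rw [V2_eq_pencilDet S] at h1
      linarith
  · rintro ⟨h1, p, hp⟩
    obtain ⟨q, hq₁, hq₂, e⟩ := exists_mem_Ioc_V2 T p
    have h3 := h.2 ⟨q.1, hq₁, q.2, hq₂, e x⟩
    rw [V2_eq_pencilDet S, hp] at h3
    obtain ⟨⟨t₁, -, t₂, -, h4⟩, -⟩ := h
    have h5 := h1 (t₁, t₂)
    rw [V2_eq_pencilDet S] at h4
    linarith

theorem V2minus_eq_zero_iff (S T : Matrix (Fin 2) (Fin 2) ℂ) (x : ℝ) :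
    V2minus T x = 0 ↔ (∀ p : ℝ × ℝ, pencilDet S T (Real.cos x) 0 p.1 p.2 ≤ 0) ∧
      ∃ p : ℝ × ℝ, pencilDet S T (Real.cos x) 0 p.1 p.2 = 0 := by
  have h := isLeast_V2minus T x
  constructor
  · intro h0
    rw [h0] at h
    obtain ⟨⟨t₁, -, t₂, -, h1⟩, h2⟩ := h
    refine ⟨fun p => ?_, (t₁, t₂), ?_⟩
    · obtain ⟨q, hq₁, hq₂, e⟩ := exists_mem_Ioc_V2 T p
      have h3 := h2 ⟨q.1, hq₁, q.2, hq₂, e x⟩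
      rw [V2_eq_pencilDet S] at h3
      linarith
    · rw [V2_eq_pencilDet S] at h1
      linarith
  · rintro ⟨h1, p, hp⟩
    obtain ⟨q, hq₁, hq₂, e⟩ := exists_mem_Ioc_V2 T p
    have h3 := h.2 ⟨q.1, hq₁, q.2, hq₂, e x⟩
    rw [V2_eq_pencilDet S, hp] at h3
    obtain ⟨⟨t₁, -, t₂, -, h4⟩, -⟩ := h
    have h5 := h1 (t₁, t₂)
    rw [V2_eq_pencilDet S] at h4
    linarith

/-- By concavity cos lies above its chord between 0 and b. Beyond b it lies below the extended
chord, which is the next estimate; together they turn linear bounds in u into linear bounds in ka.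
-/
theorem chord_le_cos_sub {b y : ℝ} (hb : 0 < b) (hy : 0 ≤ y) (hyb : y ≤ b)
    (hb' : b ≤ Real.pi / 2) : (1 - Real.cos b) / b * (b - y) ≤ Real.cos y - Real.cos b := by
  have h := strictConcaveOn_cos_Icc.concaveOn.2
    (show (0 : ℝ) ∈ _ from ⟨by linarith, by linarith⟩) (show b ∈ _ from ⟨by linarith, hb'⟩)
    (sub_nonneg.2 ((div_le_one hb).2 hyb)) (div_nonneg hy hb.le) (sub_add_cancel 1 (y / b))
  simp only [smul_eq_mul, mul_zero, zero_add, div_mul_cancel₀ _ hb.ne', Real.cos_zero] at h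
  have e : (1 - Real.cos b) / b * (b - y) =
      (1 - y / b) * 1 + y / b * Real.cos b - Real.cos b := by
    field_simp
    ring
  linarith

theorem chord_le_sub_cos {b y : ℝ} (hb : 0 < b) (hyb : b ≤ y) (hy : y ≤ Real.pi / 2) :
    (1 - Real.cos b) / b * (y - b) ≤ Real.cos b - Real.cos y := by
  have hy0 : 0 < y := hb.trans_le hyb
  have h := strictConcaveOn_cos_Icc.concaveOn.2
    (show (0 : ℝ) ∈ _ from ⟨by linarith, by linarith⟩) (show y ∈ _ from ⟨by linarith, hy⟩)
    (sub_nonneg.2 ((div_le_one hy0).2 hyb)) (div_nonneg hb.le hy0.le) (sub_add_cancel 1 (b / y))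
  simp only [smul_eq_mul, mul_zero, zero_add, div_mul_cancel₀ _ hy0.ne', Real.cos_zero] at h
  have h2 := mul_le_mul_of_nonneg_left h hy0.le
  have e : y * ((1 - b / y) * 1 + b / y * Real.cos y) = y - b + b * Real.cos y := by
    field_simp
  rw [e] at h2
  rw [div_mul_eq_mul_div, div_le_iff₀ hb]
  linarith

/-- The sign of cos ka is absorbed into the phases, which makes all gap centres look alike. -/
theorem exists_pencilDet_neg_one_pow (S T : Matrix (Fin 2) (Fin 2) ℂ) (n : ℕ) (p : ℝ × ℝ) :
    ∃ q : ℝ × ℝ, ∀ u, pencilDet S T ((-1) ^ n * u) 0 q.1 q.2 = pencilDet S T u 0 p.1 p.2 := by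
  rcases neg_one_pow_eq_or ℝ n with h | h
  · exact ⟨p, fun u => by rw [h, one_mul]⟩
  · refine ⟨(p.1 + Real.pi, p.2 + Real.pi), fun u => ?_⟩
    have := pencilDet_neg S T u 0 p.1 p.2
    rw [neg_zero] at this
    rw [h, neg_one_mul]
    exact this

theorem exists_abs_dispersion_sub_le (S T : Matrix (Fin 2) (Fin 2) ℂ) (a : ℝ) :
    ∃ C : ℝ, 0 ≤ C ∧ ∀ k, 1 ≤ k → ∀ p : ℝ × ℝ,
      |pencilDet S T (Real.cos (k * a)) (Real.sin (k * a) / k) p.1 p.2 -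
        pencilDet S T (Real.cos (k * a)) 0 p.1 p.2| ≤ C / k := by
  obtain ⟨C, hC, h⟩ := exists_abs_pencilDet_sub_le S T
  refine ⟨C, hC, fun k hk p => ?_⟩
  have hk0 : 0 < k := zero_lt_one.trans_le hk
  have hs : |Real.sin (k * a) / k| ≤ 1 / k := by
    rw [abs_div, abs_of_pos hk0]
    exact div_le_div_of_nonneg_right (Real.abs_sin_le_one _) hk0.le
  refine (h _ _ _ _ (Real.abs_cos_le_one _) (hs.trans ((div_le_one hk0).2 hk))).trans ?_
  refine (mul_le_mul_of_nonneg_left hs hC).trans (le_of_eq ?_)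
  ring

theorem continuousOn_dispersion (S T : Matrix (Fin 2) (Fin 2) ℂ) (a : ℝ) :
    ContinuousOn (fun z : ℝ × ℝ × ℝ => pencilDet S T (Real.cos (z.1 * a))
      (Real.sin (z.1 * a) / z.1) z.2.1 z.2.2) (Ioi 0 ×ˢ univ) := by
  refine (continuous_pencilDet S T).comp_continuousOn (f := fun z : ℝ × ℝ × ℝ =>
    (Real.cos (z.1 * a), Real.sin (z.1 * a) / z.1, z.2.1, z.2.2)) ?_
  have h : ContinuousOn (fun z : ℝ × ℝ × ℝ => Real.sin (z.1 * a) / z.1) (Ioi 0 ×ˢ univ) :=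
    ContinuousOn.div (by fun_prop) (by fun_prop) fun z hz => (ne_of_gt hz.1)
  fun_prop

theorem half_line_subset_spectrum {a : ℝ} (ha : 0 < a) {S T : Matrix (Fin 2) (Fin 2) ℂ}
    (hS : S.IsHermitian) (h0 : Kc T < L0plus T) (h1 : Lpi2minus T < -Ks T) :
    ∃ k₀ : ℝ, 0 < k₀ ∧ ∀ E : ℝ, k₀ ^ 2 ≤ E → (E : ℂ) ∈ opSpectrum (hamiltonian a S T) := by
  have hA : 0 < (Kc T + Ks T) / 4 := by
    unfold Kc Ks
    positivity
  have hKs : 0 < Ks T := by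
    unfold Ks
    positivity
  have key := fun u (hu : |u| ≤ 1) => exists_quadratic_neg_and_pos (X := ℝ × ℝ)
    (B := fun p => -Lc T p.1 p.2 / 4)
    (C := fun p => -(L T p.1 p.2 + Ks T) / 4) hA (τ := fun p => (p.1 + Real.pi, p.2 + Real.pi))
    (fun p => by simp only [(Lc_L_add_pi T p).1]; ring)
    (fun p => by simp only [(Lc_L_add_pi T p).2])
    (fun u hu hp p => derivative_pos_of_pencilDet_nonneg (S := 0) hu
      (fun θ₁ θ₂ => by rw [pencilDet_zero]; exact hp (θ₁, θ₂)) p.1 p.2)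
    (by
      obtain ⟨t₁, t₂, h⟩ := exists_L_nonneg T
      exact ⟨(t₁, t₂), by simp only; linarith⟩)
    (by
      obtain ⟨t₁, -, t₂, -, h⟩ := (isLeast_Lpi2minus T).1
      exact ⟨(t₁, t₂), by simp only; linarith⟩)
    (by
      obtain ⟨t₁, -, t₂, -, h⟩ := (isGreatest_L0plus T).1
      exact ⟨(t₁, t₂), by simp only at h ⊢; linarith⟩) hu
  simp only [← pencilDet_zero S T] at key
  have hc : ∀ p : ℝ × ℝ, Continuous fun u => pencilDet S T u 0 p.1 p.2 := fun p => by
    simp only [pencilDet_zero]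
    fun_prop
  obtain ⟨ε, hε, hpos⟩ := exists_uniform_pos (isCompact_Icc (a := (-1 : ℝ)) (b := 1)) hc
    fun u hu => (key u (abs_le.2 hu)).2
  obtain ⟨ε', hε', hneg⟩ := exists_uniform_pos (isCompact_Icc (a := (-1 : ℝ)) (b := 1))
    (F := fun u (p : ℝ × ℝ) => -pencilDet S T u 0 p.1 p.2) (fun p => (hc p).neg) fun u hu => by
      obtain ⟨p, hp⟩ := (key u (abs_le.2 hu)).1
      exact ⟨p, neg_pos.2 hp⟩
  obtain ⟨C, hC, hCk⟩ := exists_abs_dispersion_sub_le S T a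
  -- This threshold ensures both √E ≥ 1 and C/√E ≤ min ε ε', so the perturbation by S cannot change
  -- the two signs.
  refine ⟨C / min ε ε' + 1, by positivity, fun E hE => ?_⟩
  have hk1 : C / min ε ε' + 1 ≤ √E := Real.le_sqrt_of_sq_le hE
  have hm : 0 < min ε ε' := lt_min hε hε'
  have hk2 : 1 ≤ √E := le_trans (le_add_of_nonneg_left (by positivity)) hk1
  have hk0 : 0 < √E := zero_lt_one.trans_le hk2
  have hCε : C / √E ≤ min ε ε' := by
    rw [div_le_iff₀ hk0]
    have : C / min ε ε' ≤ √E := by linarith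
    rw [div_le_iff₀ hm] at this
    linarith
  have hu := abs_le.1 (Real.abs_cos_le_one (√E * a))
  obtain ⟨p, hp⟩ := hpos _ hu
  obtain ⟨p', hp'⟩ := hneg _ hu
  have c1 := (abs_le.1 (hCk _ hk2 p)).1
  have c2 := (abs_le.1 (hCk _ hk2 p')).2
  have hcont : Continuous fun p : ℝ × ℝ =>
      pencilDet S T (Real.cos (√E * a)) (Real.sin (√E * a) / √E) p.1 p.2 :=
    (continuous_pencilDet S T).comp (f := fun p : ℝ × ℝ =>
      (Real.cos (√E * a), Real.sin (√E * a) / √E, p.1, p.2)) (by fun_prop)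
  obtain ⟨q, hq⟩ := mem_range_of_exists_le_of_exists_ge hcont
    (c := 0) ⟨p', by linarith [min_le_right ε ε']⟩ ⟨p, by linarith [min_le_left ε ε']⟩
  have hE0 : 0 ≤ E := (Real.sqrt_pos.1 hk0).le
  rw [← Real.sq_sqrt hE0]
  exact (mem_opSpectrum_iff ha hk0 hS).2 ⟨q.1, q.2, hq⟩

theorem mem_opSpectrum_iff_exists_pair {a : ℝ} (ha : 0 < a) {S T : Matrix (Fin 2) (Fin 2) ℂ}
    (hS : S.IsHermitian) (k : ℝ) (hk : 0 < k) :
    ((k ^ 2 : ℝ) : ℂ) ∈ opSpectrum (hamiltonian a S T) ↔ ∃ p : ℝ × ℝ,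
      pencilDet S T (Real.cos (k * a)) (Real.sin (k * a) / k) p.1 p.2 = 0 := by
  rw [mem_opSpectrum_iff ha hk hS, Prod.exists]

/-- Here b = arccos M for the largest zero M: near ka = nπ the determinant is positive as long as
|cos ka| > M. -/
theorem gaps_at_band_edge_zero {a : ℝ} (ha : 0 < a) {S T : Matrix (Fin 2) (Fin 2) ℂ}
    (hS : S.IsHermitian) (h0 : L0plus T < Kc T) :
    ∃ b ∈ Ioo 0 (Real.pi / 2), V2plus T b = 0 ∧
      (∀ b' ∈ Ioo 0 (Real.pi / 2), V2plus T b' = 0 → b' = b) ∧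
      HasAsymptoticGaps (opSpectrum (hamiltonian a S T))
        (fun n => ((n * Real.pi + 0) ^ 2 - 2 * b * n * Real.pi) / a ^ 2)
        (fun n => ((n * Real.pi + 0) ^ 2 + 2 * b * n * Real.pi) / a ^ 2) := by
  have hA : 0 < (Kc T + Ks T) / 4 := by
    unfold Kc Ks
    positivity
  have hKs : 0 < Ks T := by
    unfold Ks
    positivity
  have key := exists_last_zero (X := ℝ × ℝ) (K := torusSquare)
    (B := fun p => -Lc T p.1 p.2 / 4) (C := fun p => -(L T p.1 p.2 + Ks T) / 4)
    (((continuous_Lc T).neg).div_const 4) (((continuous_L T).add_const _).neg.div_const 4) hA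
    isCompact_torusSquare
    (fun p => by
      obtain ⟨q, h₁, h₂, e₁, e₂⟩ := exists_mem_Ioc_Lc_L T p
      exact ⟨q, ⟨Ioc_subset_Icc_self h₁, Ioc_subset_Icc_self h₂⟩, by simp only [e₁],
        by simp only [e₂]⟩)
    (by
      obtain ⟨t₁, t₂, h⟩ := exists_L_nonneg T
      exact ⟨(t₁, t₂), by simp only; linarith⟩)
    (fun p => by
      obtain ⟨q, h₁, h₂, e₁, e₂⟩ := exists_mem_Ioc_Lc_L T p
      have := (isGreatest_L0plus T).2 ⟨q.1, h₁, q.2, h₂, rfl⟩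
      simp only [e₁, e₂] at this
      linarith)
    (fun u hu hp p => derivative_pos_of_pencilDet_nonneg (S := 0) hu
      (fun θ₁ θ₂ => by rw [pencilDet_zero]; exact hp (θ₁, θ₂)) p.1 p.2)
  simp only [← pencilDet_zero S T] at key
  obtain ⟨M, ⟨hM0, hM1⟩, c, hc, δ, hδ, p₀, hp₀, hge, hle, huniq⟩ := key
  have hcosb : Real.cos (Real.arccos M) = M := Real.cos_arccos (by linarith) hM1.le
  have hb0 : 0 < Real.arccos M := Real.arccos_pos.2 hM1
  have hb1 : Real.arccos M < Real.pi / 2 := Real.arccos_lt_pi_div_two.2 hM0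
  set b := Real.arccos M
  have hpi := Real.pi_pos
  obtain ⟨C, hC, hCk⟩ := exists_abs_dispersion_sub_le S T a
  have hc' : 0 < (1 - Real.cos b) / b := div_pos (by linarith) hb0
  have hcos : ∀ (n : ℕ) (k : ℝ), Real.cos (k * a) =
      (-1) ^ n * Real.cos |k * a - (n * Real.pi + 0)| := fun n k => by
    rw [Real.cos_abs, ← Real.cos_add_nat_mul_pi]
    congr 1
    ring
  refine ⟨b, ⟨hb0, hb1⟩, (V2plus_eq_zero_iff S T b).2 ?_, fun b' hb' h => ?_, ?_⟩
  · rw [hcosb]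
    exact ⟨fun p => by simpa using hge M le_rfl p, p₀, hp₀⟩
  · have h1 : Real.cos b' ∈ Ioo (0 : ℝ) 1 := by
      refine ⟨Real.cos_pos_of_mem_Ioo ⟨by linarith [hb'.1], hb'.2⟩, ?_⟩
      rw [← Real.cos_zero]
      exact Real.cos_lt_cos_of_nonneg_of_le_pi_div_two le_rfl hb'.2.le hb'.1
    obtain ⟨h2, h3⟩ := (V2plus_eq_zero_iff S T b').1 h
    have h4 := huniq _ h1 h2 h3
    rw [← hcosb] at h4
    exact Real.injOn_cos ⟨hb'.1.le, by linarith [hb'.2]⟩ ⟨hb0.le, by linarith⟩ h4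
  -- Cosine is even, so one p serves both sides of the centre. The window keeps |ka - nπ| ≤ π/2 for
  -- the chord estimate and cos within δ of M.
  · have hout : ∀ (n : ℕ), ∃ p : ℝ × ℝ, ∀ k, 1 ≤ k →
        |k * a - (n * Real.pi + 0)| ∈ Icc b (b + min δ (Real.pi / 2 - b)) →
        pencilDet S T (Real.cos (k * a)) (Real.sin (k * a) / k) p.1 p.2 ≤
          -(c * ((1 - Real.cos b) / b) * (|k * a - (n * Real.pi + 0)| - b)) + C / k := by
      intro n
      obtain ⟨p, hp⟩ := exists_pencilDet_neg_one_pow S T n p₀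
      refine ⟨p, fun k hk hy => ?_⟩
      have h1 := (abs_le.1 (hCk k hk p)).2
      have e := hp (Real.cos |k * a - (n * Real.pi + 0)|)
      rw [← hcos] at e
      generalize |k * a - (n * Real.pi + 0)| = y at hy e ⊢
      have h2 : y ≤ Real.pi / 2 := by linarith [hy.2, min_le_right δ (Real.pi / 2 - b)]
      have h3 := mul_le_mul_of_nonneg_left (chord_le_sub_cos hb0 hy.1 h2) hc.le
      have h4 : Real.cos b - Real.cos y ≤ y - b := by
        have := Real.abs_cos_sub_cos_le b y
        rw [abs_sub_comm b y, abs_of_nonneg (sub_nonneg.2 hy.1)] at this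
        exact (le_abs_self _).trans this
      have h5 : Real.cos y ≤ Real.cos b :=
        Real.cos_le_cos_of_nonneg_of_le_pi hb0.le (by linarith) hy.1
      have h6 := hle (Real.cos y) ⟨by linarith [hy.2, min_le_left δ (Real.pi / 2 - b)],
        by linarith⟩
      rw [← hcosb] at h6
      linarith
    refine hasAsymptoticGaps_of_dispersion isCompact_torusSquare
      (mem_opSpectrum_iff_exists_pair ha hS) (continuousOn_dispersion S T a) (fun p => ?_) ha
      le_rfl hb0 (lt_min hδ (sub_pos.2 hb1)) (mul_pos hc hc') hC ?_ ?_ ?_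
    · obtain ⟨q, hq, h⟩ := exists_mem_torusSquare S T p
      exact ⟨q, hq, fun k => h _ _⟩
    · intro n k hk hy p
      have h1 := (abs_le.1 (hCk k hk p)).1
      obtain ⟨q, hq⟩ := exists_pencilDet_neg_one_pow S T n p
      have e := hq (Real.cos (k * a))
      rw [hcos n k, ← mul_assoc, ← pow_add, Even.neg_one_pow ⟨n, rfl⟩, one_mul, ← hcos n k] at e
      have hy0 := abs_nonneg (k * a - (n * Real.pi + 0))
      generalize |k * a - (n * Real.pi + 0)| = y at hy hy0 e ⊢
      have h3 := mul_le_mul_of_nonneg_left (chord_le_cos_sub hb0 hy0 hy hb1.le) hc.le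
      have h5 : Real.cos b ≤ Real.cos y :=
        Real.cos_le_cos_of_nonneg_of_le_pi hy0 (by linarith) hy
      have h6 := hge (Real.cos y) (by linarith) q
      rw [← hcosb] at h6
      linarith
    · intro n
      obtain ⟨p, hp⟩ := hout n
      refine ⟨p, fun k hk hy => ?_⟩
      have := hp k hk
      rw [abs_of_nonneg (hb0.le.trans hy.1)] at this
      exact this hy
    · intro n
      obtain ⟨p, hp⟩ := hout n
      refine ⟨p, fun k hk hy => ?_⟩
      have := hp k hk
      rw [abs_of_nonpos (neg_nonneg.1 (hb0.le.trans hy.1))] at this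
      exact this hy

/-- Near ka = (n + 1/2)π the determinant is negative while |cos ka| < m = cos b, and |cos ka| is the
sine of the distance to the centre; hence c = π/2 - b. Kc > 0 yields a positive value at u = 1, so
the first zero lies below 1. -/
theorem gaps_at_band_edge_half {a : ℝ} (ha : 0 < a) {S T : Matrix (Fin 2) (Fin 2) ℂ}
    (hS : S.IsHermitian) (hK : 0 < Kc T) (h0 : -Ks T < Lpi2minus T) :
    ∃ c ∈ Ioo 0 (Real.pi / 2), V2minus T (Real.pi / 2 - c) = 0 ∧
      (∀ c' ∈ Ioo 0 (Real.pi / 2), V2minus T (Real.pi / 2 - c') = 0 → c' = c) ∧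
      HasAsymptoticGaps (opSpectrum (hamiltonian a S T))
        (fun n => ((n * Real.pi + Real.pi / 2) ^ 2 - 2 * c * n * Real.pi) / a ^ 2)
        (fun n => ((n * Real.pi + Real.pi / 2) ^ 2 + 2 * c * n * Real.pi) / a ^ 2) := by
  have hA : 0 < (Kc T + Ks T) / 4 := by
    unfold Kc Ks
    positivity
  have key := exists_first_zero (X := ℝ × ℝ) (K := torusSquare)
    (B := fun p => -Lc T p.1 p.2 / 4) (C := fun p => -(L T p.1 p.2 + Ks T) / 4)
    (((continuous_Lc T).neg).div_const 4) (((continuous_L T).add_const _).neg.div_const 4) hA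
    isCompact_torusSquare
    (fun p => by
      obtain ⟨q, h₁, h₂, e₁, e₂⟩ := exists_mem_Ioc_Lc_L T p
      exact ⟨q, ⟨Ioc_subset_Icc_self h₁, Ioc_subset_Icc_self h₂⟩, by simp only [e₁],
        by simp only [e₂]⟩)
    (τ := fun p => (p.1 + Real.pi, p.2 + Real.pi))
    (fun p => by simp only [(Lc_L_add_pi T p).1]; ring)
    (fun p => by simp only [(Lc_L_add_pi T p).2])
    (fun p => by
      obtain ⟨q, h₁, h₂, e₁, e₂⟩ := exists_mem_Ioc_Lc_L T p
      have := (isLeast_Lpi2minus T).2 ⟨q.1, h₁, q.2, h₂, rfl⟩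
      rw [e₂] at this
      linarith)
    (by
      obtain ⟨t₁, t₂, h⟩ := exists_Lc_add_L_nonpos T
      exact ⟨(t₁, t₂), by simp only; linarith⟩)
  simp only [← pencilDet_zero S T] at key
  obtain ⟨m, ⟨hm0, hm1⟩, c, hc, p₀, hp₀, hle, hge, huniq⟩ := key
  have hcosb : Real.cos (Real.arccos m) = m := Real.cos_arccos (by linarith) hm1.le
  have hb0 : 0 < Real.arccos m := Real.arccos_pos.2 hm1
  have hb1 : Real.arccos m < Real.pi / 2 := Real.arccos_lt_pi_div_two.2 hm0
  set b := Real.arccos m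
  have hpi := Real.pi_pos
  obtain ⟨C, hC, hCk⟩ := exists_abs_dispersion_sub_le S T a
  have hc' : 0 < (1 - Real.cos b) / b := div_pos (by linarith) hb0
  have hcos : ∀ (n : ℕ) (k : ℝ), Real.cos (k * a) =
      (-1) ^ (n + 1) * Real.sin (k * a - (n * Real.pi + Real.pi / 2)) := fun n k => by
    have : k * a = k * a - (n * Real.pi + Real.pi / 2) + Real.pi / 2 + n * Real.pi := by ring
    conv_lhs => rw [this]
    rw [Real.cos_add_nat_mul_pi, Real.cos_add_pi_div_two]
    ring
  refine ⟨Real.pi / 2 - b, ⟨by linarith, by linarith⟩, ?_, fun c' hc' h => ?_, ?_⟩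
  · rw [sub_sub_cancel, V2minus_eq_zero_iff S T b, hcosb]
    exact ⟨fun p => by simpa [abs_of_pos hm0] using hle m (abs_of_pos hm0).le p, p₀, hp₀⟩
  · have h1 : Real.cos (Real.pi / 2 - c') ∈ Ioo (0 : ℝ) 1 := by
      refine ⟨Real.cos_pos_of_mem_Ioo ⟨by linarith [hc'.2], by linarith [hc'.1]⟩, ?_⟩
      rw [← Real.cos_zero]
      exact Real.cos_lt_cos_of_nonneg_of_le_pi_div_two le_rfl (by linarith [hc'.1])
        (by linarith [hc'.2])
    obtain ⟨h2, h3⟩ := (V2minus_eq_zero_iff S T _).1 h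
    have h4 := huniq _ h1 h2 h3
    rw [← hcosb] at h4
    have := Real.injOn_cos ⟨by linarith [hc'.2], by linarith [hc'.1]⟩
      ⟨hb0.le, by linarith⟩ h4
    linarith
  -- G is the negative of the determinant, so that it is positive inside the gaps. With half-width d
  -- = π/2 - b, the choice δ = b lets the distance to the centre reach π/2, the limit of the chord
  -- estimates.
  · refine hasAsymptoticGaps_of_dispersion isCompact_torusSquare
      (G := fun k p => -pencilDet S T (Real.cos (k * a)) (Real.sin (k * a) / k) p.1 p.2)
      (δ := b) (C := C) (fun k hk => ?_) (continuousOn_dispersion S T a).neg (fun p => ?_) ha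
      (by positivity) (by linarith) hb0 (mul_pos hc hc') hC ?_ ?_ ?_
    · simp only [neg_eq_zero]
      exact mem_opSpectrum_iff_exists_pair ha hS k hk
    · obtain ⟨q, hq, h⟩ := exists_mem_torusSquare S T p
      exact ⟨q, hq, fun k => congrArg _ (h _ _)⟩
    · intro n k hk hy p
      have h1 := (abs_le.1 (hCk k hk p)).2
      have hu : |Real.cos (k * a)| =
          Real.cos (Real.pi / 2 - |k * a - (n * Real.pi + Real.pi / 2)|) := by
        rw [hcos n k, abs_mul, abs_pow, abs_neg, abs_one, one_pow, one_mul,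
          Real.cos_pi_div_two_sub, Real.abs_sin_eq_sin_abs_of_abs_le_pi (by linarith)]
      have hy0 := abs_nonneg (k * a - (n * Real.pi + Real.pi / 2))
      generalize |k * a - (n * Real.pi + Real.pi / 2)| = y at hy hy0 hu ⊢
      have h3 := mul_le_mul_of_nonneg_left (chord_le_sub_cos hb0 (y := Real.pi / 2 - y)
        (by linarith) (by linarith)) hc.le
      have h5 : Real.cos (Real.pi / 2 - y) ≤ Real.cos b :=
        Real.cos_le_cos_of_nonneg_of_le_pi hb0.le (by linarith) (by linarith)
      have h6 := hle (Real.cos (k * a)) (by linarith) p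
      rw [hu, ← hcosb] at h6
      rw [show Real.pi / 2 - b - y = Real.pi / 2 - y - b by ring]
      linarith
    · intro n
      obtain ⟨p, hp⟩ := exists_pencilDet_neg_one_pow S T (n + 1) p₀
      refine ⟨p, fun k hk hy => ?_⟩
      have h1 := (abs_le.1 (hCk k hk p)).1
      have e := hp (Real.sin (k * a - (n * Real.pi + Real.pi / 2)))
      rw [← hcos, ← Real.cos_pi_div_two_sub] at e
      generalize k * a - (n * Real.pi + Real.pi / 2) = y at hy e ⊢
      have h3 := mul_le_mul_of_nonneg_left (chord_le_cos_sub hb0 (y := Real.pi / 2 - y)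
        (by linarith [hy.2]) (by linarith [hy.1]) hb1.le) hc.le
      have h5 : Real.cos b ≤ Real.cos (Real.pi / 2 - y) :=
        Real.cos_le_cos_of_nonneg_of_le_pi (by linarith [hy.2]) (by linarith) (by linarith [hy.1])
      have h6 := hge _ (by linarith : m ≤ Real.cos (Real.pi / 2 - y))
      rw [← hcosb] at h6
      rw [show y - (Real.pi / 2 - b) = b - (Real.pi / 2 - y) by ring]
      linarith
    · intro n
      obtain ⟨p, hp⟩ := exists_pencilDet_neg_one_pow S T n p₀
      refine ⟨p, fun k hk hy => ?_⟩
      have h1 := (abs_le.1 (hCk k hk p)).1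
      have e := hp (Real.sin (-(k * a - (n * Real.pi + Real.pi / 2))))
      have e2 : (-1) ^ n * Real.sin (-(k * a - (n * Real.pi + Real.pi / 2))) =
          Real.cos (k * a) := by
        rw [hcos n k, Real.sin_neg]
        ring
      rw [e2, ← Real.cos_pi_div_two_sub] at e
      generalize -(k * a - (n * Real.pi + Real.pi / 2)) = y at hy e ⊢
      have h3 := mul_le_mul_of_nonneg_left (chord_le_cos_sub hb0 (y := Real.pi / 2 - y)
        (by linarith [hy.2]) (by linarith [hy.1]) hb1.le) hc.le
      have h5 : Real.cos b ≤ Real.cos (Real.pi / 2 - y) :=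
        Real.cos_le_cos_of_nonneg_of_le_pi (by linarith [hy.2]) (by linarith) (by linarith [hy.1])
      have h6 := hge _ (by linarith : m ≤ Real.cos (Real.pi / 2 - y))
      rw [← hcosb] at h6
      rw [show y - (Real.pi / 2 - b) = b - (Real.pi / 2 - y) by ring]
      linarith

theorem Kc_pos {T : Matrix (Fin 2) (Fin 2) ℂ} {i j : Fin 2} (h : T i j ≠ 0) : 0 < Kc T := by
  have h1 : 0 < ‖T i j‖ ^ 2 := by positivity
  unfold Kc
  fin_cases i <;> fin_cases j <;> simp only [Fin.zero_eta, Fin.mk_one, Fin.isValue] at h1 <;>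
    positivity

end SquareLattice

end

theorem propositionm2 (a : ℝ) (ha : 0 < a) (S T : Matrix (Fin 2) (Fin 2) ℂ)
    (hS : S.IsHermitian)
    (hT : ∃ p q : Fin 2 × Fin 2, p ≠ q ∧ T p.1 p.2 ≠ 0 ∧ T q.1 q.2 ≠ 0) :
    (SquareLattice.Kc T < SquareLattice.L0plus T →
      SquareLattice.Lpi2minus T < -SquareLattice.Ks T →
      ∃ k₀ : ℝ, 0 < k₀ ∧ ∀ E : ℝ, k₀ ^ 2 ≤ E →
        (E : ℂ) ∈ SquareLattice.opSpectrum (SquareLattice.hamiltonian a S T)) ∧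
    (SquareLattice.L0plus T < SquareLattice.Kc T →
      ∃ b ∈ Set.Ioo 0 (Real.pi / 2), SquareLattice.V2plus T b = 0 ∧
        (∀ b' ∈ Set.Ioo 0 (Real.pi / 2), SquareLattice.V2plus T b' = 0 → b' = b) ∧
        SquareLattice.HasAsymptoticGaps
          (SquareLattice.opSpectrum (SquareLattice.hamiltonian a S T))
          (fun n => (n : ℝ) ^ 2 * Real.pi ^ 2 / a ^ 2 - 2 * b * n * Real.pi / a ^ 2)
          (fun n => (n : ℝ) ^ 2 * Real.pi ^ 2 / a ^ 2 + 2 * b * n * Real.pi / a ^ 2)) ∧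
    (-SquareLattice.Ks T < SquareLattice.Lpi2minus T →
      ∃ c ∈ Set.Ioo 0 (Real.pi / 2), SquareLattice.V2minus T (Real.pi / 2 - c) = 0 ∧
        (∀ c' ∈ Set.Ioo 0 (Real.pi / 2),
          SquareLattice.V2minus T (Real.pi / 2 - c') = 0 → c' = c) ∧
        SquareLattice.HasAsymptoticGaps
          (SquareLattice.opSpectrum (SquareLattice.hamiltonian a S T))
          (fun n => ((n : ℝ) + 1 / 2) ^ 2 * Real.pi ^ 2 / a ^ 2 - 2 * c * n * Real.pi / a ^ 2)
          (fun n => ((n : ℝ) + 1 / 2) ^ 2 * Real.pi ^ 2 / a ^ 2 + 2 * c * n * Real.pi / a ^ 2)) := by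
  refine ⟨SquareLattice.half_line_subset_spectrum ha hS, fun h => ?_, fun h => ?_⟩
  · obtain ⟨b, hb, h1, h2, h3⟩ := SquareLattice.gaps_at_band_edge_zero ha hS h
    refine ⟨b, hb, h1, h2, ?_⟩
    convert h3 using 2 with n n <;> ring
  · obtain ⟨⟨i, j⟩, -, -, hij, -⟩ := hT
    obtain ⟨c, hc, h1, h2, h3⟩ :=
      SquareLattice.gaps_at_band_edge_half ha hS (SquareLattice.Kc_pos hij) h
    refine ⟨c, hc, h1, h2, ?_⟩
    convert h3 using 2 with n n <;> ring
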